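/- **Setting.** Consider an $m$-player general-sum imperfect-information extensive-form game of horizon $H$: a finite partially observable Markov game with layered states $s_h$ ($1\le h\le H$), where player $i$ at $s_h$ sees only her infoset $x_{i,h}=x_i(s_h)$ (every infoset is that of some state) and chooses an action from a nonempty finite set $\mathcal A_i$; given the state and the joint action, the players receive random rewards $r_{i,h}\in[0,1]$ and the state moves to the next layer. The game has tree structure (every state is preceded by a unique history of states and joint actions) and perfect recall (every infoset of player $i$ is preceded by a unique history of her infosets and actions). Player $i$ has $X_i$ infosets in total and $A_i$ actions. A policy $\pi_i$ of player $i$ gives an action distribution at each of her infosets, and $\pi_{i,1:h}(x_h,a_h)=\prod_{h'\le h}\pi_i(a_{h'}|x_{h'})$ along the history of $x_h$. $V_i^\pi$ is the expected total reward of player $i$ under the (possibly correlated) joint policy $\pi$. A joint policy $\pi$ is an $\varepsilon$-NFCCE if ${\rm CCEGap}(\pi)=\max_i\big(\max_{\pi_i^\dagger}V_i^{\pi_i^\dagger,\pi_{-i}}-V_i^\pi\big)\le\varepsilon$. For a layer $h$ let $\mathcal C_h(x,a)$ be the set of infosets of layer $h$ reachable from $(x,a)$ and $\mathcal C_h(x)=\bigcup_a\mathcal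 C_h(x,a)$. The balanced exploration policy $\pi_i^{\star,h}$ plays $a$ at $x$ with probability $|\mathcal C_h(x,a)|/|\mathcal C_h(x)|$ in layers before $h$, and uniformly from layer $h$ on. **Balanced OMD.** The policies $\pi_i^1$ are uniform. In round $t=1,\dots,T$ all players play one episode with $\pi^t=\prod_i\pi_i^t$. Each player $i$ observes her own trajectory $(x_1^t,a_1^t,r_1^t,\dots,x_H^t,a_H^t,r_H^t)$ and sets $$\widetilde\ell_h^t(x_h,a_h)=\frac{\mathbf 1\{(x_h^t,a_h^t)=(x_h,a_h)\}(1-r_h^t)}{\pi^t_{i,1:h}(x_h,a_h)+\gamma_i\,\pi^{\star,h}_{i,1:h}(x_h,a_h)},$$ $$\pi_i^{t+1}\in\arg\min_{\mu}\ \sum_{h,x_h,a_h}\mu_{1:h}(x_h,a_h)\,\widetilde\ell^t_h(x_h,a_h)+\frac1{\eta_i}\sum_{h,x_h,a_h}\frac{\mu_{1:h}(x_h,a_h)}{\pi^{\star,h}_{i,1:h}(x_h,a_h)}\log\frac{\mu(a_h|x_h)}{\pi_i^t(a_h|x_h)}.$$ **Balanced CFR with Hedge.** The policies $\pi_i^1$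 are uniform. In round $t=1,\dots,T$, each player $i$ in turn and for each layer $h$, one episode is played in which player $i$ plays $\pi_i^{\star,h}$ in layers $\le h$ and $\pi_i^t$ in layers $>h$, while every other player $j$ plays $\pi_j^t$. From player $i$'s trajectory $(x_{h'}^{t,h},a_{h'}^{t,h},r_{h'}^{t,h})_{h'}$ in that episode set $$\widetilde L_h^t(x_h,a_h)=\frac{\mathbf 1\{(x_h^{t,h},a_h^{t,h})=(x_h,a_h)\}}{\pi^{\star,h}_{i,1:h}(x_h,a_h)}\Big(H-h+1-\sum_{h'=h}^H r_{h'}^{t,h}\Big).$$ After the round, $\pi_i^{t+1}(a|x_h)\propto_a\pi_i^t(a|x_h)\exp\big(-\eta_i\,\pi^{\star,h}_{i,1:h}(x_h,a)\,\widetilde L_h^t(x_h,a)\big)$ for all $h$ and $x_h$. **Theorem.** There are absolute constants $C,C'>0$ such that the following holds for all such games, all $\varepsilon>0$, $\delta\in(0,1)$ and $T\ge1$. Let $\bar\pi$ be the joint policy that plays one of $\pi^1,\dots,\pi^T$ chosen uniformly at random, where $\pi^t=\prod_i\pi^t_i$. (a) Let all players run Balanced OMD for $T$ rounds with $\eta_i=\sqrt{X_iA_i\log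 A_i/(H^3T)}$ and $\gamma_i=\sqrt{X_iA_i\iota/(HT)}$, where $\iota=\log(3H\sum_iX_iA_i/\delta)$. If $T\ge C\,H^3\iota\,(\max_iX_iA_i)/\varepsilon^2$, then ${\rm CCEGap}(\bar\pi)\le\varepsilon$ with probability at least $1-\delta$. The number of episodes is $T$. (b) Let all players run Balanced CFR with Hedge for $T$ rounds with $\eta_i=\sqrt{X_iA_i\iota/(H^3T)}$, where $\iota=\log(10\sum_iX_iA_i/\delta)$. If $T\ge C\,H^3\iota\,(\max_iX_iA_i)/\varepsilon^2$, then ${\rm CCEGap}(\bar\pi)\le\varepsilon$ with probability at least $1-\delta$. The total number of episodes played is $mHT$. If $\varepsilon\le H$ and $T=\lceil C\,H^3\iota\,(\max_iX_iA_i)/\varepsilon^2\rceil$, this number is at most $C'H^4m\,\iota\,(\max_iX_iA_i)/\varepsilon^2$. -/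

import Mathlib

open MeasureTheory ProbabilityTheory

universe u v

/-- A finite-horizon, tabular, `m`-player general-sum partially observable Markov game with
horizon `H`. The state space and the infoset spaces are the disjoint unions of their layers;
`step` and `infoStep` give the layer, and layers are numbered `0, …, H - 1`. -/
structure POMG (m H : ℕ) where
  /-- underlying states -/
  S : Type u
  /-- infosets of each player -/
  X : Fin m → Type u
  /-- actions of each player -/
  A : Fin m → Type u
  [fintypeS : Fintype S]
  [fintypeX : ∀ i, Fintype (X i)]
  [fintypeA : ∀ i, Fintype (A i)]
  [nonemptyA : ∀ i, Nonempty (A i)]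
  step : S → Fin H
  infoStep : ∀ i, X i → Fin H
  /-- emission functions -/
  obs : ∀ i, S → X i
  infoStep_obs : ∀ i s, infoStep i (obs i s) = step s
  /-- an infoset is the infoset of at least one state -/
  obs_surjective : ∀ i, Function.Surjective (obs i)
  /-- distribution of the initial state -/
  init : S → ℝ
  init_mem : init ∈ stdSimplex ℝ S
  init_step : ∀ s, init s ≠ 0 → (step s : ℕ) = 0
  /-- `trans s a s'` is the probability of moving from `s` to `s'` under the joint action `a`;
  it is used only at states that are not in the last layer -/
  trans : S → (∀ i, A i) → S → ℝ
  trans_mem : ∀ s a, (step s : ℕ) + 1 < H → trans s a ∈ stdSimplex ℝ S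
  trans_step : ∀ s a s', (step s : ℕ) + 1 < H → trans s a s' ≠ 0 → (step s' : ℕ) = step s + 1
  /-- joint law of the players' random rewards in `[0, 1]` at a state and a joint action -/
  reward : S → (∀ i, A i) → ProbabilityMeasure (Fin m → unitInterval)

attribute [instance] POMG.fintypeS POMG.fintypeX POMG.fintypeA POMG.nonemptyA

namespace POMG

variable {m H : ℕ} (G : POMG.{u} m H)

/-- Joint actions. -/
abbrev JointAction : Type u := ∀ i, G.A i

/-- `(s, a)` can be followed by the state `s'`. -/
def Edge (s : G.S) (a : G.JointAction) (s' : G.S) : Prop :=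
  (G.step s' : ℕ) = G.step s + 1 ∧ G.trans s a s' ≠ 0

/-- The infoset `x'` of player `i` is immediately reachable from `(x, a)`. -/
def Child (i : Fin m) (x : G.X i) (a : G.A i) (x' : G.X i) : Prop :=
  ∃ (s : G.S) (b : G.JointAction) (s' : G.S),
    G.Edge s b s' ∧ G.obs i s = x ∧ b i = a ∧ G.obs i s' = x'

/-- The infoset `x'` of player `i` (in any later layer) is reachable from `(x, a)`. -/
inductive Desc (i : Fin m) (x : G.X i) (a : G.A i) : G.X i → Prop
  | child {x' : G.X i} : G.Child i x a x' → Desc i x a x'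
  | tail {x' : G.X i} {a' : G.A i} {x'' : G.X i} :
      Desc i x a x' → G.Child i x' a' x'' → Desc i x a x''

end POMG

/-- An imperfect-information extensive-form game: a partially observable Markov game with tree
structure and perfect recall. Every state, and every infoset of every player, beyond the first
layer has exactly one predecessor, hence (going backwards) exactly one history. -/
structure IIEFG (m H : ℕ) extends POMG.{u} m H where
  tree : ∀ s' : S, (step s' : ℕ) ≠ 0 → ∃! p : S × (∀ i, A i), toPOMG.Edge p.1 p.2 s'
  perfectRecall : ∀ i, ∀ x' : X i, (infoStep i x' : ℕ) ≠ 0 →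
    ∃! p : X i × A i, toPOMG.Child i p.1 p.2 x'

namespace POMG

variable {m H : ℕ} (G : POMG.{u} m H)

/-- Policies of player `i`: an action distribution at each infoset. -/
abbrev Policy (i : Fin m) : Type u := G.X i → stdSimplex ℝ (G.A i)

/-- A policy for each player, that is, a product policy. -/
abbrev Profile : Type u := ∀ i, G.Policy i

/-- Sequences of states and joint actions `(s_1, a_1, …, s_H, a_H)`. -/
def Path : Type u := Fin H → G.S × G.JointAction

noncomputable instance : Fintype G.Path := by
  classical
  unfold Path
  infer_instance

instance : MeasurableSpace G.Path := ⊤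

/-- An episode: states and joint actions, and the rewards of all players at all steps. -/
abbrev Episode : Type u := G.Path × (Fin H → Fin m → unitInterval)

/-- The environment's factor for the `h`-th state of a path. -/
noncomputable def envProb (w : G.Path) (h : Fin H) : ℝ :=
  if (h : ℕ) = 0 then G.init (w h).1
  else G.trans (w ⟨h - 1, by omega⟩).1 (w ⟨h - 1, by omega⟩).2 (w h).1

/-- Probability of a path when the players play the product policy `σ`. -/
noncomputable def pathProb (σ : G.Profile) (w : G.Path) : ℝ :=
  ∏ h : Fin H, (G.envProb w h * ∏ i, (σ i (G.obs i (w h).1)).1 ((w h).2 i))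

/-- Law of an episode played with the product policy `σ`. -/
noncomputable def episodeLaw (σ : G.Profile) : Measure G.Episode :=
  ∑ w : G.Path, ENNReal.ofReal (G.pathProb σ w) •
    (Measure.dirac w).prod
      (Measure.pi fun h => (G.reward (w h).1 (w h).2 : Measure (Fin m → unitInterval)))

/-- The game value of player `i` under a product policy: her expected cumulative reward. -/
noncomputable def value (i : Fin m) (σ : G.Profile) : ℝ :=
  ∫ e, ∑ h, (e.2 h i : ℝ) ∂(G.episodeLaw σ)

/-- Joint policies, not necessarily product ones: a profile is drawn from a distribution before
the episode starts and is then played. -/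
abbrev JointPolicy : Type u := PMF G.Profile

/-- The game value of player `i` under a joint policy. -/
noncomputable def jointValue (i : Fin m) (ρ : G.JointPolicy) : ℝ :=
  ∑' σ, (ρ σ).toReal * G.value i σ

/-- The value of player `i` when she plays `π` and the others follow the joint policy `ρ`. -/
noncomputable def deviationValue (i : Fin m) (ρ : G.JointPolicy) (π : G.Policy i) : ℝ :=
  ∑' σ, (ρ σ).toReal * G.value i (Function.update σ i π)

/-- `CCEGap`: the largest gain of a player from a unilateral deviation. All values lie in
`[0, H]`, so the suprema are finite. -/
noncomputable def cceGap (ρ : G.JointPolicy) : ℝ :=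
  ⨆ i : Fin m, ⨆ π : G.Policy i, (G.deviationValue i ρ π - G.jointValue i ρ)

/-- `ε`-approximate normal-form coarse correlated equilibria. -/
def IsNFCCE (ε : ℝ) (ρ : G.JointPolicy) : Prop := G.cceGap ρ ≤ ε

/-- The joint policy that plays one of `σ 0, …, σ (T - 1)` chosen uniformly at random. -/
noncomputable def uniformMixture (T : ℕ) [NeZero T] (σ : ℕ → G.Profile) : G.JointPolicy :=
  (PMF.uniformOfFintype (Fin T)).map fun t => σ t

/-- Number of infosets times number of actions of player `i`. -/
def size (i : Fin m) : ℕ := Fintype.card (G.X i) * Fintype.card (G.A i)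

/-- `∑ i, X_i A_i`. -/
def sumSize : ℕ := ∑ i, G.size i

/-- `max i, X_i A_i`. -/
def maxSize : ℕ := Finset.univ.sup G.size

open Classical in
/-- Sequence form `π_{1:h}(x, a)`: the product of `π(a'|x')` over `(x, a)` and the pairs
`(x', a')` that precede `x`. Under perfect recall these pairs form the unique history of `x`. -/
noncomputable def seqForm (i : Fin m) (π : G.Policy i) (x : G.X i) (a : G.A i) : ℝ :=
  (∏ p : G.X i × G.A i with G.Desc i p.1 p.2 x, (π p.1).1 p.2) * (π x).1 a

open Classical in
/-- `C_h(x, a)`: the infosets in layer `h` that are reachable from `(x, a)`. -/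
noncomputable def descAt (i : Fin m) (h : Fin H) (x : G.X i) (a : G.A i) : Finset (G.X i) :=
  {x' | G.infoStep i x' = h ∧ G.Desc i x a x'}

open Classical in
/-- `C_h(x)`, the union of the `C_h(x, a)` over the actions `a`. -/
noncomputable def descAt' (i : Fin m) (h : Fin H) (x : G.X i) : Finset (G.X i) :=
  Finset.univ.biUnion (G.descAt i h x)

theorem uniform_mem (i : Fin m) :
    (fun _ : G.A i => 1 / (Fintype.card (G.A i) : ℝ)) ∈ stdSimplex ℝ (G.A i) := by
  refine ⟨fun _ => by positivity, ?_⟩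
  have : (Fintype.card (G.A i) : ℝ) ≠ 0 := by exact_mod_cast Fintype.card_ne_zero
  simp [this]

/-- The uniform policy. -/
noncomputable def uniformPolicy (i : Fin m) : G.Policy i := fun _ => ⟨_, G.uniform_mem i⟩

/-- The policy that plays `π` in the layers up to and including `h`, and `π'` afterwards. -/
noncomputable def spliceAfter (i : Fin m) (h : Fin H) (π π' : G.Policy i) : G.Policy i :=
  fun x => if G.infoStep i x ≤ h then π x else π' x

/-- A (random) play of `N` episodes, numbered `0, …, N - 1`, on the probability space `(Ω, P)`.
`ℱ n` is the information available before episode `n`; the profile used in episode `n` is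
determined by this information, and given this information the episode has the law prescribed by
the game and the profile. -/
structure Play {Ω : Type v} [mΩ : MeasurableSpace Ω] (P : Measure Ω) (N : ℕ) where
  ℱ : Filtration ℕ mΩ
  profile : ℕ → Ω → G.Profile
  episode : ℕ → Ω → G.Episode
  profile_measurable : ∀ n < N, ∀ i x a, Measurable[ℱ n] fun ω => (profile n ω i x).1 a
  episode_measurable : ∀ n < N, Measurable[ℱ (n + 1)] (episode n)
  episode_law : ∀ n < N, ∀ B : Set G.Episode, MeasurableSet B →
    P⟦episode n ⁻¹' B | ℱ n⟧ =ᵐ[P] fun ω => (G.episodeLaw (profile n ω)).real B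

end POMG

namespace IIEFG

variable {m H : ℕ} (G : IIEFG.{u} m H)

theorem infoStep_of_child {i : Fin m} {x x' : G.X i} {a : G.A i} (h : G.Child i x a x') :
    (G.infoStep i x' : ℕ) = G.infoStep i x + 1 := by
  obtain ⟨s, b, s', he, rfl, -, rfl⟩ := h
  rw [G.infoStep_obs, G.infoStep_obs]
  exact he.1

theorem infoStep_of_desc {i : Fin m} {x x' : G.X i} {a : G.A i} (h : G.Desc i x a x') :
    (G.infoStep i x : ℕ) < G.infoStep i x' := by
  induction h with
  | child h => have := G.infoStep_of_child h; omega
  | tail _ h ih => have := G.infoStep_of_child h; omega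

theorem child_unique {i : Fin m} {x y z : G.X i} {a b : G.A i} (h : G.Child i x a z)
    (h' : G.Child i y b z) : x = y ∧ a = b := by
  have h0 : (G.infoStep i z : ℕ) ≠ 0 := by have := G.infoStep_of_child h; omega
  have := (G.perfectRecall i z h0).unique (y₁ := (x, a)) (y₂ := (y, b)) h h'
  simpa using this

theorem desc_unique {i : Fin m} {x z : G.X i} {a b : G.A i} (h : G.Desc i x a z)
    (h' : G.Desc i x b z) : a = b := by
  induction h with
  | child h =>
    cases h' with
    | child h' => exact (G.child_unique h h').2
    | tail hd h' =>
      have := (G.child_unique h h').1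
      subst this
      exact absurd (G.infoStep_of_desc hd) (lt_irrefl _)
  | tail hd h ih =>
    cases h' with
    | child h' =>
      have := (G.child_unique h h').1
      subst this
      exact absurd (G.infoStep_of_desc hd) (lt_irrefl _)
    | tail hd' h' =>
      have := (G.child_unique h h').1
      subst this
      exact ih hd'

theorem exists_child (i : Fin m) (x : G.X i) (a : G.A i) (hx : (G.infoStep i x : ℕ) + 1 < H) :
    ∃ x', G.Child i x a x' := by
  classical
  obtain ⟨s, rfl⟩ := G.obs_surjective i x
  rw [G.infoStep_obs] at hx
  let b : G.JointAction := Function.update (fun j => Classical.arbitrary (G.A j)) i a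
  have hs : ∃ s', G.trans s b s' ≠ 0 := by
    by_contra! hc
    have := (G.trans_mem s b hx).2
    simp [hc] at this
  obtain ⟨s', hs'⟩ := hs
  exact ⟨_, s, b, s', ⟨G.trans_step s b s' hx hs', hs'⟩, rfl, by simp [b], rfl⟩

theorem exists_desc (i : Fin m) (x : G.X i) (a : G.A i) (k : ℕ)
    (hk : (G.infoStep i x : ℕ) + 1 + k < H) :
    ∃ x', G.Desc i x a x' ∧ (G.infoStep i x' : ℕ) = G.infoStep i x + 1 + k := by
  induction k with
  | zero =>
    obtain ⟨x', h⟩ := G.exists_child i x a (by omega)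
    exact ⟨x', .child h, by simpa using G.infoStep_of_child h⟩
  | succ k ih =>
    obtain ⟨x', h, h'⟩ := ih (by omega)
    obtain ⟨x'', h''⟩ := G.exists_child i x' (Classical.arbitrary _) (by omega)
    exact ⟨x'', .tail h h'', by have := G.infoStep_of_child h''; omega⟩

theorem balanced_mem (i : Fin m) (h : Fin H) (x : G.X i) (hx : G.infoStep i x < h) :
    (fun a => ((G.descAt i h x a).card : ℝ) / (G.descAt' i h x).card) ∈
      stdSimplex ℝ (G.A i) := by
  classical
  refine ⟨fun _ => by positivity, ?_⟩
  have hcard : (G.descAt' i h x).card = ∑ a, (G.descAt i h x a).card := by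
    unfold POMG.descAt'
    convert Finset.card_biUnion _
    intro a _ b _ hab
    refine Finset.disjoint_left.2 ?_
    intro z hz hz'
    simp only [POMG.descAt, Finset.mem_filter] at hz hz'
    exact hab (G.desc_unique hz.2.2 hz'.2.2)
  have hne : (G.descAt' i h x).card ≠ 0 := by
    have hlt : (G.infoStep i x : ℕ) < h := hx
    obtain ⟨z, hz, hz'⟩ := G.exists_desc i x (Classical.arbitrary _)
      ((h : ℕ) - (G.infoStep i x + 1)) (by omega)
    apply Finset.card_ne_zero_of_mem (a := z)
    simp only [POMG.descAt', POMG.descAt, Finset.mem_biUnion, Finset.mem_filter,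
      Finset.mem_univ, true_and]
    exact ⟨_, Fin.ext (by omega), hz⟩
  rw [← Finset.sum_div, ← Nat.cast_sum, ← hcard]
  exact div_self (by exact_mod_cast hne)

/-- The balanced exploration policy of player `i` for layer `h`. -/
noncomputable def balancedPolicy (i : Fin m) (h : Fin H) : G.Policy i := fun x =>
  if hx : G.infoStep i x < h then
    ⟨fun a => ((G.descAt i h x a).card : ℝ) / (G.descAt' i h x).card, G.balanced_mem i h x hx⟩
  else G.uniformPolicy i x

/-- `π^{⋆,h}_{1:h}(x, a)` for the layer `h` of `x`. -/
noncomputable def balancedSeq (i : Fin m) (x : G.X i) (a : G.A i) : ℝ :=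
  G.seqForm i (G.balancedPolicy i (G.infoStep i x)) x a

/-- The balanced dilated KL distance of two policies. -/
noncomputable def balancedKL (i : Fin m) (μ ν : G.Policy i) : ℝ :=
  ∑ x, ∑ a, G.seqForm i μ x a / G.balancedSeq i x a * Real.log ((μ x).1 a / (ν x).1 a)

open Classical in
/-- `1{(x_h, a_h) = (x, a)}` for the pair `(x_h, a_h)` visited by player `i` in the episode `e` at
the layer `h` of `x`. -/
noncomputable def visit (i : Fin m) (e : G.Episode) (x : G.X i) (a : G.A i) : ℝ :=
  if G.obs i (e.1 (G.infoStep i x)).1 = x ∧ (e.1 (G.infoStep i x)).2 i = a then 1 else 0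

/-- The implicit-exploration loss estimator of Balanced OMD, from an episode `e` played with the
policy `μ`. -/
noncomputable def omdLoss (i : Fin m) (γ : ℝ) (μ : G.Policy i) (e : G.Episode)
    (x : G.X i) (a : G.A i) : ℝ :=
  G.visit i e x a * (1 - (e.2 (G.infoStep i x) i : ℝ)) /
    (G.seqForm i μ x a + γ * G.balancedSeq i x a)

/-- The objective that is minimized in a step of Balanced OMD with loss `ℓ` from the policy `ν`. -/
noncomputable def omdObjective (i : Fin m) (η : ℝ) (ℓ : G.X i → G.A i → ℝ) (ν μ : G.Policy i) : ℝ :=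
  (∑ x, ∑ a, G.seqForm i μ x a * ℓ x a) + 1 / η * G.balancedKL i μ ν

variable {Ω : Type v} [MeasurableSpace Ω] {P : Measure Ω}

/-- All players run Balanced OMD in self-play for `T` episodes, player `i` with learning rate
`η i` and IX parameter `γ i`. -/
structure IsBalancedOMD (T : ℕ) (η γ : Fin m → ℝ) (play : G.Play P T) : Prop where
  init : ∀ ω i, play.profile 0 ω i = G.uniformPolicy i
  update : ∀ t, t + 1 < T → ∀ ω i,
    IsMinOn
      (G.omdObjective i (η i) (G.omdLoss i (γ i) (play.profile t ω i) (play.episode t ω))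
        (play.profile t ω i))
      Set.univ (play.profile (t + 1) ω i)

/-- The counterfactual loss estimator of Balanced CFR at an infoset `x` of layer `h`, from the
episode `e` that is played for this layer. -/
noncomputable def cfrLoss (i : Fin m) (e : G.Episode) (x : G.X i) (a : G.A i) : ℝ :=
  G.visit i e x a / G.balancedSeq i x a *
    ((H : ℝ) - (G.infoStep i x : ℕ) - ∑ h' ∈ Finset.Ici (G.infoStep i x), (e.2 h' i : ℝ))

/-- The weight before normalization of the action `a` at `x` in the Hedge update from `μ`, with
learning rate `η π^{⋆,h}_{1:h}(x, a)` and loss vector `L`. -/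
noncomputable def hedgeWeight (i : Fin m) (η : ℝ) (μ : G.Policy i) (L : G.X i → G.A i → ℝ)
    (x : G.X i) (a : G.A i) : ℝ :=
  (μ x).1 a * Real.exp (-(η * G.balancedSeq i x a * L x a))

/-- The number of the episode that is played in round `t` for player `i` and layer `h`: in each
round, the players take turns, and in her turn a player plays one episode for each layer. -/
def cfrIndex (t : ℕ) (i : Fin m) (h : Fin H) : ℕ := (t * m + i) * H + h

/-- All players run Balanced CFR with Hedge in self-play for `T` rounds, player `i` with
parameter `η i`; a total of `N` episodes is played, and `pol t` are the policies maintained in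
round `t`. -/
structure IsBalancedCFR (T N : ℕ) (η : Fin m → ℝ) (pol : ℕ → Ω → G.Profile)
    (play : G.Play P N) : Prop where
  /-- the episodes played are exactly those of the rounds `0, …, T - 1` -/
  episodes : ∀ n, n < N ↔ ∃ t < T, ∃ (i : Fin m) (h : Fin H), n = cfrIndex t i h
  init : ∀ ω i, pol 0 ω i = G.uniformPolicy i
  /-- player `i` explores with the balanced policy up to layer `h`, the others do not explore -/
  played : ∀ t < T, ∀ (i : Fin m) (h : Fin H), ∀ ω,
    play.profile (cfrIndex t i h) ω = Function.update (pol t ω) i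
      (G.spliceAfter i h (G.balancedPolicy i h) (pol t ω i))
  update : ∀ t, t + 1 < T → ∀ ω i x a,
    let L : G.X i → G.A i → ℝ := fun y =>
      G.cfrLoss i (play.episode (cfrIndex t i (G.infoStep i y)) ω) y
    (pol (t + 1) ω i x).1 a = G.hedgeWeight i (η i) (pol t ω i) L x a /
      ∑ b, G.hedgeWeight i (η i) (pol t ω i) L x b

end IIEFG

/-! The gap of the uniform mixture is the largest average regret of a player
(`isNFCCE_of_regret_le`), so it suffices to bound each player's regret with high probability and to
take a union bound over the players (`measure_isNFCCE_ge`). Perfect recall makes the regret linear.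
The probability of a path prefix factors into the sequence form of player `i` at the last visited
pair and a factor of the environment and the opponents (`prefixProb_eq`). Hence a policy has value
`H` minus the pairing of its sequence form with a loss vector that does not depend on player `i`
(`value_eq`, `counterfactualLoss_update`), and each player faces adversarial linear losses on her
infoset tree with bandit feedback.

Both bounds get the factor `X_i A_i` from the balancing property `sum_reach_div`: for every policy
`μ`, the sum of `reach μ x / balancedWeight x` over all infosets is exactly `X_i A_i`. Any error at
`x` that is inversely proportional to the balanced weight therefore sums to a multiple of `X_i A_i`,
whatever the comparator.

For Balanced OMD, the dilated objective is minimized by backward recursion: exponential weights at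
each infoset, with the minimal values of the children added to the losses (`omd_step`). The regret
against the estimates is a divergence term, at most `X_i A_i log A_i / η`, and a second-order term.
The latter is linearized by `sum_sq_actionValue_le` into losses of policies that explore with the
balanced policy up to a layer; their conditional means are bounded. Implicit exploration costs a
bias of at most `γ H` per round for the played policy (`measure_played_le`), and in exchange each
pair is overestimated by at most `ι / (γ w)` in total, `w` being its balanced weight
(`measure_comparator_le`).

For Balanced CFR, `regret_decomposition` writes the regret as a sum over infosets of local regrets,
weighted with the reach of the comparator. Hedge controls the local regret against the estimates
(`local_regret_le`). The estimates are unbiased, because the sampled layer is reached with exactly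
the balanced weight, and they are at most `H / balancedWeight x`; `measure_estimate_le` gives the
concentration and balancing sums the errors.

All concentration rests on one exponential supermartingale (`measure_le_sum_le`). In its
multiplicative form `measure_deviation_le` the deviation is `κ` times the conditional mean plus `R ι
/ κ`, which exploits that the variance of a nonnegative bounded variable is at most its range times
its mean. The tuned parameters make every error a multiple of `√(H³ X_i A_i ι T)`. -/

namespace IIEFG

/-! ### Infoset trees: realization weights, telescoping and backward recursion. -/

section Tree

variable {m H : ℕ} (G : IIEFG.{u} m H) {i : Fin m}

open Classical in
/-- The realization weight `π_{1:h-1}(x)` of an infoset `x` of layer `h`. -/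
noncomputable def reach (π : G.Policy i) (x : G.X i) : ℝ :=
  ∏ p : G.X i × G.A i with G.Desc i p.1 p.2 x, (π p.1).1 p.2

open Classical in
/-- The infosets that are immediately reachable from `(x, a)`. -/
noncomputable def children (x : G.X i) (a : G.A i) : Finset (G.X i) := {x' | G.Child i x a x'}

theorem mem_children {x : G.X i} {a : G.A i} {x' : G.X i} :
    x' ∈ G.children x a ↔ G.Child i x a x' := by simp [children]

theorem seqForm_eq (π : G.Policy i) (x : G.X i) (a : G.A i) :
    G.seqForm i π x a = G.reach π x * (π x).1 a := rfl

theorem policy_nonneg (π : G.Policy i) (x : G.X i) (a : G.A i) : 0 ≤ (π x).1 a := (π x).2.1 a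

theorem policy_sum (π : G.Policy i) (x : G.X i) : ∑ a, (π x).1 a = 1 := (π x).2.2

theorem policy_le_one (π : G.Policy i) (x : G.X i) (a : G.A i) : (π x).1 a ≤ 1 := by
  rw [← G.policy_sum π x]
  exact Finset.single_le_sum (fun b _ => G.policy_nonneg π x b) (Finset.mem_univ a)

theorem reach_nonneg (π : G.Policy i) (x : G.X i) : 0 ≤ G.reach π x :=
  Finset.prod_nonneg fun _ _ => G.policy_nonneg _ _ _

theorem seqForm_nonneg (π : G.Policy i) (x : G.X i) (a : G.A i) : 0 ≤ G.seqForm i π x a :=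
  mul_nonneg (G.reach_nonneg π x) (G.policy_nonneg π x a)

theorem sum_seqForm (π : G.Policy i) (x : G.X i) : ∑ a, G.seqForm i π x a = G.reach π x := by
  simp_rw [G.seqForm_eq, ← Finset.mul_sum, G.policy_sum, mul_one]

theorem reach_root (π : G.Policy i) {x : G.X i} (hx : (G.infoStep i x : ℕ) = 0) :
    G.reach π x = 1 := by
  classical
  refine Finset.prod_eq_one fun p hp => ?_
  have := G.infoStep_of_desc (Finset.mem_filter.1 hp).2
  omega

/-- By perfect recall the last link of any chain that ends at `z` starts at `(x, a)`. -/
theorem desc_child_iff {x y z : G.X i} {a b : G.A i} (h : G.Child i x a z) :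
    G.Desc i y b z ↔ (y, b) = (x, a) ∨ G.Desc i y b x := by
  constructor
  · intro h'
    cases h' with
    | child h' => exact .inl (Prod.ext_iff.2 (G.child_unique h' h))
    | tail hd h' => exact .inr ((G.child_unique h' h).1 ▸ hd)
  · rintro (h' | h')
    · obtain ⟨rfl, rfl⟩ := Prod.ext_iff.1 h'
      exact .child h
    · exact .tail h' h

/-- The history of `x'` is that of `x` with the pair `(x, a)` added. Together with `reach_root` this
turns the product definition of `reach` into a recursion. -/
theorem reach_child (π : G.Policy i) {x x' : G.X i} {a : G.A i} (h : G.Child i x a x') :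
    G.reach π x' = G.seqForm i π x a := by
  classical
  have : (Finset.univ.filter fun p : G.X i × G.A i => G.Desc i p.1 p.2 x') =
      insert (x, a) (Finset.univ.filter fun p : G.X i × G.A i => G.Desc i p.1 p.2 x) := by
    ext p
    simp [G.desc_child_iff h]
  rw [reach, this, Finset.prod_insert, mul_comm, seqForm_eq, reach]
  intro hp
  exact absurd (G.infoStep_of_desc (Finset.mem_filter.1 hp).2) (lt_irrefl _)

theorem exists_parent {x' : G.X i} (hx : (G.infoStep i x' : ℕ) ≠ 0) :
    ∃ x a, G.Child i x a x' := by
  obtain ⟨p, hp, -⟩ := G.perfectRecall i x' hx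
  exact ⟨_, _, hp⟩

/-- Induction along the tree of infosets, from the first layer on. -/
theorem infoset_induction {p : G.X i → Prop} (root : ∀ x, (G.infoStep i x : ℕ) = 0 → p x)
    (child : ∀ x a x', G.Child i x a x' → p x → p x') (x : G.X i) : p x := by
  by_cases hx : (G.infoStep i x : ℕ) = 0
  · exact root x hx
  · obtain ⟨y, a, h⟩ := G.exists_parent hx
    exact child y a x h (infoset_induction root child y)
termination_by (G.infoStep i x : ℕ)
decreasing_by
  have := G.infoStep_of_child h
  omega

theorem reach_pos {π : G.Policy i} (hπ : ∀ x a, 0 < (π x).1 a) (x : G.X i) : 0 < G.reach π x :=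
  Finset.prod_pos fun _ _ => hπ _ _

open Classical in
theorem reach_congr {π π' : G.Policy i} {x : G.X i}
    (h : ∀ y, G.infoStep i y < G.infoStep i x → π y = π' y) : G.reach π x = G.reach π' x :=
  Finset.prod_congr rfl fun p hp => by
    rw [h p.1 (G.infoStep_of_desc (Finset.mem_filter.1 hp).2)]

theorem seqForm_congr {π π' : G.Policy i} {x : G.X i} {a : G.A i}
    (h : ∀ y, G.infoStep i y ≤ G.infoStep i x → π y = π' y) :
    G.seqForm i π x a = G.seqForm i π' x a := by
  rw [seqForm_eq, seqForm_eq, h x le_rfl, G.reach_congr fun y hy => h y hy.le]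

/-- Summation over the infosets by their predecessors. -/
theorem sum_reach_children (μ : G.Policy i) (U : G.X i → ℝ) :
    ∑ x, ∑ a, G.seqForm i μ x a * ∑ x' ∈ G.children x a, U x' =
      ∑ x with (G.infoStep i x : ℕ) ≠ 0, G.reach μ x * U x := by
  classical
  simp_rw [Finset.mul_sum, children, Finset.sum_filter]
  rw [← Finset.sum_product', Finset.univ_product_univ, Finset.sum_comm]
  refine Finset.sum_congr rfl fun x' _ => ?_
  split_ifs with hx
  · obtain ⟨x, a, h⟩ := G.exists_parent hx
    -- Perfect recall leaves a single parent pair, whose sequence-form weight is the weight of `x'`.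
    rw [Finset.sum_eq_single (x, a), if_pos h, G.reach_child μ h]
    · intro p _ hp
      refine if_neg fun h' => hp (Prod.ext_iff.2 (G.child_unique h' h))
    · simp
  · refine Finset.sum_eq_zero fun p _ => if_neg fun h => ?_
    have := G.infoStep_of_child h
    omega

/-- The telescoping identity behind all decompositions of regret over infosets. -/
theorem telescope (μ : G.Policy i) (U : G.X i → ℝ) :
    ∑ x, G.reach μ x * (U x - ∑ a, (μ x).1 a * ∑ x' ∈ G.children x a, U x') =
      ∑ x with (G.infoStep i x : ℕ) = 0, U x := by
  have h := G.sum_reach_children μ U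
  have h' : ∀ x, G.reach μ x * ∑ a, (μ x).1 a * ∑ x' ∈ G.children x a, U x' =
      ∑ a, G.seqForm i μ x a * ∑ x' ∈ G.children x a, U x' := fun x => by
    simp_rw [Finset.mul_sum (s := Finset.univ), ← mul_assoc, ← seqForm_eq]
  -- The terms of the children cancel those of all later layers, so only the first layer remains,
  -- where the weight is one.
  simp_rw [mul_sub, h', Finset.sum_sub_distrib, h]
  rw [← Finset.sum_filter_add_sum_filter_not Finset.univ (fun x => (G.infoStep i x : ℕ) = 0)
    (fun x => G.reach μ x * U x), add_sub_cancel_right]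
  refine Finset.sum_congr rfl fun x hx => ?_
  rw [G.reach_root μ (Finset.mem_filter.1 hx).2, one_mul]

/-- Backward recursion over the tree of infosets. -/
theorem exists_backward (Φ : (x : G.X i) → (G.A i → ℝ) → ℝ) :
    ∃ U : G.X i → ℝ, ∀ x, U x = Φ x fun a => ∑ x' ∈ G.children x a, U x' := by
  classical
  let step : (G.X i → ℝ) → G.X i → ℝ := fun U x => Φ x fun a => ∑ x' ∈ G.children x a, U x'
  -- Iteration from zero is stationary at `x` once it has swept the layers from the last one back to
  -- that of `x`; after `H` sweeps it is a fixed point everywhere.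
  have key : ∀ n x, H - (G.infoStep i x : ℕ) ≤ n → step^[n + 1] 0 x = step^[n] 0 x := by
    intro n
    induction n with
    | zero => intro x hx; have := (G.infoStep i x).2; omega
    | succ n ih =>
      intro x hx
      rw [Function.iterate_succ_apply', Function.iterate_succ_apply' (n := n)]
      change Φ x _ = Φ x _
      congr 1
      funext a
      refine Finset.sum_congr rfl fun x' hx' => ?_
      have := G.infoStep_of_child (G.mem_children.1 hx')
      rw [← Function.iterate_succ_apply' step]
      exact ih x' (by omega)
  refine ⟨step^[H] 0, fun x => ?_⟩
  rw [← key H x (by omega), Function.iterate_succ_apply']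

/-- The cumulative value from an infoset on, when `π` is played and `f x a` is collected at
every visited pair `(x, a)`. -/
noncomputable def stateValue (π : G.Policy i) (f : G.X i → G.A i → ℝ) : G.X i → ℝ :=
  (G.exists_backward fun x U => ∑ a, (π x).1 a * (f x a + U a)).choose

/-- The cumulative value from the pair `(x, a)` on. -/
noncomputable def actionValue (π : G.Policy i) (f : G.X i → G.A i → ℝ) (x : G.X i) (a : G.A i) :
    ℝ := f x a + ∑ x' ∈ G.children x a, G.stateValue π f x'

theorem stateValue_eq (π : G.Policy i) (f : G.X i → G.A i → ℝ) (x : G.X i) :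
    G.stateValue π f x = ∑ a, (π x).1 a * G.actionValue π f x a :=
  (G.exists_backward fun x U => ∑ a, (π x).1 a * (f x a + U a)).choose_spec x

/-- Backward induction along the tree of infosets. -/
theorem infoset_backward_induction {p : G.X i → Prop}
    (step : ∀ x, (∀ a, ∀ x' ∈ G.children x a, p x') → p x) (x : G.X i) : p x :=
  step x fun _ x' hx' =>
    have _ := G.infoStep_of_child (G.mem_children.1 hx')
    infoset_backward_induction step x'
termination_by H - (G.infoStep i x : ℕ)
decreasing_by
  have := (G.infoStep i x').2
  omega

theorem stateValue_nonneg (π : G.Policy i) {f : G.X i → G.A i → ℝ} (hf : ∀ x a, 0 ≤ f x a)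
    (x : G.X i) : 0 ≤ G.stateValue π f x := by
  induction x using G.infoset_backward_induction with
  | step x ih =>
    rw [stateValue_eq]
    exact Finset.sum_nonneg fun a _ => mul_nonneg (G.policy_nonneg _ _ _)
      (add_nonneg (hf x a) (Finset.sum_nonneg (ih a)))

theorem actionValue_nonneg (π : G.Policy i) {f : G.X i → G.A i → ℝ} (hf : ∀ x a, 0 ≤ f x a)
    (x : G.X i) (a : G.A i) : 0 ≤ G.actionValue π f x a :=
  add_nonneg (hf x a) (Finset.sum_nonneg fun _ _ => G.stateValue_nonneg π hf _)

/-- Decomposition of regret over infosets. -/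
theorem regret_decomposition (π μ : G.Policy i) (f : G.X i → G.A i → ℝ) :
    (∑ x, ∑ a, G.seqForm i π x a * f x a) - ∑ x, ∑ a, G.seqForm i μ x a * f x a =
      ∑ x, G.reach μ x * ∑ a, ((π x).1 a - (μ x).1 a) * G.actionValue π f x a := by
  -- Performance difference: the state values of `π` are telescoped along `ν`. The main term does
  -- not depend on `ν`, and the correction vanishes for `ν = π`.
  have key : ∀ ν : G.Policy i, ∑ x, ∑ a, G.seqForm i ν x a * f x a =
      (∑ x with (G.infoStep i x : ℕ) = 0, G.stateValue π f x) -
        ∑ x, G.reach ν x * ∑ a, ((π x).1 a - (ν x).1 a) * G.actionValue π f x a := by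
    intro ν
    rw [← G.telescope ν, ← Finset.sum_sub_distrib]
    refine Finset.sum_congr rfl fun x _ => ?_
    rw [← mul_sub, G.stateValue_eq, ← Finset.sum_sub_distrib, ← Finset.sum_sub_distrib,
      Finset.mul_sum]
    refine Finset.sum_congr rfl fun a _ => ?_
    rw [actionValue, seqForm_eq]
    ring
  rw [key π, key μ]
  simp

/-- The value from layer `h` on of a policy `ρ` that agrees with `π` after layer `h`. -/
theorem sum_layer_actionValue (π ρ : G.Policy i) (h : Fin H)
    (hρ : ∀ x, h < G.infoStep i x → ρ x = π x) (f : G.X i → G.A i → ℝ) :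
    ∑ x with G.infoStep i x = h, ∑ a, G.seqForm i ρ x a * G.actionValue π f x a =
      ∑ x with h ≤ G.infoStep i x, ∑ a, G.seqForm i ρ x a * f x a := by
  classical
  -- With the state values cut off up to layer `h`, the first-layer side of the telescoping identity
  -- is zero, and what remains compares layer `h` with the losses from there on.
  have ht := G.telescope ρ fun x => if h < G.infoStep i x then G.stateValue π f x else 0
  rw [Finset.sum_eq_zero (s := Finset.univ.filter _)] at ht
  swap
  · intro x hx
    have hx := (Finset.mem_filter.1 hx).2
    rw [if_neg]
    rw [Fin.lt_def]
    omega
  rw [Finset.sum_filter, Finset.sum_filter, ← sub_eq_zero, ← Finset.sum_sub_distrib, ← neg_eq_zero,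
    ← Finset.sum_neg_distrib]
  refine Eq.trans ?_ ht
  refine Finset.sum_congr rfl fun x _ => ?_
  have hch : ∀ a, ∑ x' ∈ G.children x a, (if h < G.infoStep i x' then G.stateValue π f x' else 0)
      = if h ≤ G.infoStep i x then ∑ x' ∈ G.children x a, G.stateValue π f x' else 0 := by
    intro a
    split_ifs with hx
    · refine Finset.sum_congr rfl fun x' hx' => if_pos ?_
      have := G.infoStep_of_child (G.mem_children.1 hx')
      rw [Fin.lt_def]
      rw [Fin.le_def] at hx
      omega
    · refine Finset.sum_eq_zero fun x' hx' => if_neg ?_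
      have := G.infoStep_of_child (G.mem_children.1 hx')
      rw [Fin.lt_def]
      rw [Fin.le_def] at hx
      omega
  simp only [hch]
  rcases lt_trichotomy h (G.infoStep i x) with hx | hx | hx
  · rw [if_neg hx.ne', if_pos hx.le, if_pos hx, zero_sub, neg_neg, G.stateValue_eq,
      ← Finset.sum_sub_distrib, Finset.mul_sum]
    refine Finset.sum_congr rfl fun a _ => ?_
    rw [if_pos hx.le, seqForm_eq, hρ x hx, actionValue]
    ring
  · subst hx
    rw [if_pos rfl, if_pos le_rfl, if_neg (lt_irrefl _), zero_sub, ← Finset.sum_sub_distrib,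
      mul_neg, Finset.mul_sum, neg_inj]
    refine Finset.sum_congr rfl fun a _ => ?_
    rw [if_pos le_rfl, seqForm_eq, actionValue]
    ring
  · rw [if_neg hx.ne, if_neg hx.not_ge, if_neg hx.le.not_gt]
    simp [hx.not_ge]

open Classical in
/-- The value from the pair `(x, a)` on of a policy `ρ` that agrees with `π` afterwards. -/
theorem seqForm_mul_actionValue (π ρ : G.Policy i) (x : G.X i) (a : G.A i)
    (hρ : ∀ y, G.infoStep i x < G.infoStep i y → ρ y = π y) (f : G.X i → G.A i → ℝ) :
    G.seqForm i ρ x a * G.actionValue π f x a = G.seqForm i ρ x a * f x a +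
      ∑ y with G.Desc i x a y, ∑ b, G.seqForm i ρ y b * f y b := by
  -- The same device, with the state values restricted to the subtree below `(x, a)`.
  have ht := G.telescope ρ fun y => if G.Desc i x a y then G.stateValue π f y else 0
  rw [Finset.sum_eq_zero (s := Finset.univ.filter _)] at ht
  swap
  · intro y hy
    have hy := (Finset.mem_filter.1 hy).2
    refine if_neg fun hd => ?_
    have := G.infoStep_of_desc hd
    omega
  rw [actionValue, mul_add, add_right_inj, Finset.sum_filter]
  have hx : G.seqForm i ρ x a * ∑ x' ∈ G.children x a, G.stateValue π f x' =
      ∑ y, if y = x then G.seqForm i ρ x a * ∑ x' ∈ G.children x a, G.stateValue π f x' else 0 := by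
    simp
  rw [hx, ← sub_eq_zero, ← Finset.sum_sub_distrib, ← neg_eq_zero, ← Finset.sum_neg_distrib]
  refine Eq.trans ?_ ht
  refine Finset.sum_congr rfl fun y _ => ?_
  have hch : ∀ b, ∑ x' ∈ G.children y b, (if G.Desc i x a x' then G.stateValue π f x' else 0)
      = if (x, a) = (y, b) ∨ G.Desc i x a y then
        ∑ x' ∈ G.children y b, G.stateValue π f x' else 0 := by
    intro b
    split_ifs with hd
    · exact Finset.sum_congr rfl fun x' hx' =>
        if_pos ((G.desc_child_iff (G.mem_children.1 hx')).2 hd)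
    · exact Finset.sum_eq_zero fun x' hx' =>
        if_neg ((G.desc_child_iff (G.mem_children.1 hx')).not.2 hd)
  simp only [hch]
  by_cases hy : y = x
  · subst hy
    have hd : ¬ G.Desc i y a y := fun hd => absurd (G.infoStep_of_desc hd) (lt_irrefl _)
    simp [hd, seqForm_eq, mul_assoc]
  · by_cases hd : G.Desc i x a y
    · rw [if_neg hy, if_pos hd, if_pos hd, zero_sub, neg_neg, G.stateValue_eq,
        ← Finset.sum_sub_distrib, Finset.mul_sum]
      refine Finset.sum_congr rfl fun b _ => ?_
      rw [if_pos (.inr hd), seqForm_eq, hρ y (G.infoStep_of_desc hd), actionValue]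
      ring
    · simp [hd, hy, Ne.symm hy]

end Tree

end IIEFG

namespace IIEFG

/-! ### The balanced exploration policies and the balancing property. -/

section Balance

variable {m H : ℕ} (G : IIEFG.{u} m H) {i : Fin m}

theorem mem_descAt {h : Fin H} {x x' : G.X i} {a : G.A i} :
    x' ∈ G.descAt i h x a ↔ G.infoStep i x' = h ∧ G.Desc i x a x' := by
  simp [POMG.descAt]

theorem descAt_pos {h : Fin H} {x : G.X i} (hx : G.infoStep i x < h) (a : G.A i) :
    0 < (G.descAt i h x a).card := by
  have hlt : (G.infoStep i x : ℕ) < h := hx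
  obtain ⟨z, hz, hz'⟩ := G.exists_desc i x a ((h : ℕ) - (G.infoStep i x + 1)) (by omega)
  exact Finset.card_pos.2 ⟨z, G.mem_descAt.2 ⟨Fin.ext (by omega), hz⟩⟩

theorem card_descAt' {h : Fin H} (x : G.X i) :
    (G.descAt' i h x).card = ∑ a, (G.descAt i h x a).card := by
  classical
  unfold POMG.descAt'
  convert Finset.card_biUnion _
  intro a _ b _ hab
  refine Finset.disjoint_left.2 fun z hz hz' => ?_
  exact hab (G.desc_unique (G.mem_descAt.1 hz).2 (G.mem_descAt.1 hz').2)

theorem balancedPolicy_of_lt {h : Fin H} {x : G.X i} (hx : G.infoStep i x < h) (a : G.A i) :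
    (G.balancedPolicy i h x).1 a =
      ((G.descAt i h x a).card : ℝ) / (G.descAt' i h x).card := by
  simp [balancedPolicy, hx]

theorem balancedPolicy_of_not_lt {h : Fin H} {x : G.X i} (hx : ¬ G.infoStep i x < h) :
    G.balancedPolicy i h x = G.uniformPolicy i x := by
  simp [balancedPolicy, hx]

theorem uniformPolicy_apply (x : G.X i) (a : G.A i) :
    (G.uniformPolicy i x).1 a = 1 / (Fintype.card (G.A i) : ℝ) := rfl

theorem card_action_pos : (0 : ℝ) < Fintype.card (G.A i) := by
  exact_mod_cast Fintype.card_pos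

theorem uniformPolicy_pos (x : G.X i) (a : G.A i) : 0 < (G.uniformPolicy i x).1 a := by
  rw [uniformPolicy_apply]
  exact one_div_pos.2 G.card_action_pos

theorem balancedPolicy_pos (h : Fin H) (x : G.X i) (a : G.A i) :
    0 < (G.balancedPolicy i h x).1 a := by
  by_cases hx : G.infoStep i x < h
  · rw [G.balancedPolicy_of_lt hx]
    have h1 := G.descAt_pos hx a
    have h2 : 0 < (G.descAt' i h x).card := by
      rw [card_descAt']
      exact h1.trans_le (Finset.single_le_sum (f := fun a => (G.descAt i h x a).card)
        (fun _ _ => Nat.zero_le _) (Finset.mem_univ a))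
    positivity
  · rw [G.balancedPolicy_of_not_lt hx]
    exact G.uniformPolicy_pos x a

/-- The balanced weight `π^{⋆,h}_{1:h}(x, a)`, which does not depend on `a`. -/
noncomputable def balancedWeight (x : G.X i) : ℝ :=
  G.reach (G.balancedPolicy i (G.infoStep i x)) x / Fintype.card (G.A i)

theorem balancedSeq_eq (x : G.X i) (a : G.A i) : G.balancedSeq i x a = G.balancedWeight x := by
  rw [balancedSeq, seqForm_eq, G.balancedPolicy_of_not_lt (lt_irrefl _), uniformPolicy_apply,
    balancedWeight, mul_one_div]

theorem balancedWeight_pos (x : G.X i) : 0 < G.balancedWeight x :=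
  div_pos (G.reach_pos (G.balancedPolicy_pos _) x) G.card_action_pos

open Classical in
/-- The number of infosets of layer `h` that are equal to `x` or reachable from `x`. -/
noncomputable def numBelow (h : Fin H) (x : G.X i) : ℕ :=
  if G.infoStep i x = h then 1 else (G.descAt' i h x).card

theorem numBelow_of_lt {h : Fin H} {x : G.X i} (hx : h < G.infoStep i x) :
    G.numBelow h x = 0 := by
  rw [numBelow, if_neg hx.ne', card_descAt']
  refine Finset.sum_eq_zero fun a _ => Finset.card_eq_zero.2 (Finset.eq_empty_of_forall_notMem ?_)
  intro z hz
  obtain ⟨rfl, hd⟩ := G.mem_descAt.1 hz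
  have := G.infoStep_of_desc hd
  rw [Fin.lt_def] at hx
  omega

/-- `Desc` grows by links at its far end; counting by children needs this unfolding at the near end.
-/
theorem desc_iff_child {x z : G.X i} {a : G.A i} :
    G.Desc i x a z ↔ ∃ y, G.Child i x a y ∧ (z = y ∨ ∃ b, G.Desc i y b z) := by
  constructor
  · intro h
    induction h with
    | child h => exact ⟨_, h, .inl rfl⟩
    | tail hd h ih =>
      obtain ⟨y, hy, rfl | ⟨b, hb⟩⟩ := ih
      · exact ⟨_, hy, .inr ⟨_, .child h⟩⟩
      · exact ⟨_, hy, .inr ⟨_, .tail hb h⟩⟩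
  · rintro ⟨y, hy, rfl | ⟨b, hb⟩⟩
    · exact .child hy
    · induction hb with
      | child h => exact .tail (.child hy) h
      | tail _ h ih => exact .tail ih h

/-- Distinct children have disjoint sets of descendants, since histories are unique, so the counts
add up. -/
theorem card_descAt (h : Fin H) (x : G.X i) (a : G.A i) :
    (G.descAt i h x a).card = ∑ x' ∈ G.children x a, G.numBelow h x' := by
  classical
  let B : G.X i → Finset (G.X i) := fun y =>
    if G.infoStep i y = h then {y} else G.descAt' i h y
  have hB : ∀ y z, z ∈ B y ↔ G.infoStep i z = h ∧ (z = y ∨ ∃ b, G.Desc i y b z) := by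
    intro y z
    simp only [B]
    split_ifs with hy
    · simp only [Finset.mem_singleton]
      constructor
      · rintro rfl; exact ⟨hy, .inl rfl⟩
      · rintro ⟨hz, rfl | ⟨b, hb⟩⟩
        · rfl
        · have := G.infoStep_of_desc hb
          rw [hy, hz] at this
          omega
    · simp only [POMG.descAt', Finset.mem_biUnion, G.mem_descAt, Finset.mem_univ, true_and]
      constructor
      · rintro ⟨b, hz, hb⟩; exact ⟨hz, .inr ⟨b, hb⟩⟩
      · rintro ⟨hz, rfl | ⟨b, hb⟩⟩
        · exact absurd hz hy
        · exact ⟨b, hz, hb⟩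
  have hcard : ∀ y, (B y).card = G.numBelow h y := by
    intro y
    simp only [B, numBelow]
    split_ifs <;> simp
  have : G.descAt i h x a = (G.children x a).biUnion B := by
    ext z
    rw [Finset.mem_biUnion, mem_descAt, desc_iff_child]
    simp only [hB, mem_children]
    constructor
    · rintro ⟨hz, y, hy, hd⟩; exact ⟨y, hy, hz, hd⟩
    · rintro ⟨y, hy, hz, hd⟩; exact ⟨hz, y, hy, hd⟩
  rw [this, Finset.card_biUnion]
  · simp_rw [hcard]
  · intro y hy z hz hyz
    refine Finset.disjoint_left.2 fun w hw hw' => hyz ?_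
    have hy := G.mem_children.1 hy
    have hz := G.mem_children.1 hz
    -- Two siblings above a common `w` coincide. They lie in the same layer, so if `w` is one of
    -- them it cannot lie strictly below the other; otherwise the claim passes to the predecessor of
    -- `w`.
    have key : ∀ w y z, G.Child i x a y → G.Child i x a z →
        (w = y ∨ ∃ b, G.Desc i y b w) → (w = z ∨ ∃ b, G.Desc i z b w) → y = z := by
      intro w
      induction w using G.infoset_induction with
      | root w hw =>
        intro y z hy hz h1 _
        have h3 := G.infoStep_of_child hy
        rcases h1 with rfl | ⟨b, hb⟩
        · omega
        · have := G.infoStep_of_desc hb; omega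
      | child w c w' hw ih =>
        intro y z hy hz h1 h2
        have h3 := G.infoStep_of_child hy
        have h4 := G.infoStep_of_child hz
        have h5 : (∃ b, G.Desc i y b w') → (w = y ∨ ∃ b, G.Desc i y b w) := by
          rintro ⟨b, hb⟩
          rcases (G.desc_child_iff hw).1 hb with h | h
          · exact .inl (Prod.ext_iff.1 h).1.symm
          · exact .inr ⟨b, h⟩
        have h6 : (∃ b, G.Desc i z b w') → (w = z ∨ ∃ b, G.Desc i z b w) := by
          rintro ⟨b, hb⟩
          rcases (G.desc_child_iff hw).1 hb with h | h
          · exact .inl (Prod.ext_iff.1 h).1.symm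
          · exact .inr ⟨b, h⟩
        rcases h1 with rfl | h1
        · rcases h2 with rfl | ⟨b, h2⟩
          · rfl
          · have := G.infoStep_of_desc h2; omega
        · rcases h2 with rfl | h2
          · obtain ⟨b, h1⟩ := h1
            have := G.infoStep_of_desc h1; omega
          · exact ih y z hy hz (h5 h1) (h6 h2)
    exact key w y z hy hz ((hB y w).1 hw).2 ((hB z w).1 hw').2

/-- The ratio of `numBelow h x` to the balanced reach of `x` is a potential that every policy
conserves before layer `h`: the balanced policy splits its mass in proportion to the numbers of
descendants in layer `h`, so each action carries the potential of `x` to its children. Telescoping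
leaves layer `h`, where the number is one, against a quantity free of `μ`. -/
theorem sum_layer_reach_div_aux (μ : G.Policy i) (h : Fin H) :
    ∑ x with G.infoStep i x = h, G.reach μ x / G.reach (G.balancedPolicy i h) x =
      ∑ x with (G.infoStep i x : ℕ) = 0, (G.numBelow h x : ℝ) := by
  classical
  have hpos := fun x : G.X i => (G.reach_pos (G.balancedPolicy_pos h) x)
  have ht := G.telescope μ fun x => (G.numBelow h x : ℝ) / G.reach (G.balancedPolicy i h) x
  refine Eq.trans ?_ (ht.trans (Finset.sum_congr rfl fun x hx => ?_))
  · rw [Finset.sum_filter]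
    refine Finset.sum_congr rfl fun x _ => ?_
    have hch : ∀ a, ∑ x' ∈ G.children x a,
        (G.numBelow h x' : ℝ) / G.reach (G.balancedPolicy i h) x' =
        ((G.descAt i h x a).card : ℝ) / G.seqForm i (G.balancedPolicy i h) x a := by
      intro a
      rw [card_descAt, Nat.cast_sum, Finset.sum_div]
      refine Finset.sum_congr rfl fun x' hx' => ?_
      rw [G.reach_child _ (G.mem_children.1 hx')]
    simp only [hch]
    have hge : ¬ G.infoStep i x < h → ∀ a, (G.descAt i h x a).card = 0 := by
      intro hx a
      refine Finset.card_eq_zero.2 (Finset.eq_empty_of_forall_notMem fun z hz => hx ?_)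
      obtain ⟨rfl, hd⟩ := G.mem_descAt.1 hz
      exact G.infoStep_of_desc hd
    rcases lt_trichotomy (G.infoStep i x) h with hx | hx | hx
    · rw [if_neg hx.ne, numBelow, if_neg hx.ne]
      have : ∀ a, (μ x).1 a * (((G.descAt i h x a).card : ℝ) /
          G.seqForm i (G.balancedPolicy i h) x a) =
          (μ x).1 a * (((G.descAt' i h x).card : ℝ) / G.reach (G.balancedPolicy i h) x) := by
        intro a
        have h0 : (0 : ℝ) < (G.descAt i h x a).card := by exact_mod_cast G.descAt_pos hx a
        have h1 := G.balancedPolicy_pos h x a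
        have h2 := (hpos x).ne'
        rw [G.balancedPolicy_of_lt hx] at h1
        have h3 : ((G.descAt' i h x).card : ℝ) ≠ 0 := by
          intro h3
          simp [h3] at h1
        rw [seqForm_eq, G.balancedPolicy_of_lt hx]
        field_simp
      simp [this, ← Finset.sum_mul, G.policy_sum]
    · simp [hge hx.not_lt, numBelow, hx, div_eq_mul_inv]
    · simp [hge hx.not_gt, G.numBelow_of_lt hx, hx.ne']
  · rw [G.reach_root _ (Finset.mem_filter.1 hx).2, div_one]

/-- The balancing property, in a layer. -/
theorem sum_layer_reach_div (μ : G.Policy i) (h : Fin H) :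
    ∑ x with G.infoStep i x = h, G.reach μ x / G.balancedWeight x =
      (Finset.univ.filter fun x : G.X i => G.infoStep i x = h).card * Fintype.card (G.A i) := by
  have h1 := G.sum_layer_reach_div_aux μ h
  -- As the right-hand side is free of `μ`, the sum may be evaluated at the balanced policy, where
  -- every ratio is one.
  rw [← G.sum_layer_reach_div_aux (G.balancedPolicy i h) h] at h1
  have h2 : ∑ x with G.infoStep i x = h, G.reach (G.balancedPolicy i h) x /
      G.reach (G.balancedPolicy i h) x =
      (Finset.univ.filter fun x : G.X i => G.infoStep i x = h).card := by
    rw [Finset.card_eq_sum_ones, Nat.cast_sum]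
    refine Finset.sum_congr rfl fun x _ => ?_
    rw [div_self (G.reach_pos (G.balancedPolicy_pos h) x).ne', Nat.cast_one]
  rw [← h2, ← h1, Finset.sum_mul]
  refine Finset.sum_congr rfl fun x hx => ?_
  rw [balancedWeight, (Finset.mem_filter.1 hx).2, div_div_eq_mul_div, mul_div_right_comm]

/-- The balancing property. -/
theorem sum_reach_div (μ : G.Policy i) :
    ∑ x, G.reach μ x / G.balancedWeight x = G.size i := by
  have h1 : ∑ h : Fin H, ∑ x with G.infoStep i x = h, G.reach μ x / G.balancedWeight x =
    ∑ x, G.reach μ x / G.balancedWeight x := Finset.sum_fiberwise _ _ _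
  rw [← h1]
  simp_rw [sum_layer_reach_div]
  rw [← Finset.sum_mul, POMG.size, Nat.cast_mul, ← Nat.cast_sum,
    ← Finset.card_eq_sum_card_fiberwise (s := Finset.univ) (fun _ _ => Finset.mem_coe.2 (Finset.mem_univ _)),
    Finset.card_univ]

theorem reach_div_le (μ : G.Policy i) (x : G.X i) :
    G.reach μ x / G.balancedWeight x ≤ G.size i := by
  rw [← G.sum_reach_div μ]
  exact Finset.single_le_sum (f := fun x => G.reach μ x / G.balancedWeight x)
    (fun x _ => div_nonneg (G.reach_nonneg _ _) (G.balancedWeight_pos x).le) (Finset.mem_univ x)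

end Balance

end IIEFG

/-! ### Path probabilities: marginalization and factorization over the players. -/

/-- Exchanging `w k` with `z` is an involution of the pairs `(w, z)`. This sums out one coordinate
without splitting the type of functions. -/
theorem sum_sum_update {ι Z : Type*} [Fintype ι] [DecidableEq ι] [Fintype Z]
    (φ : (ι → Z) → ℝ) (k : ι) :
    ∑ w : ι → Z, ∑ z, φ (Function.update w k z) = Fintype.card Z * ∑ w, φ w := by
  classical
  let e : (ι → Z) × Z → (ι → Z) × Z := fun p => (Function.update p.1 k p.2, p.1 k)
  have he : Function.Involutive e := by
    rintro ⟨w, z⟩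
    simp [e]
  have h := Equiv.sum_comp (he.toPerm e) fun p : (ι → Z) × Z => φ p.1
  simp only [Function.Involutive.coe_toPerm, e, Fintype.sum_prod_type] at h
  rw [h]
  simp [Finset.mul_sum]

namespace IIEFG

section Paths

variable {m H : ℕ} (G : IIEFG.{u} m H)

/-- Replace the state and the joint action of one layer of a path. -/
def setStep (w : G.Path) (k : Fin H) (z : G.S × G.JointAction) : G.Path :=
  Function.update (β := fun _ => G.S × G.JointAction) w k z

theorem setStep_self (w : G.Path) (k : Fin H) (z : G.S × G.JointAction) :
    G.setStep w k z k = z := Function.update_self (β := fun _ => G.S × G.JointAction) ..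

theorem setStep_of_ne (w : G.Path) {h k : Fin H} (hk : h ≠ k) (z : G.S × G.JointAction) :
    G.setStep w k z h = w h := Function.update_of_ne (β := fun _ => G.S × G.JointAction) hk ..

theorem path_sum_update (φ : G.Path → ℝ) (k : Fin H) :
    ∑ w : G.Path, ∑ z, φ (G.setStep w k z) =
      Fintype.card (G.S × G.JointAction) * ∑ w, φ w := by
  classical
  have h := sum_sum_update (Z := G.S × G.JointAction) φ k
  have e : ∀ ψ : G.Path → ℝ, ∑ w : G.Path, ψ w = ∑ w : Fin H → G.S × G.JointAction, ψ w :=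
    fun ψ => Fintype.sum_equiv (Equiv.refl _) _ _ fun _ => rfl
  rw [e, e]
  exact h

/-- The layers before layer `n`. -/
def layersBelow (H n : ℕ) : Finset (Fin H) := Finset.univ.filter fun h => (h : ℕ) < n

theorem mem_layersBelow {n : ℕ} {h : Fin H} : h ∈ layersBelow H n ↔ (h : ℕ) < n := by
  simp [layersBelow]

theorem layersBelow_zero : layersBelow H 0 = ∅ := by
  simp [layersBelow]

theorem layersBelow_self : layersBelow H H = Finset.univ := by
  simp [layersBelow]

theorem layersBelow_succ (k : Fin H) :
    layersBelow H (k + 1) = insert k (layersBelow H k) := by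
  ext h
  simp only [mem_layersBelow, Finset.mem_insert, Fin.ext_iff]
  omega

theorem prod_layersBelow_succ (k : Fin H) (f : Fin H → ℝ) :
    ∏ h ∈ layersBelow H (k + 1), f h = (∏ h ∈ layersBelow H k, f h) * f k := by
  rw [layersBelow_succ, Finset.prod_insert (by simp [mem_layersBelow]), mul_comm]

/-- The factor of the probability of a path that belongs to layer `h`. -/
noncomputable def stepFactor (σ : G.Profile) (w : G.Path) (h : Fin H) : ℝ :=
  G.envProb w h * ∏ i, (σ i (G.obs i (w h).1)).1 ((w h).2 i)

/-- The probability of the part of a path in the first `n` layers. -/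
noncomputable def prefixProb (σ : G.Profile) (n : ℕ) (w : G.Path) : ℝ :=
  ∏ h ∈ layersBelow H n, G.stepFactor σ w h

theorem prefixProb_succ (σ : G.Profile) (k : Fin H) (w : G.Path) :
    G.prefixProb σ (k + 1) w = G.prefixProb σ k w * G.stepFactor σ w k := by
  exact prod_layersBelow_succ k _

theorem prefixProb_horizon (σ : G.Profile) (w : G.Path) :
    G.prefixProb σ H w = G.pathProb σ w := by
  simp [prefixProb, POMG.pathProb, stepFactor, layersBelow_self]

/-- The first `n` states of a path are in their layers, and are linked by possible transitions. -/
def ValidPrefix (n : ℕ) (w : G.Path) : Prop :=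
  ∀ h : Fin H, (h : ℕ) < n → (G.step (w h).1 : ℕ) = h ∧
    ∀ h' : Fin H, (h' : ℕ) + 1 = h → G.Edge (w h').1 (w h').2 (w h).1

theorem validPrefix_of_envProb {n : ℕ} {w : G.Path}
    (hw : ∀ h : Fin H, (h : ℕ) < n → G.envProb w h ≠ 0) : G.ValidPrefix n w := by
  have key : ∀ k : ℕ, ∀ h : Fin H, (h : ℕ) = k → (h : ℕ) < n → (G.step (w h).1 : ℕ) = h ∧
      ∀ h' : Fin H, (h' : ℕ) + 1 = h → G.Edge (w h').1 (w h').2 (w h).1 := by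
    intro k
    induction k with
    | zero =>
      intro h hk hn
      have := hw h hn
      rw [POMG.envProb, if_pos hk] at this
      exact ⟨by rw [G.init_step _ this, hk], fun h' hh' => by omega⟩
    | succ k ih =>
      intro h hk hn
      have hp := (ih ⟨h - 1, by omega⟩ (by simp [hk]) (by simp; omega)).1
      have ht := hw h hn
      rw [POMG.envProb, if_neg (by omega)] at ht
      have hlt : (G.step (w ⟨h - 1, by omega⟩).1 : ℕ) + 1 < H := by
        rw [hp]; simp only; omega
      have hs := G.trans_step _ _ _ hlt ht
      refine ⟨by rw [hs, hp]; simp only; omega, fun h' hh' => ?_⟩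
      have : h' = ⟨h - 1, by omega⟩ := Fin.ext (by simp only; omega)
      rw [this]
      exact ⟨hs, ht⟩
  exact fun h hn => key h h rfl hn

theorem validPrefix_of_prefixProb {σ : G.Profile} {n : ℕ} {w : G.Path}
    (hw : G.prefixProb σ n w ≠ 0) : G.ValidPrefix n w := by
  refine G.validPrefix_of_envProb fun h hn => ?_
  have := Finset.prod_ne_zero_iff.1 hw h (mem_layersBelow.2 hn)
  exact left_ne_zero_of_mul this

theorem envProb_update_of_lt (w : G.Path) {h k : Fin H} (hk : h < k) (z : G.S × G.JointAction) :
    G.envProb (G.setStep w k z) h = G.envProb w h := by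
  have h1 : h ≠ k := hk.ne
  have h2 : (⟨h - 1, by omega⟩ : Fin H) ≠ k := by
    intro h2
    have := Fin.ext_iff.1 h2
    rw [Fin.lt_def] at hk
    simp only at this
    omega
  simp only [POMG.envProb, G.setStep_of_ne w h1, G.setStep_of_ne w h2]

theorem stepFactor_update_of_lt (σ : G.Profile) (w : G.Path) {h k : Fin H} (hk : h < k)
    (z : G.S × G.JointAction) :
    G.stepFactor σ (G.setStep w k z) h = G.stepFactor σ w h := by
  rw [stepFactor, G.envProb_update_of_lt w hk z, G.setStep_of_ne w hk.ne, stepFactor]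

theorem prefixProb_update (σ : G.Profile) (w : G.Path) (k : Fin H) (z : G.S × G.JointAction) :
    G.prefixProb σ k (G.setStep w k z) = G.prefixProb σ k w :=
  Finset.prod_congr rfl fun _ hh =>
    G.stepFactor_update_of_lt σ w (Fin.lt_def.2 (mem_layersBelow.1 hh)) z

theorem sum_jointAction (σ : G.Profile) (s : G.S) :
    ∑ a : G.JointAction, ∏ i, (σ i (G.obs i s)).1 (a i) = 1 := by
  classical
  rw [← Fintype.piFinset_univ, ← Finset.prod_univ_sum]
  exact Finset.prod_eq_one fun i _ => (σ i (G.obs i s)).2.2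

/-- Validity of the prefix puts the preceding state in layer `k - 1`, hence not in the last one;
only there is `trans` required to be a distribution. -/
theorem sum_stepFactor_update (σ : G.Profile) (w : G.Path) (k : Fin H)
    (hw : G.ValidPrefix k w) : ∑ z, G.stepFactor σ (G.setStep w k z) k = 1 := by
  simp only [stepFactor, setStep_self]
  by_cases hk : (k : ℕ) = 0
  · simp only [POMG.envProb, if_pos hk, setStep_self, Fintype.sum_prod_type,
      ← Finset.mul_sum, sum_jointAction, mul_one]
    exact G.init_mem.2
  · have hne : (⟨k - 1, by omega⟩ : Fin H) ≠ k := by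
      intro h
      have := Fin.ext_iff.1 h
      simp only at this
      omega
    simp only [POMG.envProb, if_neg hk, setStep_self, G.setStep_of_ne w hne,
      Fintype.sum_prod_type, ← Finset.mul_sum, sum_jointAction, mul_one]
    refine (G.trans_mem _ _ ?_).2
    rw [(hw ⟨k - 1, by omega⟩ (by simp only; omega)).1]
    simp only
    omega

/-- Marginalization: the layers from `n` on do not matter for a function of the first `n`
layers. -/
theorem sum_pathProb_mul (σ : G.Profile) (n : ℕ) (hn : n ≤ H) (F : G.Path → ℝ)
    (hF : ∀ (k : Fin H), n ≤ k → ∀ w z, F (G.setStep w k z) = F w) :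
    ∑ w, G.pathProb σ w * F w = (∑ w, G.prefixProb σ n w * F w) *
      ((Fintype.card (G.S × G.JointAction) : ℝ)⁻¹) ^ (H - n) := by
  -- One layer is summed out at a time. The sums keep ranging over whole paths, so each free layer
  -- overcounts by the cardinality that the inverse power removes.
  have key : ∀ j, n + j ≤ H → (∑ w, G.prefixProb σ (n + j) w * F w) *
      ((Fintype.card (G.S × G.JointAction) : ℝ)⁻¹) ^ (H - (n + j)) =
      (∑ w, G.prefixProb σ n w * F w) *
      ((Fintype.card (G.S × G.JointAction) : ℝ)⁻¹) ^ (H - n) := by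
    intro j
    induction j with
    | zero => intro _; rfl
    | succ j ih =>
      intro hj
      rw [← ih (by omega)]
      let k : Fin H := ⟨n + j, by omega⟩
      have hS : Nonempty G.S := by
        by_contra hS
        rw [not_nonempty_iff] at hS
        simpa using G.init_mem.2
      have hc : (Fintype.card (G.S × G.JointAction) : ℝ) ≠ 0 := by
        exact_mod_cast Fintype.card_ne_zero
      have hs := G.path_sum_update (fun w => G.prefixProb σ (n + j + 1) w * F w) k
      have hk : (k : ℕ) = n + j := rfl
      have hs' : ∀ w, ∑ z, G.prefixProb σ (n + j + 1) (G.setStep w k z) *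
          F (G.setStep w k z) = G.prefixProb σ (n + j) w * F w := by
        intro w
        rw [← hk]
        simp_rw [prefixProb_succ, prefixProb_update, hF k (by omega), mul_right_comm _ _ (F w)]
        rw [← Finset.mul_sum]
        -- Off the valid prefixes the step factors need not sum to one, but there the prefix has
        -- weight zero.
        by_cases h0 : G.prefixProb σ k w = 0
        · simp [h0]
        · rw [G.sum_stepFactor_update σ w k (G.validPrefix_of_prefixProb h0), mul_one]
      simp_rw [hs'] at hs
      rw [hs, show H - (n + j) = H - (n + (j + 1)) + 1 by omega, pow_succ, ← add_assoc]
      field_simp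
  rw [← key (H - n) (by omega)]
  simp [show n + (H - n) = H by omega, prefixProb_horizon]

theorem sum_pathProb (σ : G.Profile) : ∑ w, G.pathProb σ w = 1 := by
  have h := G.sum_pathProb_mul σ 0 (Nat.zero_le _) (fun _ => 1) (fun _ _ _ _ => rfl)
  have hS : Nonempty G.S := by
    by_contra hS
    rw [not_nonempty_iff] at hS
    simpa using G.init_mem.2
  have hc : (Fintype.card (G.S × G.JointAction) : ℝ) ≠ 0 := by
    exact_mod_cast Fintype.card_ne_zero
  have hP : Fintype.card G.Path = Fintype.card (G.S × G.JointAction) ^ H := by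
    classical
    have : Fintype.card (Fin H → G.S × G.JointAction) = _ := Fintype.card_fun
    rw [Fintype.card_fin] at this
    rw [← this]
    exact Fintype.card_congr (Equiv.refl _)
  simp only [mul_one, prefixProb, layersBelow_zero, Finset.prod_empty,
    Finset.sum_const, Finset.card_univ, hP, nsmul_eq_mul, Nat.cast_pow, Nat.sub_zero] at h
  rw [h, ← mul_pow, mul_inv_cancel₀ hc, one_pow]

theorem envProb_nonneg {w : G.Path} (h : Fin H) (hw : G.ValidPrefix h w) : 0 ≤ G.envProb w h := by
  rw [POMG.envProb]
  split_ifs with h0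
  · exact G.init_mem.1 _
  · refine (G.trans_mem _ _ ?_).1 _
    rw [(hw ⟨h - 1, by omega⟩ (by simp only; omega)).1]
    simp only
    omega

variable (i : Fin m)

/-- The factor of the probability of the first `n` layers of a path that does not come from
player `i`. -/
noncomputable def othersProb (σ : G.Profile) (n : ℕ) (w : G.Path) : ℝ :=
  ∏ h ∈ layersBelow H n,
    (G.envProb w h * ∏ j ∈ Finset.univ.erase i, (σ j (G.obs j (w h).1)).1 ((w h).2 j))

variable {i}

/-- Consecutive infosets of a valid path are linked by `Child`, so the product over the history in
the tree is the product along the path. -/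
theorem seqForm_path {w : G.Path} (π : G.Policy i) (k : Fin H) (hw : G.ValidPrefix (k + 1) w) :
    G.seqForm i π (G.obs i (w k).1) ((w k).2 i) =
      ∏ h ∈ layersBelow H (k + 1), (π (G.obs i (w h).1)).1 ((w h).2 i) := by
  have key : ∀ n (k : Fin H), (k : ℕ) = n → G.ValidPrefix (k + 1) w →
      G.seqForm i π (G.obs i (w k).1) ((w k).2 i) =
      ∏ h ∈ layersBelow H (k + 1), (π (G.obs i (w h).1)).1 ((w h).2 i) := by
    intro n
    induction n with
    | zero =>
      intro k hk hw
      rw [prod_layersBelow_succ, seqForm_eq, reach_root]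
      · simp [hk, layersBelow_zero]
      · rw [G.infoStep_obs, (hw k (by omega)).1, hk]
    | succ n ih =>
      intro k hk hw
      let k' : Fin H := ⟨n, by omega⟩
      have hk' : (k' : ℕ) + 1 = k := hk.symm
      rw [prod_layersBelow_succ, seqForm_eq, ← hk',
        ← ih k' rfl fun h hh => hw h (by omega), G.reach_child]
      exact ⟨_, _, _, (hw k (by omega)).2 k' hk', rfl, rfl, rfl⟩
  exact key k k rfl hw

/-- The source of linearity: player `i` enters the probability of a prefix only through the sequence
form of her last visited pair. If some environment factor vanishes, both sides are zero and validity
is not needed. -/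
theorem prefixProb_eq (σ : G.Profile) (k : Fin H) (w : G.Path) :
    G.prefixProb σ (k + 1) w =
      G.seqForm i (σ i) (G.obs i (w k).1) ((w k).2 i) * G.othersProb i σ (k + 1) w := by
  by_cases hw : ∀ h : Fin H, (h : ℕ) < k + 1 → G.envProb w h ≠ 0
  · rw [G.seqForm_path _ k (G.validPrefix_of_envProb hw), prefixProb, othersProb,
      ← Finset.prod_mul_distrib]
    refine Finset.prod_congr rfl fun h _ => ?_
    rw [stepFactor, ← Finset.mul_prod_erase _ _ (Finset.mem_univ i)]
    ring
  · push Not at hw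
    obtain ⟨h, hh, h0⟩ := hw
    have hm := mem_layersBelow.2 hh
    rw [prefixProb, othersProb, Finset.prod_eq_zero hm, Finset.prod_eq_zero hm, mul_zero]
    · rw [h0, zero_mul]
    · rw [stepFactor, h0, zero_mul]

theorem othersProb_nonneg (σ : G.Profile) (n : ℕ) (w : G.Path) : 0 ≤ G.othersProb i σ n w := by
  by_cases hw : ∀ h : Fin H, (h : ℕ) < n → G.envProb w h ≠ 0
  · refine Finset.prod_nonneg fun h hh => mul_nonneg ?_ ?_
    · exact G.envProb_nonneg h fun h' hh' => G.validPrefix_of_envProb hw h'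
        (hh'.trans (mem_layersBelow.1 hh))
    · exact Finset.prod_nonneg fun j _ => (σ j _).2.1 _
  · push Not at hw
    obtain ⟨h, hh, h0⟩ := hw
    have hm := mem_layersBelow.2 hh
    rw [othersProb, Finset.prod_eq_zero hm]
    rw [h0, zero_mul]

theorem othersProb_update (σ : G.Profile) (π : G.Policy i) (n : ℕ) (w : G.Path) :
    G.othersProb i (Function.update σ i π) n w = G.othersProb i σ n w := by
  refine Finset.prod_congr rfl fun h _ => ?_
  congr 1
  refine Finset.prod_congr rfl fun j hj => ?_
  rw [Function.update_of_ne (Finset.ne_of_mem_erase hj)]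

theorem pathProb_nonneg (σ : G.Profile) (w : G.Path) : 0 ≤ G.pathProb σ w := by
  rw [← prefixProb_horizon]
  by_cases hw : G.prefixProb σ H w = 0
  · exact hw.ge
  · refine Finset.prod_nonneg fun h hh => mul_nonneg ?_ ?_
    · exact G.envProb_nonneg h fun h' hh' => G.validPrefix_of_prefixProb hw h'
        (hh'.trans (mem_layersBelow.1 hh))
    · exact Finset.prod_nonneg fun j _ => (σ j _).2.1 _

/-- The visited pairs of player `i` are linked. -/
theorem desc_path_iff {w : G.Path} (hw : G.ValidPrefix H w) (k : Fin H) (x : G.X i) (a : G.A i) :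
    G.Desc i x a (G.obs i (w k).1) ↔ G.infoStep i x < k ∧
      G.obs i (w (G.infoStep i x)).1 = x ∧ (w (G.infoStep i x)).2 i = a := by
  have key : ∀ n (k : Fin H), (k : ℕ) = n → (G.Desc i x a (G.obs i (w k).1) ↔
      G.infoStep i x < k ∧
      G.obs i (w (G.infoStep i x)).1 = x ∧ (w (G.infoStep i x)).2 i = a) := by
    intro n
    induction n with
    | zero =>
      intro k hk
      constructor
      · intro hd
        have := G.infoStep_of_desc hd
        rw [G.infoStep_obs, (hw k k.2).1] at this
        omega
      · rintro ⟨h, -⟩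
        rw [Fin.lt_def] at h
        omega
    | succ n ih =>
      intro k hk
      let k' : Fin H := ⟨n, by omega⟩
      have hk' : (k' : ℕ) + 1 = k := hk.symm
      have hc : G.Child i (G.obs i (w k').1) ((w k').2 i) (G.obs i (w k).1) :=
        ⟨_, _, _, (hw k k.2).2 k' hk', rfl, rfl, rfl⟩
      rw [G.desc_child_iff hc, ih k' rfl]
      have hs : G.infoStep i (G.obs i (w k').1) = k' :=
        Fin.ext (by rw [G.infoStep_obs, (hw k' k'.2).1])
      constructor
      · rintro (h | ⟨h, h'⟩)
        · obtain ⟨rfl, rfl⟩ := Prod.ext_iff.1 h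
          simp only [hs, and_self, and_true]
          rw [Fin.lt_def]
          omega
        · refine ⟨?_, h'⟩
          rw [Fin.lt_def] at h ⊢
          omega
      · rintro ⟨h, h1, h2⟩
        rcases eq_or_ne (G.infoStep i x) k' with h' | h'
        · rw [h'] at h1 h2
          exact .inl (by rw [h1, h2])
        · refine .inr ⟨?_, h1, h2⟩
          rw [Fin.lt_def] at h ⊢
          have := Fin.val_ne_of_ne h'
          omega
  exact key k k rfl

end Paths

end IIEFG

namespace IIEFG

/-! ### Expected losses: values are affine in the sequence form. -/

section Expectations

variable {m H : ℕ} (G : IIEFG.{u} m H)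

/-- The law of the rewards of an episode, given its states and joint actions. -/
noncomputable def rewardLaw (w : G.Path) : Measure (Fin H → Fin m → unitInterval) :=
  Measure.pi fun h => (G.reward (w h).1 (w h).2 : Measure (Fin m → unitInterval))

instance (w : G.Path) : IsProbabilityMeasure (G.rewardLaw w) := by
  unfold rewardLaw; infer_instance

theorem episodeLaw_eq (σ : G.Profile) :
    G.episodeLaw σ = ∑ w, ENNReal.ofReal (G.pathProb σ w) •
      (G.rewardLaw w).map (Prod.mk w) := by
  simp only [POMG.episodeLaw, rewardLaw, Measure.dirac_prod]

instance (σ : G.Profile) : IsProbabilityMeasure (G.episodeLaw σ) := by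
  constructor
  have : ∀ w, ((G.rewardLaw w).map (Prod.mk w)) Set.univ = 1 := fun w => by
    rw [Measure.map_apply measurable_prodMk_left MeasurableSet.univ]
    simp
  rw [episodeLaw_eq, Measure.finsetSum_apply]
  simp only [Measure.smul_apply, this, smul_eq_mul, mul_one]
  rw [← ENNReal.ofReal_sum_of_nonneg fun w _ => G.pathProb_nonneg σ w, G.sum_pathProb,
    ENNReal.ofReal_one]

theorem integral_episodeLaw (σ : G.Profile) {f : G.Episode → ℝ} (hf : Measurable f) {B : ℝ}
    (hB : ∀ e, |f e| ≤ B) :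
    ∫ e, f e ∂G.episodeLaw σ = ∑ w, G.pathProb σ w * ∫ r, f (w, r) ∂G.rewardLaw w := by
  have hi : ∀ w, Integrable f ((G.rewardLaw w).map (Prod.mk w)) := fun w => by
    have : IsProbabilityMeasure ((G.rewardLaw w).map (Prod.mk w)) :=
      Measure.isProbabilityMeasure_map measurable_prodMk_left.aemeasurable
    exact .of_bound hf.aestronglyMeasurable B (.of_forall hB)
  rw [episodeLaw_eq, integral_finsetSum_measure]
  · refine Finset.sum_congr rfl fun w _ => ?_
    rw [integral_smul_measure, ENNReal.toReal_ofReal (G.pathProb_nonneg σ w), smul_eq_mul,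
      integral_map measurable_prodMk_left.aemeasurable hf.aestronglyMeasurable]
  · exact fun w _ => (hi w).smul_measure ENNReal.ofReal_ne_top

theorem ae_validPrefix (σ : G.Profile) : ∀ᵐ e ∂G.episodeLaw σ, G.ValidPrefix H e.1 := by
  have hm : MeasurableSet {e : G.Episode | ¬ G.ValidPrefix H e.1} :=
    measurable_fst (MeasurableSpace.measurableSet_top (s := {w | ¬ G.ValidPrefix H w}))
  rw [ae_iff, episodeLaw_eq, Measure.finsetSum_apply]
  refine Finset.sum_eq_zero fun w _ => ?_
  rw [Measure.smul_apply, Measure.map_apply measurable_prodMk_left hm, smul_eq_mul]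
  by_cases hw : G.pathProb σ w = 0
  · simp [hw]
  · have : G.ValidPrefix H w := G.validPrefix_of_prefixProb (by rwa [prefixProb_horizon])
    simp [this]

theorem measurable_episode {f : G.Episode → ℝ} (hf : ∀ w, Measurable fun r => f (w, r)) :
    Measurable f := measurable_from_prod_countable_right hf

variable {i : Fin m}

theorem measurable_visit (x : G.X i) (a : G.A i) : Measurable fun e => G.visit i e x a :=
  G.measurable_episode fun w => (measurable_const :
    Measurable fun _ : Fin H → Fin m → unitInterval => G.visit i (w, fun _ _ => 0) x a)

theorem measurable_reward (h : Fin H) : Measurable fun e : G.Episode => (e.2 h i : ℝ) := by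
  fun_prop

theorem visit_nonneg (e : G.Episode) (x : G.X i) (a : G.A i) : 0 ≤ G.visit i e x a := by
  unfold visit; split_ifs <;> simp

theorem visit_le_one (e : G.Episode) (x : G.X i) (a : G.A i) : G.visit i e x a ≤ 1 := by
  unfold visit; split_ifs <;> simp

/-- The loss of player `i` at `(x, a)` in an episode, zero if `(x, a)` is not visited. -/
noncomputable def visitLoss (e : G.Episode) (x : G.X i) (a : G.A i) : ℝ :=
  G.visit i e x a * (1 - (e.2 (G.infoStep i x) i : ℝ))

theorem measurable_visitLoss (x : G.X i) (a : G.A i) : Measurable fun e => G.visitLoss e x a :=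
  (G.measurable_visit x a).mul ((G.measurable_reward _).const_sub 1)

theorem visitLoss_nonneg (e : G.Episode) (x : G.X i) (a : G.A i) : 0 ≤ G.visitLoss e x a :=
  mul_nonneg (G.visit_nonneg e x a) (sub_nonneg.2 (e.2 _ i).2.2)

theorem visitLoss_le_visit (e : G.Episode) (x : G.X i) (a : G.A i) :
    G.visitLoss e x a ≤ G.visit i e x a :=
  mul_le_of_le_one_right (G.visit_nonneg e x a) (by linarith [(e.2 (G.infoStep i x) i).2.1])

theorem visitLoss_le_one (e : G.Episode) (x : G.X i) (a : G.A i) : G.visitLoss e x a ≤ 1 :=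
  (G.visitLoss_le_visit e x a).trans (G.visit_le_one e x a)

theorem abs_visitLoss_le (e : G.Episode) (x : G.X i) (a : G.A i) : |G.visitLoss e x a| ≤ 1 := by
  rw [abs_of_nonneg (G.visitLoss_nonneg e x a)]
  exact G.visitLoss_le_one e x a

theorem integrable_visitLoss (σ : G.Profile) (x : G.X i) (a : G.A i) :
    Integrable (fun e => G.visitLoss e x a) (G.episodeLaw σ) :=
  .of_bound (G.measurable_visitLoss x a).aestronglyMeasurable 1
    (.of_forall fun e => G.abs_visitLoss_le e x a)

variable (i) in
/-- The expected loss of player `i` at a state and a joint action. -/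
noncomputable def meanLoss (s : G.S) (a : G.JointAction) : ℝ :=
  ∫ r, (1 - (r i : ℝ)) ∂(G.reward s a : Measure (Fin m → unitInterval))

theorem meanLoss_nonneg (s : G.S) (a : G.JointAction) : 0 ≤ G.meanLoss i s a :=
  integral_nonneg fun r => sub_nonneg.2 (r i).2.2

theorem integral_rewardLaw (w : G.Path) (h : Fin H) :
    ∫ r, (1 - (r h i : ℝ)) ∂G.rewardLaw w = G.meanLoss i (w h).1 (w h).2 := by
  rw [meanLoss, rewardLaw]
  exact integral_comp_eval (μ := fun h => (G.reward (w h).1 (w h).2 :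
    Measure (Fin m → unitInterval))) (i := h) (f := fun r => 1 - (r i : ℝ))
    (by fun_prop : Measurable fun r : Fin m → unitInterval => 1 - (r i : ℝ)).aestronglyMeasurable

open Classical in
/-- The expected loss of player `i` at `(x, a)`, weighted with the probability that the
environment and the other players give to this pair. -/
noncomputable def counterfactualLoss (σ : G.Profile) (x : G.X i) (a : G.A i) : ℝ :=
  (∑ w : G.Path, G.othersProb i σ (G.infoStep i x + 1) w *
    ((if G.obs i (w (G.infoStep i x)).1 = x ∧ (w (G.infoStep i x)).2 i = a then 1 else 0) *
      G.meanLoss i (w (G.infoStep i x)).1 (w (G.infoStep i x)).2)) *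
    ((Fintype.card (G.S × G.JointAction) : ℝ)⁻¹) ^ (H - (G.infoStep i x + 1))

theorem counterfactualLoss_nonneg (σ : G.Profile) (x : G.X i) (a : G.A i) :
    0 ≤ G.counterfactualLoss σ x a := by
  refine mul_nonneg (Finset.sum_nonneg fun w _ => mul_nonneg (G.othersProb_nonneg _ _ _)
    (mul_nonneg ?_ (G.meanLoss_nonneg _ _))) (by positivity)
  split_ifs <;> simp

theorem counterfactualLoss_update (σ : G.Profile) (π : G.Policy i) :
    G.counterfactualLoss (i := i) (Function.update σ i π) = G.counterfactualLoss σ := by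
  funext x a
  simp only [counterfactualLoss, othersProb_update]

/-- On the paths through `(x, a)` the contribution of player `i` is constant and leaves the sum; the
layers after `x` are marginalized. -/
theorem integral_visitLoss (σ : G.Profile) (x : G.X i) (a : G.A i) :
    ∫ e, G.visitLoss e x a ∂G.episodeLaw σ =
      G.seqForm i (σ i) x a * G.counterfactualLoss σ x a := by
  classical
  rw [G.integral_episodeLaw σ (G.measurable_visitLoss x a) fun e => G.abs_visitLoss_le e x a]
  set h := G.infoStep i x with hh
  let F : G.Path → ℝ := fun w => (if G.obs i (w h).1 = x ∧ (w h).2 i = a then 1 else 0) *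
    G.meanLoss i (w h).1 (w h).2
  have hF : ∀ w, ∫ r, G.visitLoss (w, r) x a ∂G.rewardLaw w = F w := by
    intro w
    simp only [visitLoss, visit, F, ← hh]
    rw [integral_const_mul, integral_rewardLaw]
  simp only [hF]
  rw [G.sum_pathProb_mul σ (h + 1) h.2 F, counterfactualLoss, ← mul_assoc, Finset.mul_sum]
  · congr 1
    refine Finset.sum_congr rfl fun w _ => ?_
    simp only [F, ← hh]
    split_ifs with hv
    · rw [G.prefixProb_eq (i := i), hv.1, hv.2, mul_assoc]
    · simp
  · intro k hk w z
    have : h ≠ k := by rintro rfl; omega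
    simp only [F, G.setStep_of_ne w this]

theorem infoStep_obs_path {w : G.Path} (hw : G.ValidPrefix H w) (h : Fin H) :
    G.infoStep i (G.obs i (w h).1) = h :=
  Fin.ext (by rw [G.infoStep_obs, (hw h h.2).1])

open Classical in
theorem visit_eq (e : G.Episode) {h : Fin H} {x : G.X i} (hx : G.infoStep i x = h) (a : G.A i) :
    G.visit i e x a = if G.obs i (e.1 h).1 = x ∧ (e.1 h).2 i = a then 1 else 0 := by
  subst hx
  unfold visit
  congr

/-- Exactly one pair is visited in a layer. -/
theorem sum_layer_visit_mul {e : G.Episode} (he : G.ValidPrefix H e.1) (h : Fin H)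
    (f : G.X i → G.A i → ℝ) :
    ∑ x with G.infoStep i x = h, ∑ a, G.visit i e x a * f x a =
      f (G.obs i (e.1 h).1) ((e.1 h).2 i) := by
  classical
  rw [Finset.sum_eq_single (G.obs i (e.1 h).1), Finset.sum_eq_single ((e.1 h).2 i)]
  · rw [G.visit_eq e (G.infoStep_obs_path he h)]
    simp
  · intro a _ ha
    rw [G.visit_eq e (G.infoStep_obs_path he h)]
    simp [ha.symm]
  · simp
  · intro x hx hne
    refine Finset.sum_eq_zero fun a _ => ?_
    rw [G.visit_eq e (Finset.mem_filter.1 hx).2]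
    simp [hne.symm]
  · intro hx
    exact absurd (by simpa using G.infoStep_obs_path he h) hx

theorem sum_layer_visitLoss {e : G.Episode} (he : G.ValidPrefix H e.1) (h : Fin H) :
    ∑ x with G.infoStep i x = h, ∑ a, G.visitLoss e x a = 1 - (e.2 h i : ℝ) := by
  have := G.sum_layer_visit_mul he h fun (x : G.X i) _ => 1 - (e.2 (G.infoStep i x) i : ℝ)
  rw [G.infoStep_obs_path he h] at this
  exact this

/-- At most one pair is visited in a layer, for all paths. -/
theorem sum_layer_visit_le (e : G.Episode) (h : Fin H) :
    ∑ x with G.infoStep i x = h, ∑ a, G.visit i e x a ≤ 1 := by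
  classical
  calc ∑ x with G.infoStep i x = h, ∑ a, G.visit i e x a
      = ∑ x with G.infoStep i x = h, ∑ a,
        (if G.obs i (e.1 h).1 = x ∧ (e.1 h).2 i = a then (1 : ℝ) else 0) :=
        Finset.sum_congr rfl fun x hx => Finset.sum_congr rfl fun a _ =>
          G.visit_eq e (Finset.mem_filter.1 hx).2 a
    _ ≤ ∑ x, ∑ a, (if G.obs i (e.1 h).1 = x ∧ (e.1 h).2 i = a then (1 : ℝ) else 0) :=
        Finset.sum_le_sum_of_subset_of_nonneg (Finset.filter_subset _ _) fun x _ _ =>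
          Finset.sum_nonneg fun a _ => by split_ifs <;> simp
    _ = 1 := by simp [ite_and]

theorem sum_layers (f : G.X i → ℝ) :
    ∑ x, f x = ∑ h : Fin H, ∑ x with G.infoStep i x = h, f x :=
  (Finset.sum_fiberwise _ _ _).symm

theorem sum_visit_le (e : G.Episode) : ∑ x, ∑ a, G.visit i e x a ≤ H := by
  rw [sum_layers]
  calc _ ≤ ∑ h : Fin H, (1 : ℝ) := Finset.sum_le_sum fun h _ => G.sum_layer_visit_le e h
    _ = H := by simp

/-- The expected loss of a layer. -/
theorem sum_layer_seqForm_counterfactualLoss (σ : G.Profile) (h : Fin H) :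
    ∑ x : G.X i with G.infoStep i x = h, ∑ a,
      G.seqForm i (σ i) x a * G.counterfactualLoss σ x a =
      ∫ e, (1 - (e.2 h i : ℝ)) ∂G.episodeLaw σ := by
  simp_rw [← integral_visitLoss]
  simp_rw [← integral_finsetSum _ fun a _ => G.integrable_visitLoss σ _ a]
  rw [← integral_finsetSum _ fun x _ => integrable_finsetSum _ fun a _ =>
    G.integrable_visitLoss σ x a]
  refine integral_congr_ae ?_
  filter_upwards [G.ae_validPrefix σ] with e he
  exact G.sum_layer_visitLoss he h

/-- The counterfactual loss ignores the policy of player `i`, so the sum is the expected loss of one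
layer after she switches to `π`. Policies other than the played one, such as exploring ones, are
bounded through this. -/
theorem sum_layer_seqForm_counterfactualLoss_le (σ : G.Profile) (π : G.Policy i) (h : Fin H) :
    ∑ x : G.X i with G.infoStep i x = h, ∑ a,
      G.seqForm i π x a * G.counterfactualLoss σ x a ≤ 1 := by
  have := G.sum_layer_seqForm_counterfactualLoss (i := i) (Function.update σ i π) h
  rw [Function.update_self, counterfactualLoss_update] at this
  rw [this]
  have hB : ∀ e : G.Episode, 1 - (e.2 h i : ℝ) ≤ 1 := fun e => by linarith [(e.2 h i).2.1]
  calc _ ≤ ∫ e, (1 : ℝ) ∂G.episodeLaw (Function.update σ i π) := by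
        refine integral_mono_of_nonneg (.of_forall fun e => sub_nonneg.2 (e.2 h i).2.2)
          (integrable_const 1) (.of_forall hB)
    _ = 1 := by simp

theorem sum_seqForm_counterfactualLoss_le (σ : G.Profile) (π : G.Policy i) (s : Finset (G.X i)) :
    ∑ x ∈ s, ∑ a, G.seqForm i π x a * G.counterfactualLoss σ x a ≤ H := by
  calc _ ≤ ∑ x, ∑ a, G.seqForm i π x a * G.counterfactualLoss σ x a :=
        Finset.sum_le_sum_of_subset_of_nonneg (Finset.subset_univ s) fun x _ _ =>
          Finset.sum_nonneg fun a _ => mul_nonneg (G.seqForm_nonneg π x a)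
            (G.counterfactualLoss_nonneg σ x a)
    _ ≤ ∑ h : Fin H, (1 : ℝ) := by
        rw [sum_layers]
        exact Finset.sum_le_sum fun h _ => G.sum_layer_seqForm_counterfactualLoss_le σ π h
    _ = H := by simp

theorem integrable_reward (σ : G.Profile) (h : Fin H) :
    Integrable (fun e : G.Episode => (e.2 h i : ℝ)) (G.episodeLaw σ) :=
  .of_bound (G.measurable_reward h).aestronglyMeasurable 1
    (.of_forall fun e => by rw [Real.norm_of_nonneg (e.2 h i).2.1]; exact (e.2 h i).2.2)

theorem value_eq (σ : G.Profile) :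
    G.value i σ = H - ∑ x : G.X i, ∑ a, G.seqForm i (σ i) x a * G.counterfactualLoss σ x a := by
  rw [sum_layers]
  simp_rw [sum_layer_seqForm_counterfactualLoss]
  rw [POMG.value, integral_finsetSum _ fun h _ => G.integrable_reward σ h, eq_sub_iff_add_eq,
    ← Finset.sum_add_distrib]
  calc _ = ∑ h : Fin H, (1 : ℝ) := by
        refine Finset.sum_congr rfl fun h _ => ?_
        rw [integral_sub (integrable_const _) (G.integrable_reward σ h)]
        simp
    _ = H := by simp

theorem value_update (σ : G.Profile) (π : G.Policy i) :
    G.value i (Function.update σ i π) =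
      H - ∑ x : G.X i, ∑ a, G.seqForm i π x a * G.counterfactualLoss σ x a := by
  rw [value_eq, counterfactualLoss_update, Function.update_self]

theorem value_mem_Icc (σ : G.Profile) : G.value i σ ∈ Set.Icc (0 : ℝ) H := by
  rw [value_eq]
  constructor
  · linarith [G.sum_seqForm_counterfactualLoss_le σ (σ i) Finset.univ]
  · have : 0 ≤ ∑ x : G.X i, ∑ a, G.seqForm i (σ i) x a * G.counterfactualLoss σ x a :=
      Finset.sum_nonneg fun x _ => Finset.sum_nonneg fun a _ => mul_nonneg (G.seqForm_nonneg _ x a)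
            (G.counterfactualLoss_nonneg σ x a)
    linarith

open Classical in
/-- The loss from `(x, a)` on, if this pair is visited. -/
theorem visit_mul_tail {e : G.Episode} (he : G.ValidPrefix H e.1) (x : G.X i) (a : G.A i) :
    G.visit i e x a * ((H : ℝ) - (G.infoStep i x : ℕ) -
      ∑ h' ∈ Finset.Ici (G.infoStep i x), (e.2 h' i : ℝ)) =
      G.visitLoss e x a + ∑ y with G.Desc i x a y, ∑ b, G.visitLoss e y b := by
  have h1 : (H : ℝ) - (G.infoStep i x : ℕ) - ∑ h' ∈ Finset.Ici (G.infoStep i x), (e.2 h' i : ℝ) =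
      (1 - (e.2 (G.infoStep i x) i : ℝ)) +
        ∑ h' ∈ Finset.Ioi (G.infoStep i x), (1 - (e.2 h' i : ℝ)) := by
    have hc : (H : ℝ) - (G.infoStep i x : ℕ) = ∑ h' ∈ Finset.Ici (G.infoStep i x), (1 : ℝ) := by
      simp [Nat.cast_sub (G.infoStep i x).2.le]
    rw [hc, ← Finset.sum_sub_distrib, ← Finset.Ioi_insert, Finset.sum_insert (by simp)]
  -- On a valid path that visits `y`, the earlier pair `(x, a)` is visited exactly when it precedes
  -- `y`.
  have h2 : ∀ y b, G.infoStep i x < G.infoStep i y → G.visitLoss e y b * G.visit i e x a =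
      if G.Desc i x a y then G.visitLoss e y b else 0 := by
    intro y b hlt
    split_ifs with hd
    · by_cases hv : G.obs i (e.1 (G.infoStep i y)).1 = y ∧ (e.1 (G.infoStep i y)).2 i = b
      · rw [← hv.1, G.desc_path_iff he] at hd
        rw [G.visit_eq e rfl, if_pos hd.2, mul_one]
      · rw [visitLoss, G.visit_eq e rfl, if_neg hv]
        simp
    · by_cases hv : G.obs i (e.1 (G.infoStep i y)).1 = y ∧ (e.1 (G.infoStep i y)).2 i = b
      · rw [← hv.1, G.desc_path_iff he] at hd
        rw [G.visit_eq e (x := x) rfl, if_neg fun h => hd ⟨hlt, h⟩, mul_zero]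
      · rw [visitLoss, G.visit_eq e rfl, if_neg hv]
        simp
  rw [h1, mul_add, visitLoss, add_right_inj, Finset.mul_sum]
  simp_rw [← G.sum_layer_visitLoss he, Finset.mul_sum]
  have h3 : ∀ h' ∈ Finset.Ioi (G.infoStep i x), ∑ y with G.infoStep i y = h', ∑ b,
      G.visit i e x a * G.visitLoss e y b =
      ∑ y with G.infoStep i y = h', ∑ b, if G.Desc i x a y then G.visitLoss e y b else 0 := by
    intro h' hh'
    refine Finset.sum_congr rfl fun y hy => Finset.sum_congr rfl fun b _ => ?_
    have hlt : G.infoStep i x < G.infoStep i y := by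
      rw [(Finset.mem_filter.1 hy).2]
      exact Finset.mem_Ioi.1 hh'
    rw [mul_comm, h2 y b hlt]
  rw [Finset.sum_congr rfl h3, Finset.sum_filter, sum_layers]
  refine (Finset.sum_subset (Finset.subset_univ _) fun h' _ hh' => ?_).trans
    (Finset.sum_congr rfl fun h' _ => Finset.sum_congr rfl fun y _ => ?_)
  · refine Finset.sum_eq_zero fun y hy => Finset.sum_eq_zero fun b _ => if_neg fun hd => hh' ?_
    rw [Finset.mem_Ioi, ← (Finset.mem_filter.1 hy).2]
    exact G.infoStep_of_desc hd
  · split_ifs <;> simp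

/-- The loss from `(x, a)` on has the expected value of the pair, for a profile in which player
`i` plays `π` after the layer of `x`. -/
theorem integral_visit_mul_tail (σ : G.Profile) (π : G.Policy i) (x : G.X i) (a : G.A i)
    (hσ : ∀ y, G.infoStep i x < G.infoStep i y → σ i y = π y) :
    ∫ e, G.visit i e x a * ((H : ℝ) - (G.infoStep i x : ℕ) -
      ∑ h' ∈ Finset.Ici (G.infoStep i x), (e.2 h' i : ℝ)) ∂G.episodeLaw σ =
      G.seqForm i (σ i) x a * G.actionValue π (G.counterfactualLoss σ) x a := by
  classical
  rw [G.seqForm_mul_actionValue π (σ i) x a hσ]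
  simp_rw [← integral_visitLoss]
  simp_rw [← integral_finsetSum _ fun b _ => G.integrable_visitLoss σ _ b]
  rw [← integral_finsetSum _ fun y _ => integrable_finsetSum _ fun b _ =>
    G.integrable_visitLoss σ y b, ← integral_add (G.integrable_visitLoss σ x a)
    (integrable_finsetSum _ fun y _ => integrable_finsetSum _ fun b _ =>
      G.integrable_visitLoss σ y b)]
  refine integral_congr_ae ?_
  filter_upwards [G.ae_validPrefix σ] with e he
  exact G.visit_mul_tail he x a

end Expectations

end IIEFG

/-! ### Conditional laws of episodes and exponential concentration. -/

/-- The hypothesis identifies the joint law of `(q, e)` with a composition product on rectangles,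
which determine it. It is applied with `q` the identity of `Ω` into `Ω` with the σ-algebra of the
past. -/
theorem lintegral_of_condLaw {Ω Ω' E : Type*} [MeasurableSpace Ω] [MeasurableSpace Ω']
    [MeasurableSpace E] (P : Measure Ω) [IsProbabilityMeasure P] (q : Ω → Ω') (hq : Measurable q)
    (e : Ω → E) (he : Measurable e) (κ : Kernel Ω' E) [IsMarkovKernel κ]
    (h : ∀ A, MeasurableSet A → ∀ B, MeasurableSet B →
      P (q ⁻¹' A ∩ e ⁻¹' B) = ∫⁻ ω in q ⁻¹' A, κ (q ω) B ∂P)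
    (F : Ω' × E → ENNReal) (hF : Measurable F) :
    ∫⁻ ω, F (q ω, e ω) ∂P = ∫⁻ ω, ∫⁻ y, F (q ω, y) ∂κ (q ω) ∂P := by
  have : IsProbabilityMeasure (P.map q) := Measure.isProbabilityMeasure_map hq.aemeasurable
  have hqe : Measurable fun ω => (q ω, e ω) := hq.prodMk he
  have : IsProbabilityMeasure (P.map fun ω => (q ω, e ω)) :=
    Measure.isProbabilityMeasure_map hqe.aemeasurable
  have key : P.map (fun ω => (q ω, e ω)) = (P.map q) ⊗ₘ κ := by
    refine Measure.ext_prod fun {A} {B} hA hB => ?_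
    rw [Measure.map_apply hqe (hA.prod hB), Measure.compProd_apply_prod hA hB,
      setLIntegral_map hA (κ.measurable_coe hB) hq, ← h A hA B hB]
    rfl
  rw [← lintegral_map hF hqe, key, Measure.lintegral_compProd hF,
    lintegral_map hF.lintegral_kernel_prod_right' hq]

/-- The expectation of `exp ψ` is at most `1 + b ≤ exp b`. Both kinds of supermartingale increments
used below arise from a pointwise bound of this form. -/
theorem lintegral_exp_sub_le_one {E : Type*} [MeasurableSpace E] (μ : Measure E)
    [IsProbabilityMeasure μ] {ψ g : E → ℝ} {b : ℝ} (hg : Integrable g μ)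
    (h : ∀ e, Real.exp (ψ e) ≤ 1 + g e) (hb : ∫ e, g e ∂μ ≤ b) :
    ∫⁻ e, ENNReal.ofReal (Real.exp (ψ e - b)) ∂μ ≤ 1 := by
  calc ∫⁻ e, ENNReal.ofReal (Real.exp (ψ e - b)) ∂μ
      ≤ ∫⁻ e, ENNReal.ofReal (Real.exp (-b) * (1 + g e)) ∂μ := by
        refine lintegral_mono fun e => ENNReal.ofReal_le_ofReal ?_
        rw [sub_eq_neg_add, Real.exp_add]
        gcongr
        exact h e
    _ = ENNReal.ofReal (∫ e, Real.exp (-b) * (1 + g e) ∂μ) := by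
        rw [ofReal_integral_eq_lintegral_ofReal]
        · exact ((integrable_const 1).add hg).const_mul _
        · refine .of_forall fun e => mul_nonneg (Real.exp_pos _).le ?_
          exact (Real.exp_pos _).le.trans (h e)
    _ ≤ 1 := by
        rw [← ENNReal.ofReal_one]
        refine ENNReal.ofReal_le_ofReal ?_
        rw [integral_const_mul, integral_add (integrable_const 1) hg]
        have h1 : 1 + ∫ e, g e ∂μ ≤ Real.exp b := by linarith [Real.add_one_le_exp b]
        calc _ ≤ Real.exp (-b) * Real.exp b := by
              gcongr
              simpa using h1
          _ = 1 := by rw [← Real.exp_add]; simp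

namespace IIEFG

section Concentration

variable {m H : ℕ} (G : IIEFG.{u} m H) {Ω : Type v}

/-- Joint measurability of a function of the past and of an episode. -/
def JointMeasurable (mΩ : MeasurableSpace Ω) (f : Ω → G.Episode → ℝ) : Prop :=
  Measurable[mΩ.prod inferInstance] fun p : Ω × G.Episode => f p.1 p.2

variable {G}

theorem JointMeasurable.of_left {mΩ : MeasurableSpace Ω} {f : Ω → ℝ} (hf : Measurable f) :
    G.JointMeasurable mΩ fun ω _ => f ω := hf.comp measurable_fst

theorem JointMeasurable.of_right {mΩ : MeasurableSpace Ω} {f : G.Episode → ℝ}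
    (hf : Measurable f) : G.JointMeasurable mΩ fun _ e => f e := hf.comp measurable_snd

variable (G)

/-- All components of a random profile are measurable. -/
def MeasurableProfile (mΩ : MeasurableSpace Ω) (σ : Ω → G.Profile) : Prop :=
  ∀ i x a, Measurable[mΩ] fun ω => (σ ω i x).1 a

variable {G}

theorem MeasurableProfile.seqForm {mΩ : MeasurableSpace Ω} {σ : Ω → G.Profile}
    (hσ : G.MeasurableProfile mΩ σ) (i : Fin m) (x : G.X i) (a : G.A i) :
    Measurable fun ω => G.seqForm i (σ ω i) x a :=
  (Finset.measurable_prod _ fun _ _ => hσ _ _ _).mul (hσ _ _ _)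

theorem MeasurableProfile.pathProb {mΩ : MeasurableSpace Ω} {σ : Ω → G.Profile}
    (hσ : G.MeasurableProfile mΩ σ) (w : G.Path) : Measurable fun ω => G.pathProb (σ ω) w :=
  Finset.measurable_prod _ fun _ _ =>
    (Finset.measurable_prod _ fun _ _ => hσ _ _ _).const_mul _

theorem MeasurableProfile.counterfactualLoss {mΩ : MeasurableSpace Ω} {σ : Ω → G.Profile}
    (hσ : G.MeasurableProfile mΩ σ) (i : Fin m) (x : G.X i) (a : G.A i) :
    Measurable fun ω => G.counterfactualLoss (σ ω) x a :=
  (Finset.measurable_sum _ fun _ _ => (Finset.measurable_prod _ fun _ _ =>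
    (Finset.measurable_prod _ fun _ _ => hσ _ _ _).const_mul _).mul_const _).mul_const _

theorem MeasurableProfile.integral {mΩ : MeasurableSpace Ω} {σ : Ω → G.Profile}
    (hσ : G.MeasurableProfile mΩ σ) {f : G.Episode → ℝ} (hf : Measurable f) {B : ℝ}
    (hB : ∀ e, |f e| ≤ B) : Measurable fun ω => ∫ e, f e ∂G.episodeLaw (σ ω) := by
  simp_rw [G.integral_episodeLaw _ hf hB]
  exact Finset.measurable_sum _ fun w _ => (hσ.pathProb w).mul_const _

/-- The law of the next episode given the past, as a kernel. -/
noncomputable def MeasurableProfile.kernel {mΩ : MeasurableSpace Ω} {σ : Ω → G.Profile}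
    (hσ : G.MeasurableProfile mΩ σ) : Kernel Ω G.Episode where
  toFun ω := G.episodeLaw (σ ω)
  measurable' := by
    refine Measure.measurable_of_measurable_coe _ fun B _ => ?_
    simp only [episodeLaw_eq, Measure.finsetSum_apply, Measure.smul_apply, smul_eq_mul]
    exact Finset.measurable_sum _ fun w _ => (hσ.pathProb w).ennreal_ofReal.mul_const _

instance {mΩ : MeasurableSpace Ω} {σ : Ω → G.Profile} (hσ : G.MeasurableProfile mΩ σ) :
    IsMarkovKernel hσ.kernel :=
  ⟨fun ω => inferInstanceAs (IsProbabilityMeasure (G.episodeLaw (σ ω)))⟩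

variable [mΩ : MeasurableSpace Ω] {P : Measure Ω} {N : ℕ}

theorem measurable_profile (play : G.Play P N) {n : ℕ} (hn : n < N) :
    G.MeasurableProfile (play.ℱ n) (play.profile n) := play.profile_measurable n hn

variable [IsProbabilityMeasure P]

/-- Lifts the prescribed conditional probabilities of events to functions of the past and the new
episode jointly. -/
theorem lintegral_episode (play : G.Play P N) {n : ℕ} (hn : n < N)
    {F : Ω × G.Episode → ENNReal} (hF : Measurable[(play.ℱ n).prod inferInstance] F) :
    ∫⁻ ω, F (ω, play.episode n ω) ∂P =
      ∫⁻ ω, ∫⁻ e, F (ω, e) ∂G.episodeLaw (play.profile n ω) ∂P := by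
  have hle := play.ℱ.le n
  refine @lintegral_of_condLaw Ω Ω G.Episode mΩ (play.ℱ n) _ P _ id (measurable_id'' hle)
    (play.episode n) ((play.episode_measurable n hn).mono (play.ℱ.le _) le_rfl)
    (measurable_profile play hn).kernel _ ?_ F hF
  intro A hA B hB
  have hA' := hle A hA
  have hB' : MeasurableSet (play.episode n ⁻¹' B) :=
    play.ℱ.le _ _ (play.episode_measurable n hn hB)
  have h1 := setIntegral_condExp (μ := P) hle
    (f := (play.episode n ⁻¹' B).indicator fun _ => (1 : ℝ))
    ((integrable_const 1).indicator hB') hA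
  rw [setIntegral_congr_ae (g := fun ω => (G.episodeLaw (play.profile n ω)).real B) hA'
    ((play.episode_law n hn B hB).mono fun ω hω _ => hω), setIntegral_indicator hB',
    setIntegral_const, smul_eq_mul, mul_one] at h1
  have h2 : Measurable fun ω => (G.episodeLaw (play.profile n ω)) B :=
    (((measurable_profile play hn).kernel.measurable_coe hB)).mono hle le_rfl
  have h3 : ∫⁻ ω in A, G.episodeLaw (play.profile n ω) B ∂P =
      ENNReal.ofReal (∫ ω in A, (G.episodeLaw (play.profile n ω)).real B ∂P) := by
    rw [ofReal_integral_eq_lintegral_ofReal]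
    · refine lintegral_congr fun ω => ?_
      rw [measureReal_def, ENNReal.ofReal_toReal (measure_ne_top _ _)]
    · refine .of_bound h2.ennreal_toReal.aestronglyMeasurable 1 (.of_forall fun ω => ?_)
      rw [Real.norm_of_nonneg measureReal_nonneg]
      exact measureReal_le_one
    · exact .of_forall fun ω => measureReal_nonneg
  change P (A ∩ play.episode n ⁻¹' B) = ∫⁻ ω in A, G.episodeLaw (play.profile n ω) B ∂P
  rw [h3, h1, measureReal_def, ENNReal.ofReal_toReal (measure_ne_top _ _)]

/-- An exponential supermartingale bound. -/
theorem lintegral_exp_sum_le (play : G.Play P N) (ζ : ℕ → Ω → G.Episode → ℝ)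
    (hζ : ∀ n < N, G.JointMeasurable (play.ℱ n) (ζ n))
    (h : ∀ n < N, ∀ ω,
      ∫⁻ e, ENNReal.ofReal (Real.exp (ζ n ω e)) ∂G.episodeLaw (play.profile n ω) ≤ 1) :
    ∀ n ≤ N, Measurable[play.ℱ n] (fun ω => ∑ k ∈ Finset.range n, ζ k ω (play.episode k ω)) ∧
      ∫⁻ ω, ENNReal.ofReal (Real.exp (∑ k ∈ Finset.range n, ζ k ω (play.episode k ω))) ∂P ≤ 1 := by
  intro n
  induction n with
  | zero => intro _; simp
  | succ n ih =>
    intro hn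
    obtain ⟨hm, hi⟩ := ih (by omega)
    have hn' : n < N := by omega
    have hle : play.ℱ n ≤ play.ℱ (n + 1) := play.ℱ.mono (Nat.le_succ n)
    constructor
    · simp only [Finset.sum_range_succ]
      refine (hm.mono hle le_rfl).add ?_
      have hpair : @Measurable Ω (Ω × G.Episode) (play.ℱ (n + 1))
          ((play.ℱ n).prod inferInstance) fun ω => (ω, play.episode n ω) :=
        Measurable.prodMk (measurable_id'' hle) (play.episode_measurable n hn')
      exact (hζ n hn').comp hpair
    · have hF : Measurable[(play.ℱ n).prod inferInstance] fun p : Ω × G.Episode =>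
          ENNReal.ofReal (Real.exp (∑ k ∈ Finset.range n, ζ k p.1 (play.episode k p.1))) *
          ENNReal.ofReal (Real.exp (ζ n p.1 p.2)) := by
        refine Measurable.mul ?_ (hζ n hn').exp.ennreal_ofReal
        exact (@Measurable.comp _ _ _ ((play.ℱ n).prod inferInstance) (play.ℱ n) _ _ _
          hm.exp.ennreal_ofReal (@measurable_fst _ _ (play.ℱ n) _))
      have hL := lintegral_episode play hn' hF
      simp only at hL
      simp only [Finset.sum_range_succ, Real.exp_add]
      simp only [ENNReal.ofReal_mul (Real.exp_pos _).le]
      rw [hL]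
      -- Given the past, the earlier factor is a constant and the new one integrates to at most one.
      refine le_trans (lintegral_mono fun ω => ?_) hi
      rw [lintegral_const_mul']
      · exact mul_le_of_le_one_right zero_le (h n hn' ω)
      · exact ENNReal.ofReal_ne_top

/-- Markov's inequality for the supermartingale. The index set `I` selects the relevant episodes, as
in CFR those played for one player and layer; the others get increment zero. -/
theorem measure_le_sum_le (play : G.Play P N) (I : Finset ℕ) (hI : ∀ n ∈ I, n < N)
    (ζ : ℕ → Ω → G.Episode → ℝ) (hζ : ∀ n ∈ I, G.JointMeasurable (play.ℱ n) (ζ n))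
    (h : ∀ n ∈ I, ∀ ω,
      ∫⁻ e, ENNReal.ofReal (Real.exp (ζ n ω e)) ∂G.episodeLaw (play.profile n ω) ≤ 1) (ι : ℝ) :
    P {ω | ι < ∑ n ∈ I, ζ n ω (play.episode n ω)} ≤ ENNReal.ofReal (Real.exp (-ι)) := by
  classical
  obtain ⟨hm, hi⟩ := lintegral_exp_sum_le play (fun n => if n ∈ I then ζ n else 0)
    (fun n hn => by
      split_ifs with h'
      · exact hζ n h'
      · exact JointMeasurable.of_left measurable_const)
    (fun n hn ω => by
      split_ifs with h'
      · exact h n h' ω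
      · simp) N le_rfl
  have hsum : ∀ ω, ∑ n ∈ Finset.range N, (if n ∈ I then ζ n else 0) ω (play.episode n ω) =
      ∑ n ∈ I, ζ n ω (play.episode n ω) := by
    intro ω
    rw [← Finset.sum_subset (fun n hn => Finset.mem_range.2 (hI n hn) : I ⊆ Finset.range N)]
    · exact Finset.sum_congr rfl fun n hn => by rw [if_pos hn]
    · intro n _ hn
      simp [hn]
  simp only [hsum] at hm hi
  have hMk := mul_meas_ge_le_lintegral₀ (μ := P)
    ((hm.mono (play.ℱ.le N) le_rfl).exp.ennreal_ofReal.aemeasurable) (ENNReal.ofReal (Real.exp ι))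
  rw [Real.exp_neg, ENNReal.ofReal_inv_of_pos (Real.exp_pos ι)]
  rw [ENNReal.le_inv_iff_mul_le, mul_comm]
  refine le_trans ?_ (hMk.trans hi)
  gcongr
  intro hω
  exact ENNReal.ofReal_le_ofReal (Real.exp_le_exp.2 (le_of_lt hω))

/-- Concentration of a sum of nonnegative bounded terms around the sum of the conditional
expectations, from above (`s = 1`) and from below (`s = -1`). -/
theorem measure_deviation_le (play : G.Play P N) (I : Finset ℕ) (hI : ∀ n ∈ I, n < N)
    {K : Type*} [Fintype K] (c : ℕ → Ω → K → ℝ) (φ : K → G.Episode → ℝ)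
    (hc : ∀ n ∈ I, ∀ k, Measurable[play.ℱ n] fun ω => c n ω k) (hφ : ∀ k, Measurable (φ k))
    {B : ℝ} (hB : ∀ k e, |φ k e| ≤ B) {R κ s : ℝ} (hR : 0 < R) (hκ : 0 < κ) (hκ1 : κ ≤ 1)
    (hs : |s| = 1)
    (h0 : ∀ n ∈ I, ∀ ω e, 0 ≤ ∑ k, c n ω k * φ k e)
    (hle : ∀ n ∈ I, ∀ ω e, ∑ k, c n ω k * φ k e ≤ R) (ι : ℝ) :
    P {ω | κ * (∑ n ∈ I, ∑ k, c n ω k * ∫ e, φ k e ∂G.episodeLaw (play.profile n ω)) + R * ι / κ <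
      s * ((∑ n ∈ I, ∑ k, c n ω k * φ k (play.episode n ω)) -
        ∑ n ∈ I, ∑ k, c n ω k * ∫ e, φ k e ∂G.episodeLaw (play.profile n ω))} ≤
      ENNReal.ofReal (Real.exp (-ι)) := by
  let z : ℕ → Ω → G.Episode → ℝ := fun n ω e => ∑ k, c n ω k * φ k e
  let E : ℕ → Ω → ℝ := fun n ω => ∑ k, c n ω k * ∫ e, φ k e ∂G.episodeLaw (play.profile n ω)
  have hint : ∀ n ω k, Integrable (φ k) (G.episodeLaw (play.profile n ω)) := fun n ω k =>
    .of_bound (hφ k).aestronglyMeasurable B (.of_forall (hB k))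
  have hzi : ∀ n ω, Integrable (z n ω) (G.episodeLaw (play.profile n ω)) := fun n ω =>
    integrable_finsetSum _ fun k _ => (hint n ω k).const_mul _
  have hzE : ∀ n ω, ∫ e, z n ω e ∂G.episodeLaw (play.profile n ω) = E n ω := fun n ω => by
    simp only [z, E]
    rw [integral_finsetSum _ fun k _ => (hint n ω k).const_mul _]
    simp_rw [integral_const_mul]
  -- The increments are scaled by `κ / R`, so that the exponent `u` has size at most `κ ≤ 1` and
  -- `exp u ≤ 1 + u + u²`. Since `u² ≤ κ |u|` and `z` is nonnegative, the quadratic term costs only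
  -- `κ² / R` times the conditional mean.
  have hk := measure_le_sum_le play I hI
    (fun n ω e => s * (κ / R) * z n ω e - (s * (κ / R) + κ / R * κ) * E n ω) ?_ ?_ ι
  · refine le_trans (measure_mono fun ω hω => ?_) hk
    simp only [Set.mem_ofPred_eq] at hω ⊢
    rw [Finset.sum_sub_distrib, ← Finset.mul_sum, ← Finset.mul_sum]
    change κ * (∑ n ∈ I, E n ω) + R * ι / κ <
      s * ((∑ n ∈ I, z n ω (play.episode n ω)) - ∑ n ∈ I, E n ω) at hω
    have := mul_lt_mul_of_pos_left hω (div_pos hκ hR)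
    have h' : κ / R * (R * ι / κ) = ι := by field_simp
    nlinarith
  · intro n hn
    have h1 : G.JointMeasurable (play.ℱ n) (z n) := Finset.measurable_sum _ fun k _ =>
      Measurable.mul (JointMeasurable.of_left (hc n hn k)) (JointMeasurable.of_right (hφ k))
    have h2 : Measurable[play.ℱ n] (E n) := Finset.measurable_sum _ fun k _ =>
      (hc n hn k).mul ((measurable_profile play (hI n hn)).integral (hφ k) (hB k))
    exact Measurable.sub (Measurable.const_mul h1 _)
      (JointMeasurable.of_left (h2.const_mul _))
  · intro n hn ω
    refine lintegral_exp_sub_le_one _ (g := fun e => (s * (κ / R) + κ / R * κ) * z n ω e)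
      ((hzi n ω).const_mul _) (fun e => ?_) (by rw [integral_const_mul, hzE])
    have hz0 : 0 ≤ z n ω e := h0 n hn ω e
    have hzR : z n ω e ≤ R := hle n hn ω e
    have hu : κ / R * z n ω e ≤ κ := by
      rw [div_mul_eq_mul_div, div_le_iff₀ hR]
      gcongr
    have hu0 : 0 ≤ κ / R * z n ω e := by positivity
    have hs2 : s * s = 1 := by rw [← abs_mul_abs_self, hs, one_mul]
    have hb : |s * (κ / R) * z n ω e| ≤ 1 := by
      rw [mul_assoc, abs_mul, hs, one_mul, abs_of_nonneg hu0]
      exact hu.trans hκ1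
    have h1 := (abs_le.1 (Real.abs_exp_sub_one_sub_id_le hb)).2
    have h2 : (s * (κ / R) * z n ω e) ^ 2 = (s * s) * ((κ / R * z n ω e) * (κ / R * z n ω e)) := by
      ring
    rw [h2, hs2, one_mul] at h1
    nlinarith [mul_le_mul_of_nonneg_left hu hu0]

end Concentration

end IIEFG

/-! ### Divergence and exponential weights on a finite simplex. -/

section Simplex

variable {A : Type*} [Fintype A]

/-- The product of `1 - z + z²/2` and `1 + z + z²/2` is `1 + z⁴/4`, and the second factor is at most
`exp z`. -/
theorem exp_neg_le_quadratic {z : ℝ} (hz : 0 ≤ z) : Real.exp (-z) ≤ 1 - z + z ^ 2 / 2 := by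
  have h := Real.quadratic_le_exp_of_nonneg hz
  have h0 : 0 ≤ 1 - z + z ^ 2 / 2 := by nlinarith [sq_nonneg (z - 1)]
  have h1 : 1 ≤ (1 - z + z ^ 2 / 2) * (1 + z + z ^ 2 / 2) := by nlinarith [sq_nonneg (z ^ 2)]
  rw [Real.exp_neg, inv_le_comm₀ (Real.exp_pos z) (by nlinarith), inv_le_iff_one_le_mul₀ (by nlinarith)]
  nlinarith [mul_le_mul_of_nonneg_left h h0]

/-- The Kullback-Leibler divergence of two distributions on a finite type. -/
noncomputable def finiteKL (μ p : A → ℝ) : ℝ := ∑ a, μ a * Real.log (μ a / p a)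

/-- Adding the terms `p a - μ a`, which sum to zero, makes every summand nonnegative; positivity and
the equality case become termwise. -/
theorem finiteKL_eq {μ p : A → ℝ} (hμ : μ ∈ stdSimplex ℝ A) (hp : p ∈ stdSimplex ℝ A)
    (hpos : ∀ a, 0 < p a) :
    finiteKL μ p = ∑ a, p a * InformationTheory.klFun (μ a / p a) := by
  have h : ∀ a, p a * InformationTheory.klFun (μ a / p a) =
      μ a * Real.log (μ a / p a) + (p a - μ a) := by
    intro a
    have := (hpos a).ne'
    rw [InformationTheory.klFun]
    field_simp
    ring
  simp_rw [h, Finset.sum_add_distrib, Finset.sum_sub_distrib, hμ.2, hp.2, finiteKL]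
  ring

theorem finiteKL_nonneg {μ p : A → ℝ} (hμ : μ ∈ stdSimplex ℝ A) (hp : p ∈ stdSimplex ℝ A)
    (hpos : ∀ a, 0 < p a) : 0 ≤ finiteKL μ p := by
  rw [finiteKL_eq hμ hp hpos]
  exact Finset.sum_nonneg fun a _ => mul_nonneg (hpos a).le
    (InformationTheory.klFun_nonneg (div_nonneg (hμ.1 a) (hpos a).le))

theorem eq_of_finiteKL_le_zero {μ p : A → ℝ} (hμ : μ ∈ stdSimplex ℝ A) (hp : p ∈ stdSimplex ℝ A)
    (hpos : ∀ a, 0 < p a) (h : finiteKL μ p ≤ 0) : μ = p := by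
  have h0 := le_antisymm h (finiteKL_nonneg hμ hp hpos)
  rw [finiteKL_eq hμ hp hpos, Finset.sum_eq_zero_iff_of_nonneg fun a _ => mul_nonneg (hpos a).le
    (InformationTheory.klFun_nonneg (div_nonneg (hμ.1 a) (hpos a).le))] at h0
  funext a
  have h1 := (mul_eq_zero.1 (h0 a (Finset.mem_univ a))).resolve_left (hpos a).ne'
  rw [InformationTheory.klFun_eq_zero_iff (div_nonneg (hμ.1 a) (hpos a).le)] at h1
  exact (div_eq_one_iff_eq (hpos a).ne').1 h1

theorem finiteKL_uniform_le [Nonempty A] {μ : A → ℝ} (hμ : μ ∈ stdSimplex ℝ A) :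
    finiteKL μ (fun _ => 1 / (Fintype.card A : ℝ)) ≤ Real.log (Fintype.card A) := by
  have hc : (0 : ℝ) < Fintype.card A := by exact_mod_cast Fintype.card_pos
  calc finiteKL μ (fun _ => 1 / (Fintype.card A : ℝ))
      ≤ ∑ a, μ a * Real.log (Fintype.card A) := by
        refine Finset.sum_le_sum fun a _ => ?_
        rcases (hμ.1 a).eq_or_lt with h | h
        · simp [← h]
        · refine mul_le_mul_of_nonneg_left (Real.log_le_log (by positivity) ?_) h.le
          rw [div_div_eq_mul_div, div_one]
          refine mul_le_of_le_one_left hc.le ?_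
          rw [← hμ.2]
          exact Finset.single_le_sum (fun b _ => hμ.1 b) (Finset.mem_univ a)
    _ = Real.log (Fintype.card A) := by rw [← Finset.sum_mul, hμ.2, one_mul]

/-- The normalization constant of the exponential weights update. -/
noncomputable def partitionFn (c : ℝ) (ν u : A → ℝ) : ℝ := ∑ a, ν a * Real.exp (-(u a / c))

/-- The exponential weights update. -/
noncomputable def expWeights (c : ℝ) (ν u : A → ℝ) (a : A) : ℝ :=
  ν a * Real.exp (-(u a / c)) / partitionFn c ν u

variable [Nonempty A] {c : ℝ} {ν u : A → ℝ}

theorem partitionFn_pos (hν : ∀ a, 0 < ν a) : 0 < partitionFn c ν u :=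
  Finset.sum_pos (fun a _ => mul_pos (hν a) (Real.exp_pos _)) Finset.univ_nonempty

theorem expWeights_pos (hν : ∀ a, 0 < ν a) (a : A) : 0 < expWeights c ν u a :=
  div_pos (mul_pos (hν a) (Real.exp_pos _)) (partitionFn_pos hν)

theorem expWeights_mem (hν : ∀ a, 0 < ν a) : expWeights c ν u ∈ stdSimplex ℝ A := by
  refine ⟨fun a => (expWeights_pos hν a).le, ?_⟩
  simp only [expWeights, ← Finset.sum_div]
  exact div_self (partitionFn_pos hν).ne'

/-- The three-point identity of the exponential weights update. -/
theorem expWeights_identity (hc : 0 < c) (hν : ∀ a, 0 < ν a) {μ : A → ℝ}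
    (hμ : μ ∈ stdSimplex ℝ A) :
    ∑ a, μ a * u a + c * finiteKL μ ν =
      -(c * Real.log (partitionFn c ν u)) + c * finiteKL μ (expWeights c ν u) := by
  have hZ := partitionFn_pos (c := c) (u := u) hν
  have h : ∀ a, μ a * Real.log (μ a / expWeights c ν u a) =
      μ a * Real.log (μ a / ν a) + μ a * (u a / c) + μ a * Real.log (partitionFn c ν u) := by
    intro a
    rcases (hμ.1 a).eq_or_lt with h0 | h0
    · simp [← h0]
    · rw [Real.log_div h0.ne' (expWeights_pos hν a).ne', Real.log_div h0.ne' (hν a).ne',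
        expWeights, Real.log_div (mul_pos (hν a) (Real.exp_pos _)).ne' hZ.ne',
        Real.log_mul (hν a).ne' (Real.exp_pos _).ne', Real.log_exp]
      ring
  have h2 : c * ∑ a, μ a * (u a / c) = ∑ a, μ a * u a := by
    rw [Finset.mul_sum]
    exact Finset.sum_congr rfl fun a _ => by field_simp
  simp only [finiteKL]
  simp_rw [h, Finset.sum_add_distrib, ← Finset.sum_mul, hμ.2]
  linear_combination -h2

/-- Local second-order bound, from `exp_neg_le_quadratic` and `log Z ≤ Z - 1`. It needs nonnegative
losses but no upper bound on them. -/
theorem le_neg_log_partitionFn (hc : 0 < c) (hν : ∀ a, 0 < ν a) (hν1 : ν ∈ stdSimplex ℝ A)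
    (hu : ∀ a, 0 ≤ u a) :
    ∑ a, ν a * u a - 1 / (2 * c) * ∑ a, ν a * u a ^ 2 ≤
      -(c * Real.log (partitionFn c ν u)) := by
  have h1 : partitionFn c ν u ≤ 1 - (∑ a, ν a * u a) / c + (∑ a, ν a * u a ^ 2) / (2 * c ^ 2) := by
    calc partitionFn c ν u ≤ ∑ a, ν a * (1 - u a / c + (u a / c) ^ 2 / 2) :=
          Finset.sum_le_sum fun a _ => mul_le_mul_of_nonneg_left
            (exp_neg_le_quadratic (div_nonneg (hu a) hc.le)) (hν a).le
      _ = _ := by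
          simp_rw [mul_add, mul_sub, Finset.sum_add_distrib, Finset.sum_sub_distrib, mul_one,
            hν1.2, Finset.sum_div]
          congr 1
          · congr 1
            exact Finset.sum_congr rfl fun a _ => by field_simp
          · exact Finset.sum_congr rfl fun a _ => by field_simp
  have h2 := Real.log_le_sub_one_of_pos (partitionFn_pos (c := c) (u := u) hν)
  have h3 : c * Real.log (partitionFn c ν u) ≤
      c * (-(∑ a, ν a * u a) / c + (∑ a, ν a * u a ^ 2) / (2 * c ^ 2)) := by
    refine mul_le_mul_of_nonneg_left (h2.trans ?_) hc.le
    rw [neg_div]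
    linarith
  have h4 : c * (-(∑ a, ν a * u a) / c + (∑ a, ν a * u a ^ 2) / (2 * c ^ 2)) =
      -(∑ a, ν a * u a) + 1 / (2 * c) * ∑ a, ν a * u a ^ 2 := by
    field_simp
  linarith

theorem neg_log_partitionFn_le (hc : 0 < c) (hν : ∀ a, 0 < ν a) (hν1 : ν ∈ stdSimplex ℝ A) :
    -(c * Real.log (partitionFn c ν u)) ≤ ∑ a, ν a * u a := by
  have h := convexOn_exp.map_sum_le (t := Finset.univ) (w := ν) (p := fun a => -(u a / c))
    (fun a _ => (hν a).le) hν1.2 (fun _ _ => Set.mem_univ _)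
  simp only [smul_eq_mul] at h
  have h2 := (Real.le_log_iff_exp_le (partitionFn_pos (c := c) (u := u) hν)).2 h
  have h3 := mul_le_mul_of_nonneg_left h2 hc.le
  have h4 : c * ∑ a, ν a * -(u a / c) = -∑ a, ν a * u a := by
    rw [Finset.mul_sum, ← Finset.sum_neg_distrib]
    exact Finset.sum_congr rfl fun a _ => by field_simp
  linarith

end Simplex

/-- A telescoping sum of which the last term is bounded. -/
theorem sum_telescope_le {T : ℕ} (hT : 0 < T) (a b : ℕ → ℝ)
    (h : ∀ t, t + 1 < T → a (t + 1) = b t) (hb : 0 ≤ b (T - 1)) :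
    ∑ t ∈ Finset.range T, (a t - b t) ≤ a 0 := by
  have key : ∀ n, n + 1 ≤ T → ∑ t ∈ Finset.range (n + 1), (a t - b t) = a 0 - b n := by
    intro n
    induction n with
    | zero => intro _; simp
    | succ n ih =>
      intro hn
      rw [Finset.sum_range_succ, ih (by omega), h n (by omega)]
      ring
  obtain ⟨n, rfl⟩ : ∃ n, T = n + 1 := ⟨T - 1, by omega⟩
  rw [key n le_rfl]
  simpa using hb

namespace IIEFG

/-! ### One step of mirror descent with the balanced dilated divergence. -/

section MirrorDescent

variable {m H : ℕ} (G : IIEFG.{u} m H) {i : Fin m}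

/-- The balanced weight is the same for all actions, so the dilated divergence is a weighted sum of
local ones, with weights that `sum_reach_div` controls. -/
theorem balancedKL_eq (μ ν : G.Policy i) :
    G.balancedKL i μ ν = ∑ x, G.reach μ x / G.balancedWeight x * finiteKL (μ x).1 (ν x).1 := by
  refine Finset.sum_congr rfl fun x _ => ?_
  rw [finiteKL, Finset.mul_sum]
  refine Finset.sum_congr rfl fun a _ => ?_
  rw [balancedSeq_eq, seqForm_eq]
  ring

theorem balancedKL_nonneg (μ : G.Policy i) {ν : G.Policy i} (hν : ∀ x a, 0 < (ν x).1 a) :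
    0 ≤ G.balancedKL i μ ν := by
  rw [balancedKL_eq]
  exact Finset.sum_nonneg fun x _ => mul_nonneg
    (div_nonneg (G.reach_nonneg μ x) (G.balancedWeight_pos x).le)
    (finiteKL_nonneg (μ x).2 (ν x).2 (hν x))

theorem balancedKL_uniform_le (μ : G.Policy i) :
    G.balancedKL i μ (G.uniformPolicy i) ≤ G.size i * Real.log (Fintype.card (G.A i)) := by
  rw [balancedKL_eq, ← G.sum_reach_div μ, Finset.sum_mul]
  exact Finset.sum_le_sum fun x _ => mul_le_mul_of_nonneg_left (finiteKL_uniform_le (μ x).2)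
    (div_nonneg (G.reach_nonneg μ x) (G.balancedWeight_pos x).le)

/-- A step of mirror descent from a positive policy: the new policy is positive, and the regret
of the step is bounded by the progress in divergence and a second-order term. -/
theorem omd_step {η : ℝ} (hη : 0 < η) {ℓ : G.X i → G.A i → ℝ} (hℓ : ∀ x a, 0 ≤ ℓ x a)
    {ν : G.Policy i} (hν : ∀ x a, 0 < (ν x).1 a) :
    ∃ p : G.Policy i, (∀ x a, 0 < (p x).1 a) ∧
      (∀ ν', IsMinOn (G.omdObjective i η ℓ ν) Set.univ ν' → ν' = p) ∧
      ∀ μ : G.Policy i, (∑ x, ∑ a, G.seqForm i ν x a * ℓ x a) -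
        ∑ x, ∑ a, G.seqForm i μ x a * ℓ x a ≤
        1 / η * G.balancedKL i μ ν - 1 / η * G.balancedKL i μ p +
          η / 2 * ∑ x, ∑ a, G.seqForm i ν x a * G.balancedWeight x * G.actionValue ν ℓ x a ^ 2 := by
  -- The coefficient of the local divergence at `x` in the objective, per unit of reach.
  let c : G.X i → ℝ := fun x => 1 / (η * G.balancedWeight x)
  have hc : ∀ x, 0 < c x := fun x => one_div_pos.2 (mul_pos hη (G.balancedWeight_pos x))
  -- `V x` is the optimal value of the objective from `x` on: a soft minimum of the losses augmented
  -- by the optimal values of the children.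
  obtain ⟨V, hV⟩ := G.exists_backward fun x U =>
    -(c x * Real.log (partitionFn (c x) (ν x).1 fun a => ℓ x a + U a))
  let U : G.X i → G.A i → ℝ := fun x a => ℓ x a + ∑ x' ∈ G.children x a, V x'
  change ∀ x, V x = -(c x * Real.log (partitionFn (c x) (ν x).1 (U x))) at hV
  let p : G.Policy i := fun x => ⟨expWeights (c x) (ν x).1 (U x), expWeights_mem (hν x)⟩
  have hp : ∀ x a, 0 < (p x).1 a := fun x a => expWeights_pos (hν x) a
  have hKL : ∀ μ ν : G.Policy i, 1 / η * G.balancedKL i μ ν =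
      ∑ x, G.reach μ x * (c x * finiteKL (μ x).1 (ν x).1) := by
    intro μ ν
    rw [balancedKL_eq, Finset.mul_sum]
    refine Finset.sum_congr rfl fun x _ => ?_
    simp only [c]
    have := (G.balancedWeight_pos x).ne'
    field_simp
  -- The local three-point identities telescope along `μ`. The objective is a constant plus the
  -- divergence from `p`, which yields both the uniqueness of the minimizer and the progress term of
  -- the regret.
  have hobj : ∀ μ : G.Policy i, G.omdObjective i η ℓ ν μ =
      (∑ x with (G.infoStep i x : ℕ) = 0, V x) + 1 / η * G.balancedKL i μ p := by
    intro μ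
    rw [omdObjective, hKL, hKL, ← G.telescope μ, ← Finset.sum_add_distrib,
      ← Finset.sum_add_distrib]
    refine Finset.sum_congr rfl fun x _ => ?_
    have h := expWeights_identity (u := U x) (hc x) (hν x) (μ x).2
    rw [← hV] at h
    simp only [seqForm_eq, mul_assoc, ← Finset.mul_sum]
    rw [← mul_add, ← mul_add]
    congr 1
    simp only [U, mul_add, Finset.sum_add_distrib] at h
    simp only [p]
    linarith
  have hKLp : 1 / η * G.balancedKL i p p = 0 := by
    rw [hKL]
    refine Finset.sum_eq_zero fun x _ => ?_
    have : finiteKL (p x).1 (p x).1 = 0 := Finset.sum_eq_zero fun a _ => by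
      rw [div_self (hp x a).ne', Real.log_one, mul_zero]
    rw [this]
    ring
  -- Bounding the soft minimum by the mean under `ν` (Jensen) replaces the augmented losses by
  -- action values of `ν` in the second-order term.
  have hV0 : ∀ x, 0 ≤ V x ∧ V x ≤ G.stateValue ν ℓ x := by
    intro x
    induction x using G.infoset_backward_induction with
    | step x ih =>
      have hU0 : ∀ a, 0 ≤ U x a := fun a =>
        add_nonneg (hℓ x a) (Finset.sum_nonneg fun x' hx' => (ih a x' hx').1)
      constructor
      · rw [hV, neg_nonneg]
        refine mul_nonpos_of_nonneg_of_nonpos (hc x).le (Real.log_nonpos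
          (partitionFn_pos (hν x)).le ?_)
        rw [← (ν x).2.2]
        refine Finset.sum_le_sum fun a _ => mul_le_of_le_one_right (hν x a).le ?_
        rw [Real.exp_le_one_iff, neg_nonpos]
        exact div_nonneg (hU0 a) (hc x).le
      · rw [hV, stateValue_eq]
        refine (neg_log_partitionFn_le (hc x) (hν x) (ν x).2).trans ?_
        exact Finset.sum_le_sum fun a _ => mul_le_mul_of_nonneg_left
          (add_le_add le_rfl (Finset.sum_le_sum fun x' hx' => (ih a x' hx').2)) (hν x a).le
  have hU0 : ∀ x a, 0 ≤ U x a := fun x a =>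
    add_nonneg (hℓ x a) (Finset.sum_nonneg fun x' _ => (hV0 x').1)
  have hUle : ∀ x a, U x a ≤ G.actionValue ν ℓ x a := fun x a =>
    add_le_add le_rfl (Finset.sum_le_sum fun x' _ => (hV0 x').2)
  refine ⟨p, hp, fun ν' hmin => ?_, fun μ => ?_⟩
  · have h1 : G.omdObjective i η ℓ ν ν' ≤ G.omdObjective i η ℓ ν p := hmin (Set.mem_univ p)
    rw [hobj, hobj, hKLp, add_zero] at h1
    have h2 : ∑ x, G.reach ν' x * (c x * finiteKL (ν' x).1 (p x).1) ≤ 0 := by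
      rw [← hKL]; linarith
    have hnn : ∀ x, 0 ≤ G.reach ν' x * (c x * finiteKL (ν' x).1 (p x).1) := fun x =>
      mul_nonneg (G.reach_nonneg _ _) (mul_nonneg (hc x).le
        (finiteKL_nonneg (ν' x).2 (p x).2 (hp x)))
    -- A vanishing divergence only identifies the policies where `ν'` reaches; positivity of `p`
    -- then propagates reachability down the tree, starting at the first layer.
    have h3 : ∀ x, 0 < G.reach ν' x → ν' x = p x := by
      intro x hx
      have h4 := (Finset.single_le_sum (fun x _ => hnn x) (Finset.mem_univ x)).trans h2
      refine Subtype.ext (eq_of_finiteKL_le_zero (ν' x).2 (p x).2 (hp x) ?_)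
      have h5 := nonpos_of_mul_nonpos_right h4 hx
      exact nonpos_of_mul_nonpos_right h5 (hc x)
    have h4 : ∀ x, 0 < G.reach ν' x := by
      intro x
      induction x using G.infoset_induction with
      | root x hx => rw [G.reach_root _ hx]; exact one_pos
      | child x a x' h ih =>
        rw [G.reach_child _ h, seqForm_eq, h3 x ih]
        exact mul_pos ih (hp x a)
    exact funext fun x => h3 x (h4 x)
  · have h1 := hobj μ
    rw [omdObjective] at h1
    have h2 : (∑ x, ∑ a, G.seqForm i ν x a * ℓ x a) -
        η / 2 * ∑ x, ∑ a, G.seqForm i ν x a * G.balancedWeight x * G.actionValue ν ℓ x a ^ 2 ≤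
        ∑ x with (G.infoStep i x : ℕ) = 0, V x := by
      rw [← G.telescope ν, Finset.mul_sum, ← Finset.sum_sub_distrib]
      refine Finset.sum_le_sum fun x _ => ?_
      have h3 := le_neg_log_partitionFn (hc x) (hν x) (ν x).2 (hU0 x)
      rw [← hV] at h3
      have h4 : ∑ a, (ν x).1 a * U x a ^ 2 ≤ ∑ a, (ν x).1 a * G.actionValue ν ℓ x a ^ 2 :=
        Finset.sum_le_sum fun a _ => mul_le_mul_of_nonneg_left
          (pow_le_pow_left₀ (hU0 x a) (hUle x a) 2) (hν x a).le
      have h5 : 1 / (2 * c x) = η / 2 * G.balancedWeight x := by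
        simp only [c]
        have := (G.balancedWeight_pos x).ne'
        field_simp
      rw [h5] at h3
      have h6 := mul_le_mul_of_nonneg_left h4
        (mul_nonneg (half_pos hη).le (G.balancedWeight_pos x).le)
      have h7 : ∑ a, G.seqForm i ν x a * G.balancedWeight x * G.actionValue ν ℓ x a ^ 2 =
          G.reach ν x * (G.balancedWeight x * ∑ a, (ν x).1 a * G.actionValue ν ℓ x a ^ 2) := by
        simp only [Finset.mul_sum, seqForm_eq]
        exact Finset.sum_congr rfl fun a _ => by ring
      rw [h7]
      simp only [seqForm_eq, mul_assoc, ← Finset.mul_sum]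
      rw [mul_left_comm (η / 2), ← mul_sub]
      refine mul_le_mul_of_nonneg_left ?_ (G.reach_nonneg ν x)
      simp only [U, mul_add, Finset.sum_add_distrib] at h3
      simp only [U] at h6
      linarith
    linarith

/-- The policy that explores the layers up to `h` and then follows `ν`. -/
noncomputable abbrev explore (h : Fin H) (ν : G.Policy i) : G.Policy i :=
  G.spliceAfter i h (G.balancedPolicy i h) ν

theorem explore_of_lt {h : Fin H} (ν : G.Policy i) {x : G.X i} (hx : h < G.infoStep i x) :
    G.explore h ν x = ν x := if_neg hx.not_ge

theorem explore_of_le {h : Fin H} (ν : G.Policy i) {x : G.X i} (hx : G.infoStep i x ≤ h) :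
    G.explore h ν x = G.balancedPolicy i h x := if_pos hx

theorem seqForm_explore {h : Fin H} (ν : G.Policy i) {x : G.X i} (hx : G.infoStep i x = h)
    (a : G.A i) : G.seqForm i (G.explore h ν) x a = G.balancedWeight x := by
  subst hx
  rw [← G.balancedSeq_eq x a, balancedSeq]
  exact G.seqForm_congr fun y hy => G.explore_of_le ν hy

/-- The second-order term is linear in the losses, up to a factor. -/
theorem sum_sq_actionValue_le (ν : G.Policy i) {ℓ : G.X i → G.A i → ℝ} (hℓ : ∀ x a, 0 ≤ ℓ x a)
    {B : ℝ} (hB : ∑ x, ∑ a, G.seqForm i ν x a * ℓ x a ≤ B) :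
    ∑ x, ∑ a, G.seqForm i ν x a * G.balancedWeight x * G.actionValue ν ℓ x a ^ 2 ≤
      B * ∑ h : Fin H, ∑ x with h ≤ G.infoStep i x, ∑ a,
        G.seqForm i (G.explore h ν) x a * ℓ x a := by
  classical
  have hnn : ∀ x, 0 ≤ ∑ a, G.seqForm i ν x a * ℓ x a := fun x =>
    Finset.sum_nonneg fun a _ => mul_nonneg (G.seqForm_nonneg ν x a) (hℓ x a)
  -- One factor of the square, weighted with the sequence form, is part of the total loss of `ν`.
  -- The other, weighted with the balanced weight, becomes in `h2` a loss of an exploring policy.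
  have h1 : ∀ x a, G.seqForm i ν x a * G.actionValue ν ℓ x a ≤ B := by
    intro x a
    rw [G.seqForm_mul_actionValue ν ν x a fun _ _ => rfl]
    refine le_trans ?_ hB
    have hx : x ∉ Finset.univ.filter fun y => G.Desc i x a y := fun hx =>
      absurd (G.infoStep_of_desc (Finset.mem_filter.1 hx).2) (lt_irrefl _)
    calc _ ≤ (∑ b, G.seqForm i ν x b * ℓ x b) +
          ∑ y with G.Desc i x a y, ∑ b, G.seqForm i ν y b * ℓ y b := by
          gcongr
          exact Finset.single_le_sum (f := fun b => G.seqForm i ν x b * ℓ x b)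
            (fun b _ => mul_nonneg (G.seqForm_nonneg ν x b) (hℓ x b)) (Finset.mem_univ a)
      _ = ∑ y ∈ insert x (Finset.univ.filter fun y => G.Desc i x a y),
          ∑ b, G.seqForm i ν y b * ℓ y b := by rw [Finset.sum_insert hx]
      _ ≤ _ := Finset.sum_le_sum_of_subset_of_nonneg (Finset.subset_univ _) fun y _ _ => hnn y
  have h2 : ∀ h : Fin H, ∑ x with h ≤ G.infoStep i x, ∑ a,
      G.seqForm i (G.explore h ν) x a * ℓ x a =
      ∑ x with G.infoStep i x = h, ∑ a, G.balancedWeight x * G.actionValue ν ℓ x a := by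
    intro h
    rw [← G.sum_layer_actionValue ν (G.explore h ν) h fun x hx => G.explore_of_lt ν hx]
    refine Finset.sum_congr rfl fun x hx => Finset.sum_congr rfl fun a _ => ?_
    rw [G.seqForm_explore ν (Finset.mem_filter.1 hx).2]
  simp_rw [h2]
  rw [← sum_layers, Finset.mul_sum]
  refine Finset.sum_le_sum fun x _ => ?_
  rw [Finset.mul_sum]
  refine Finset.sum_le_sum fun a _ => ?_
  have h3 := mul_le_mul_of_nonneg_right (h1 x a)
    (mul_nonneg (G.balancedWeight_pos x).le (G.actionValue_nonneg ν hℓ x a))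
  nlinarith

end MirrorDescent

end IIEFG

namespace IIEFG

/-! ### Balanced OMD: estimated regret and concentration of the estimates. -/

section OMD

variable {m H : ℕ} {G : IIEFG.{u} m H} {i : Fin m}

theorem omdLoss_eq (γ : ℝ) (μ : G.Policy i) (e : G.Episode) (x : G.X i) (a : G.A i) :
    G.omdLoss i γ μ e x a =
      G.visitLoss e x a / (G.seqForm i μ x a + γ * G.balancedWeight x) := by
  rw [omdLoss, balancedSeq_eq, visitLoss]

theorem seqForm_pos {μ : G.Policy i} (hμ : ∀ x a, 0 < (μ x).1 a) (x : G.X i) (a : G.A i) :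
    0 < G.seqForm i μ x a := mul_pos (G.reach_pos hμ x) (hμ x a)

/-- In each layer the balanced weights are the sequence form of an exploring policy, so the layer
contributes at most one. This controls the bias of implicit exploration. -/
theorem sum_balancedWeight_counterfactualLoss_le (σ : G.Profile) :
    ∑ x : G.X i, ∑ a, G.balancedWeight x * G.counterfactualLoss σ x a ≤ H := by
  rw [sum_layers]
  calc _ ≤ ∑ h : Fin H, (1 : ℝ) := Finset.sum_le_sum fun h _ => by
        refine le_trans (le_of_eq ?_)
          (G.sum_layer_seqForm_counterfactualLoss_le σ (G.explore h (σ i)) h)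
        refine Finset.sum_congr rfl fun x hx => Finset.sum_congr rfl fun a _ => ?_
        rw [G.seqForm_explore (σ i) (Finset.mem_filter.1 hx).2]
    _ = H := by simp

/-- The implicit-exploration estimator is optimistic in the exponential sense. -/
theorem exp_omdLoss_le {p w y : ℝ} (hp : 0 < p) (hw : 0 < w) (hy : 0 ≤ y) (hy1 : y ≤ 1) :
    Real.exp (w * (y / (p + w))) ≤ 1 + w / p * y := by
  -- As `y ≤ 1`, the denominator may be lowered to `p + w * y`; then `1 - z ≤ exp (-z)` is inverted.
  have h1 : w * (y / (p + w)) ≤ 1 - (1 + w / p * y)⁻¹ := by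
    have h2 : 1 - (1 + w / p * y)⁻¹ = w * y / (p + w * y) := by
      field_simp
      ring
    rw [h2, ← mul_div_assoc]
    have : w * y ≤ w := mul_le_of_le_one_right hw.le hy1
    gcongr
  have h2 : (1 + w / p * y)⁻¹ ≤ Real.exp (-(w * (y / (p + w)))) := by
    linarith [Real.add_one_le_exp (-(w * (y / (p + w))))]
  rw [Real.exp_neg] at h2
  exact (inv_le_inv₀ (by positivity) (Real.exp_pos _)).1 h2

variable {Ω : Type v} [MeasurableSpace Ω] {P : Measure Ω} {T : ℕ}

/-- The update only prescribes some minimizer. Starting from a positive policy it is unique and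
given by exponential weights, so positivity persists. -/
theorem IsBalancedOMD.pos {η γ : Fin m → ℝ} {play : G.Play P T}
    (hG : G.IsBalancedOMD T η γ play) (hη : 0 < η i) (hγ : 0 < γ i) (ω : Ω) {t : ℕ} (ht : t < T)
    (x : G.X i) (a : G.A i) : 0 < (play.profile t ω i x).1 a := by
  induction t generalizing x a with
  | zero => rw [hG.init]; exact G.uniformPolicy_pos x a
  | succ t ih =>
    obtain ⟨p, hp, hmin, -⟩ := G.omd_step hη
      (ℓ := G.omdLoss i (γ i) (play.profile t ω i) (play.episode t ω)) (fun x a => by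
        rw [omdLoss_eq]
        exact div_nonneg (G.visitLoss_nonneg _ _ _) (add_nonneg (G.seqForm_nonneg _ _ _)
          (mul_nonneg hγ.le (G.balancedWeight_pos x).le))) (ih (by omega))
    rw [hmin _ (hG.update t ht ω i)]
    exact hp x a

/-- The regret of mirror descent with respect to the estimated losses. -/
theorem IsBalancedOMD.estimated_regret_le {η γ : Fin m → ℝ} {play : G.Play P T}
    (hG : G.IsBalancedOMD T η γ play) (hT : 0 < T) (hη : 0 < η i) (hγ : 0 < γ i) (ω : Ω)
    (π : G.Policy i) :
    ∑ t ∈ Finset.range T, ((∑ x, ∑ a, G.seqForm i (play.profile t ω i) x a *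
        G.omdLoss i (γ i) (play.profile t ω i) (play.episode t ω) x a) -
      ∑ x, ∑ a, G.seqForm i π x a *
        G.omdLoss i (γ i) (play.profile t ω i) (play.episode t ω) x a) ≤
      1 / η i * (G.size i * Real.log (Fintype.card (G.A i))) +
        η i / 2 * (H * ∑ t ∈ Finset.range T, ∑ h : Fin H, ∑ x with h ≤ G.infoStep i x, ∑ a,
          G.seqForm i (G.explore h (play.profile t ω i)) x a *
            G.omdLoss i (γ i) (play.profile t ω i) (play.episode t ω) x a) := by
  have hℓ : ∀ t x a, 0 ≤ G.omdLoss i (γ i) (play.profile t ω i) (play.episode t ω) x a := by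
    intro t x a
    rw [omdLoss_eq]
    exact div_nonneg (G.visitLoss_nonneg _ _ _) (add_nonneg (G.seqForm_nonneg _ _ _)
      (mul_nonneg hγ.le (G.balancedWeight_pos x).le))
  have hstep : ∀ t, ∃ p : G.Policy i, t < T → (∀ x a, 0 < (p x).1 a) ∧
      (t + 1 < T → play.profile (t + 1) ω i = p) ∧
      (∑ x, ∑ a, G.seqForm i (play.profile t ω i) x a *
        G.omdLoss i (γ i) (play.profile t ω i) (play.episode t ω) x a) -
        ∑ x, ∑ a, G.seqForm i π x a *
          G.omdLoss i (γ i) (play.profile t ω i) (play.episode t ω) x a ≤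
        1 / η i * G.balancedKL i π (play.profile t ω i) - 1 / η i * G.balancedKL i π p +
          η i / 2 * (H * ∑ h : Fin H, ∑ x with h ≤ G.infoStep i x, ∑ a,
          G.seqForm i (G.explore h (play.profile t ω i)) x a *
            G.omdLoss i (γ i) (play.profile t ω i) (play.episode t ω) x a) := by
    intro t
    by_cases ht : t < T
    · obtain ⟨p, hp, hmin, hreg⟩ := G.omd_step hη (hℓ t)
        (fun x a => hG.pos hη hγ ω ht x a)
      refine ⟨p, fun _ => ⟨hp, fun ht' => hmin _ (hG.update t ht' ω i), (hreg π).trans ?_⟩⟩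
      gcongr
      -- The estimated loss of the played policy is at most `H` on every episode: its weighted
      -- entries are at most visit indicators, with at most one visit per layer.
      refine G.sum_sq_actionValue_le (play.profile t ω i) (hℓ t) ?_
      refine le_trans (Finset.sum_le_sum fun x _ => Finset.sum_le_sum fun a _ => ?_)
        (G.sum_visit_le (i := i) (play.episode t ω))
      have h1 := seqForm_pos (fun x a => hG.pos hη hγ ω ht x a) x a
      have h2 := mul_pos hγ (G.balancedWeight_pos x)
      rw [omdLoss_eq, mul_div_assoc', div_le_iff₀ (by positivity), mul_comm]
      exact mul_le_mul (G.visitLoss_le_visit _ x a) (by linarith) h1.le (G.visit_nonneg _ x a)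
    · exact ⟨play.profile t ω i, fun h => absurd h ht⟩
  choose p hp using hstep
  have htel := sum_telescope_le hT (fun t => 1 / η i * G.balancedKL i π (play.profile t ω i))
    (fun t => 1 / η i * G.balancedKL i π (p t))
    (fun t ht => by rw [(hp t (by omega)).2.1 ht])
    (mul_nonneg (one_div_pos.2 hη).le (G.balancedKL_nonneg π (hp (T - 1) (by omega)).1))
  calc _ ≤ ∑ t ∈ Finset.range T, (1 / η i * G.balancedKL i π (play.profile t ω i) -
        1 / η i * G.balancedKL i π (p t) + η i / 2 * (H * ∑ h : Fin H,
          ∑ x with h ≤ G.infoStep i x, ∑ a,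
          G.seqForm i (G.explore h (play.profile t ω i)) x a *
            G.omdLoss i (γ i) (play.profile t ω i) (play.episode t ω) x a)) :=
        Finset.sum_le_sum fun t ht => (hp t (Finset.mem_range.1 ht)).2.2
    _ ≤ _ := by
        rw [Finset.sum_add_distrib, ← Finset.mul_sum, ← Finset.mul_sum]
        gcongr
        refine htel.trans ?_
        rw [hG.init]
        gcongr
        exact G.balancedKL_uniform_le π

variable [IsProbabilityMeasure P]

/-- The estimated losses of the played policies are not much below the true ones. -/
theorem IsBalancedOMD.measure_played_le {η γ : Fin m → ℝ} {play : G.Play P T}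
    (hG : G.IsBalancedOMD T η γ play) (hη : 0 < η i) (hγ : 0 < γ i) (hH : 0 < H)
    {κ : ℝ} (hκ : 0 < κ) (hκ1 : κ ≤ 1) (ι : ℝ) :
    P {ω | (∑ t ∈ Finset.range T, ∑ x, ∑ a, G.seqForm i (play.profile t ω i) x a *
          G.omdLoss i (γ i) (play.profile t ω i) (play.episode t ω) x a) +
        (γ i * H * T + κ * (H * T) + H * ι / κ) <
      ∑ t ∈ Finset.range T, ∑ x, ∑ a, G.seqForm i (play.profile t ω i) x a *
        G.counterfactualLoss (play.profile t ω) x a} ≤ ENNReal.ofReal (Real.exp (-ι)) := by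
  have hw : ∀ x : G.X i, 0 < γ i * G.balancedWeight x := fun x =>
    mul_pos hγ (G.balancedWeight_pos x)
  have hc0 : ∀ t ω x a, 0 ≤ G.seqForm i (play.profile t ω i) x a /
      (G.seqForm i (play.profile t ω i) x a + γ i * G.balancedWeight x) := fun t ω x a =>
    div_nonneg (G.seqForm_nonneg _ x a) (add_nonneg (G.seqForm_nonneg _ x a) (hw x).le)
  have hc1 : ∀ t ω x a, G.seqForm i (play.profile t ω i) x a /
      (G.seqForm i (play.profile t ω i) x a + γ i * G.balancedWeight x) ≤ 1 := fun t ω x a =>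
    div_le_one_of_le₀ (by linarith [hw x]) (add_nonneg (G.seqForm_nonneg _ x a) (hw x).le)
  have h := measure_deviation_le (s := -1) play (Finset.range T) (fun n hn => Finset.mem_range.1 hn)
    (K := G.X i × G.A i)
    (fun t ω k => G.seqForm i (play.profile t ω i) k.1 k.2 /
      (G.seqForm i (play.profile t ω i) k.1 k.2 + γ i * G.balancedWeight k.1))
    (fun k e => G.visitLoss e k.1 k.2)
    (fun n hn k => by
      have := (measurable_profile play (Finset.mem_range.1 hn)).seqForm i k.1 k.2
      exact this.div (this.add_const _))
    (fun k => G.measurable_visitLoss _ _) (fun k e => G.abs_visitLoss_le e _ _)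
    (R := H) (by exact_mod_cast hH) hκ hκ1 (by simp)
    (fun n _ ω e => Finset.sum_nonneg fun k _ => mul_nonneg (hc0 _ _ _ _) (G.visitLoss_nonneg _ _ _))
    (fun n _ ω e => by
      rw [Fintype.sum_prod_type]
      refine le_trans (Finset.sum_le_sum fun x _ => Finset.sum_le_sum fun a _ => ?_)
        (G.sum_visit_le (i := i) e)
      exact (mul_le_of_le_one_left (G.visitLoss_nonneg _ _ _) (hc1 _ _ _ _)).trans
        (G.visitLoss_le_visit _ _ _)) ι
  refine le_trans (measure_mono fun ω hω => ?_) h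
  simp only [Set.mem_ofPred_eq, Fintype.sum_prod_type, integral_visitLoss] at hω ⊢
  have hz : ∀ t, ∑ x, ∑ a, G.seqForm i (play.profile t ω i) x a /
      (G.seqForm i (play.profile t ω i) x a + γ i * G.balancedWeight x) *
        G.visitLoss (play.episode t ω) x a = ∑ x, ∑ a, G.seqForm i (play.profile t ω i) x a *
          G.omdLoss i (γ i) (play.profile t ω i) (play.episode t ω) x a := fun t => by
    simp only [omdLoss_eq, mul_div_assoc', div_mul_eq_mul_div]
  simp only [hz]
  have hE1 : ∑ t ∈ Finset.range T, ∑ x, ∑ a, G.seqForm i (play.profile t ω i) x a /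
      (G.seqForm i (play.profile t ω i) x a + γ i * G.balancedWeight x) *
        (G.seqForm i (play.profile t ω i) x a * G.counterfactualLoss (play.profile t ω) x a) ≤
      H * T := by
    calc _ ≤ ∑ t ∈ Finset.range T, (H : ℝ) := Finset.sum_le_sum fun t _ => by
          refine le_trans (Finset.sum_le_sum fun x _ => Finset.sum_le_sum fun a _ => ?_)
            (G.sum_seqForm_counterfactualLoss_le (play.profile t ω) (play.profile t ω i)
              Finset.univ)
          exact mul_le_of_le_one_left (mul_nonneg (G.seqForm_nonneg _ _ _)
            (G.counterfactualLoss_nonneg _ _ _)) (hc1 _ _ _ _)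
      _ = H * T := by simp [mul_comm]
  -- With `p` the sequence form and `g` equal to `γ` times the balanced weight, the bias factor is
  -- `p - p² / (p + g) ≤ g`.
  have hE2 : (∑ t ∈ Finset.range T, ∑ x, ∑ a, G.seqForm i (play.profile t ω i) x a *
        G.counterfactualLoss (play.profile t ω) x a) - γ i * H * T ≤
      ∑ t ∈ Finset.range T, ∑ x, ∑ a, G.seqForm i (play.profile t ω i) x a /
      (G.seqForm i (play.profile t ω i) x a + γ i * G.balancedWeight x) *
        (G.seqForm i (play.profile t ω i) x a * G.counterfactualLoss (play.profile t ω) x a) := by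
    have : γ i * H * T = ∑ t ∈ Finset.range T, γ i * H := by simp [mul_comm]
    rw [this, ← Finset.sum_sub_distrib]
    refine Finset.sum_le_sum fun t ht => ?_
    rw [sub_le_iff_le_add]
    refine le_trans ?_ (add_le_add le_rfl (mul_le_mul_of_nonneg_left
      (sum_balancedWeight_counterfactualLoss_le (i := i) (play.profile t ω)) hγ.le))
    simp only [Finset.mul_sum, ← Finset.sum_add_distrib]
    refine Finset.sum_le_sum fun x _ => Finset.sum_le_sum fun a _ => ?_
    have hp := seqForm_pos (fun x a => hG.pos hη hγ ω (Finset.mem_range.1 ht) x a) x a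
    have h1 := hc1 t ω x a
    have h2 : G.seqForm i (play.profile t ω i) x a =
      G.seqForm i (play.profile t ω i) x a / (G.seqForm i (play.profile t ω i) x a +
        γ i * G.balancedWeight x) * (G.seqForm i (play.profile t ω i) x a +
        γ i * G.balancedWeight x) := by
      have := (add_pos hp (hw x)).ne'
      field_simp
    have h3 : G.seqForm i (play.profile t ω i) x a ≤ G.seqForm i (play.profile t ω i) x a /
        (G.seqForm i (play.profile t ω i) x a + γ i * G.balancedWeight x) *
          G.seqForm i (play.profile t ω i) x a + γ i * G.balancedWeight x := by
      nlinarith [mul_le_mul_of_nonneg_right h1 (hw x).le]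
    nlinarith [mul_le_mul_of_nonneg_right h3 (G.counterfactualLoss_nonneg (play.profile t ω) x a)]
  have hE3 := mul_le_mul_of_nonneg_left hE1 hκ.le
  linarith

/-- The second-order term is under control. -/
theorem measure_secondOrder_le {γ : Fin m → ℝ} (play : G.Play P T) (hγ : 0 < γ i) (hH : 0 < H)
    (hsize : 0 < G.size i) (ι : ℝ) :
    P {ω | 2 * (H ^ 2 * T) + H ^ 2 * G.size i / γ i * ι <
      ∑ t ∈ Finset.range T, ∑ h : Fin H, ∑ x with h ≤ G.infoStep i x, ∑ a,
          G.seqForm i (G.explore h (play.profile t ω i)) x a *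
            G.omdLoss i (γ i) (play.profile t ω i) (play.episode t ω) x a} ≤
      ENNReal.ofReal (Real.exp (-ι)) := by
  classical
  have hw : ∀ x : G.X i, 0 < γ i * G.balancedWeight x := fun x =>
    mul_pos hγ (G.balancedWeight_pos x)
  let d : ℕ → Ω → G.X i → G.A i → ℝ := fun t ω x a => ∑ h : Fin H, if h ≤ G.infoStep i x then
    G.seqForm i (G.explore h (play.profile t ω i)) x a /
      (G.seqForm i (play.profile t ω i) x a + γ i * G.balancedWeight x) else 0
  have hnn : ∀ t ω (h : Fin H) x a, 0 ≤ G.seqForm i (G.explore h (play.profile t ω i)) x a /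
      (G.seqForm i (play.profile t ω i) x a + γ i * G.balancedWeight x) := fun t ω h x a =>
    div_nonneg (G.seqForm_nonneg _ x a) (add_nonneg (G.seqForm_nonneg _ x a) (hw x).le)
  have hd0 : ∀ t ω x a, 0 ≤ d t ω x a := fun t ω x a => Finset.sum_nonneg fun h _ => by
    split_ifs
    · exact hnn t ω h x a
    · exact le_rfl
  -- By balancing, no policy reaches `x` with more than `size i` times its balanced weight, and the
  -- denominator contains `γ` times that weight.
  have hd1 : ∀ t ω x a, d t ω x a ≤ H * (G.size i / γ i) := fun t ω x a => by
    calc d t ω x a ≤ ∑ h : Fin H, (G.size i / γ i : ℝ) := Finset.sum_le_sum fun h _ => by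
          split_ifs
          · have h1 := G.reach_div_le (G.explore h (play.profile t ω i)) x
            rw [div_le_iff₀ (G.balancedWeight_pos x)] at h1
            have h2 : G.seqForm i (G.explore h (play.profile t ω i)) x a ≤
                G.size i * G.balancedWeight x :=
              (mul_le_of_le_one_right (G.reach_nonneg _ _) (G.policy_le_one _ _ _)).trans h1
            rw [div_le_div_iff₀ (add_pos_of_nonneg_of_pos (G.seqForm_nonneg _ x a) (hw x)) hγ]
            have h3 : 0 ≤ (G.size i : ℝ) * G.seqForm i (play.profile t ω i) x a :=
              mul_nonneg (Nat.cast_nonneg _) (G.seqForm_nonneg _ x a)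
            nlinarith
          · positivity
      _ = H * (G.size i / γ i) := by simp
  have hsum : ∀ t ω (f : G.X i → G.A i → ℝ), ∑ x, ∑ a, d t ω x a * f x a =
      ∑ h : Fin H, ∑ x with h ≤ G.infoStep i x, ∑ a,
        G.seqForm i (G.explore h (play.profile t ω i)) x a /
          (G.seqForm i (play.profile t ω i) x a + γ i * G.balancedWeight x) * f x a := by
    intro t ω f
    simp only [d, Finset.sum_filter, Finset.sum_mul]
    refine (Finset.sum_congr rfl fun x _ => Finset.sum_comm).trans (Finset.sum_comm.trans ?_)
    refine Finset.sum_congr rfl fun h _ => Finset.sum_congr rfl fun x _ => ?_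
    split_ifs <;> simp
  have h := measure_deviation_le (s := 1) play (Finset.range T) (fun n hn => Finset.mem_range.1 hn)
    (K := G.X i × G.A i) (fun t ω k => d t ω k.1 k.2)
    (fun k e => G.visitLoss e k.1 k.2)
    (fun n hn k => by
      have hσ := measurable_profile play (Finset.mem_range.1 hn)
      refine Finset.measurable_sum _ fun h _ => ?_
      split_ifs
      · refine Measurable.div ?_ ((hσ.seqForm i k.1 k.2).add_const _)
        have hσ' : G.MeasurableProfile (play.ℱ n) fun ω =>
            Function.update (play.profile n ω) i (G.explore h (play.profile n ω i)) := by
          intro j x a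
          by_cases hj : j = i
          · subst hj
            simp only [Function.update_self, explore, POMG.spliceAfter]
            split_ifs
            · exact measurable_const
            · exact hσ j x a
          · simp only [Function.update_of_ne hj]
            exact hσ j x a
        have := hσ'.seqForm i k.1 k.2
        simpa only [Function.update_self] using this
      · exact measurable_const)
    (fun k => G.measurable_visitLoss _ _) (fun k e => G.abs_visitLoss_le e _ _)
    (R := H ^ 2 * G.size i / γ i) (by positivity) one_pos le_rfl (by simp)
    (fun n _ ω e => Finset.sum_nonneg fun k _ => mul_nonneg (hd0 _ _ _ _) (G.visitLoss_nonneg _ _ _))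
    (fun n _ ω e => by
      rw [Fintype.sum_prod_type]
      calc _ ≤ ∑ x, ∑ a, H * (G.size i / γ i) * G.visit i e x a :=
            Finset.sum_le_sum fun x _ => Finset.sum_le_sum fun a _ => mul_le_mul (hd1 _ _ _ _)
              (G.visitLoss_le_visit _ _ _) (G.visitLoss_nonneg _ _ _) (by positivity)
        _ = H * (G.size i / γ i) * ∑ x, ∑ a, G.visit i e x a := by
            simp only [Finset.mul_sum]
        _ ≤ H * (G.size i / γ i) * H := by gcongr; exact G.sum_visit_le e
        _ = _ := by ring) ι
  refine le_trans (measure_mono fun ω hω => ?_) h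
  simp only [Set.mem_ofPred_eq, Fintype.sum_prod_type, integral_visitLoss, hsum] at hω ⊢
  have hz : ∀ t, ∑ h : Fin H, ∑ x with h ≤ G.infoStep i x, ∑ a,
        G.seqForm i (G.explore h (play.profile t ω i)) x a /
          (G.seqForm i (play.profile t ω i) x a + γ i * G.balancedWeight x) *
          G.visitLoss (play.episode t ω) x a =
      ∑ h : Fin H, ∑ x with h ≤ G.infoStep i x, ∑ a,
          G.seqForm i (G.explore h (play.profile t ω i)) x a *
            G.omdLoss i (γ i) (play.profile t ω i) (play.episode t ω) x a := fun t => by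
    simp only [omdLoss_eq, mul_div_assoc', div_mul_eq_mul_div]
  simp only [hz]
  -- In conditional mean the estimator is at most the counterfactual loss, so each exploring policy
  -- contributes at most `H` per round.
  have hE : ∑ t ∈ Finset.range T, ∑ h : Fin H, ∑ x with h ≤ G.infoStep i x, ∑ a,
        G.seqForm i (G.explore h (play.profile t ω i)) x a /
          (G.seqForm i (play.profile t ω i) x a + γ i * G.balancedWeight x) *
          (G.seqForm i (play.profile t ω i) x a * G.counterfactualLoss (play.profile t ω) x a) ≤
        H ^ 2 * T := by
    calc _ ≤ ∑ t ∈ Finset.range T, ∑ h : Fin H, (H : ℝ) :=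
          Finset.sum_le_sum fun t _ => Finset.sum_le_sum fun h _ => by
          refine le_trans (Finset.sum_le_sum fun x _ => Finset.sum_le_sum fun a _ => ?_)
            (G.sum_seqForm_counterfactualLoss_le (play.profile t ω)
              (G.explore h (play.profile t ω i)) (Finset.univ.filter fun x => h ≤ G.infoStep i x))
          rw [← mul_assoc]
          refine mul_le_mul_of_nonneg_right ?_ (G.counterfactualLoss_nonneg _ _ _)
          rw [div_mul_eq_mul_div, mul_div_assoc]
          refine mul_le_of_le_one_right (G.seqForm_nonneg _ _ _) ?_
          exact div_le_one_of_le₀ (by linarith [hw x])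
            (add_nonneg (G.seqForm_nonneg _ x a) (hw x).le)
      _ = H ^ 2 * T := by simp; ring
  have h1 : H ^ 2 * (G.size i : ℝ) / γ i * ι = H ^ 2 * G.size i / γ i * ι / 1 := by ring
  linarith

/-- The estimated losses at a pair are not much above the true ones. -/
theorem IsBalancedOMD.measure_comparator_le {η γ : Fin m → ℝ} {play : G.Play P T}
    (hG : G.IsBalancedOMD T η γ play) (hη : 0 < η i) (hγ : 0 < γ i) (ι : ℝ)
    (x : G.X i) (a : G.A i) :
    P {ω | ι / (γ i * G.balancedWeight x) <
      ∑ t ∈ Finset.range T, (G.omdLoss i (γ i) (play.profile t ω i) (play.episode t ω) x a -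
        G.counterfactualLoss (play.profile t ω) x a)} ≤ ENNReal.ofReal (Real.exp (-ι)) := by
  have hw : 0 < γ i * G.balancedWeight x := mul_pos hγ (G.balancedWeight_pos x)
  have h := measure_le_sum_le play (Finset.range T) (fun n hn => Finset.mem_range.1 hn)
    -- With this scaling `exp_omdLoss_le` applies and its linear term has conditional mean exactly
    -- the compensator, so no variance term appears.
    (fun t ω e => γ i * G.balancedWeight x *
      (G.visitLoss e x a / (G.seqForm i (play.profile t ω i) x a + γ i * G.balancedWeight x)) -
      γ i * G.balancedWeight x * G.counterfactualLoss (play.profile t ω) x a)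
    (fun n hn => by
      have hσ := measurable_profile play (Finset.mem_range.1 hn)
      have h1 : G.JointMeasurable (play.ℱ n) fun ω _ =>
          G.seqForm i (play.profile n ω i) x a + γ i * G.balancedWeight x :=
        JointMeasurable.of_left ((hσ.seqForm i x a).add_const _)
      have h2 : G.JointMeasurable (play.ℱ n) fun ω _ =>
          γ i * G.balancedWeight x * G.counterfactualLoss (play.profile n ω) x a :=
        JointMeasurable.of_left ((hσ.counterfactualLoss i x a).const_mul _)
      exact Measurable.sub (Measurable.const_mul (Measurable.div
        (JointMeasurable.of_right (G.measurable_visitLoss x a)) h1) _) h2)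
    (fun n hn ω => by
      have hp := seqForm_pos (fun x a => hG.pos hη hγ ω (Finset.mem_range.1 hn) x a) x a
      refine lintegral_exp_sub_le_one _
        (g := fun e => γ i * G.balancedWeight x / G.seqForm i (play.profile n ω i) x a *
          G.visitLoss e x a) ((G.integrable_visitLoss _ x a).const_mul _)
        (fun e => exp_omdLoss_le hp hw (G.visitLoss_nonneg e x a) (G.visitLoss_le_one e x a)) ?_
      rw [integral_const_mul, integral_visitLoss]
      refine le_of_eq ?_
      field_simp) ι
  refine le_trans (measure_mono fun ω hω => ?_) h
  simp only [Set.mem_ofPred_eq, omdLoss_eq] at hω ⊢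
  rw [div_lt_iff₀' hw, Finset.mul_sum] at hω
  simpa only [mul_sub] using hω

end OMD

end IIEFG

/-! ### From regret to approximate equilibria. -/

/-- Several rounds may share a profile, so the sum over profiles is expanded into one over rounds.
-/
theorem tsum_map_uniformOfFintype {α : Type*} {T : ℕ} [NeZero T] (σ : ℕ → α) (g : α → ℝ) :
    ∑' s, (((PMF.uniformOfFintype (Fin T)).map fun t : Fin T => σ t) s).toReal * g s =
      (∑ t ∈ Finset.range T, g (σ t)) / T := by
  classical
  have h : ∀ s, (((PMF.uniformOfFintype (Fin T)).map fun t : Fin T => σ t) s).toReal * g s =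
      ∑ t : Fin T, if s = σ t then (T : ℝ)⁻¹ * g (σ t) else 0 := by
    intro s
    rw [PMF.map_apply, tsum_fintype, ENNReal.toReal_sum, Finset.sum_mul]
    · refine Finset.sum_congr rfl fun t _ => ?_
      split_ifs with h
      · simp [h]
      · simp
    · intro t _
      split_ifs
      · exact PMF.apply_ne_top _ _
      · exact ENNReal.zero_ne_top
  simp_rw [h]
  rw [Summable.tsum_finsetSum (f := fun (t : Fin T) s => if s = σ t then (T : ℝ)⁻¹ * g (σ t) else 0)
    fun t _ => (hasSum_ite_eq (σ t) _).summable]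
  simp_rw [tsum_ite_eq]
  rw [Fin.sum_univ_eq_sum_range fun t => (T : ℝ)⁻¹ * g (σ t), ← Finset.mul_sum, div_eq_inv_mul]

namespace IIEFG

variable {m H : ℕ} (G : IIEFG.{u} m H)

theorem nonempty_state : Nonempty G.S := by
  by_contra hS
  rw [not_nonempty_iff] at hS
  simpa using G.init_mem.2

theorem horizon_pos (G : IIEFG.{u} m H) : 0 < H := by
  obtain ⟨s⟩ := G.nonempty_state
  exact (Nat.zero_le _).trans_lt (G.step s).2

theorem size_pos (i : Fin m) : 0 < G.size i := by
  obtain ⟨s⟩ := G.nonempty_state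
  have : Nonempty (G.X i) := ⟨G.obs i s⟩
  exact Nat.mul_pos Fintype.card_pos Fintype.card_pos

theorem size_le_sumSize (i : Fin m) : G.size i ≤ G.sumSize :=
  Finset.single_le_sum (f := G.size) (fun _ _ => Nat.zero_le _) (Finset.mem_univ i)

theorem size_le_maxSize (i : Fin m) : G.size i ≤ G.maxSize :=
  Finset.le_sup (f := G.size) (Finset.mem_univ i)

theorem card_action_le_size (i : Fin m) : Fintype.card (G.A i) ≤ G.size i := by
  obtain ⟨s⟩ := G.nonempty_state
  have : Nonempty (G.X i) := ⟨G.obs i s⟩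
  exact Nat.le_mul_of_pos_left _ Fintype.card_pos

theorem isNFCCE_of_regret_le (hm : 0 < m) {T : ℕ} [NeZero T] {ε : ℝ} (σ : ℕ → G.Profile)
    (h : ∀ i (π : G.Policy i), ∑ t ∈ Finset.range T,
      (G.value i (Function.update (σ t) i π) - G.value i (σ t)) ≤ ε * T) :
    G.IsNFCCE ε (G.uniformMixture T σ) := by
  have : Nonempty (Fin m) := ⟨⟨0, hm⟩⟩
  have hT : (0 : ℝ) < T := by exact_mod_cast Nat.pos_of_ne_zero (NeZero.ne T)
  refine ciSup_le fun i => ?_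
  have : Nonempty (G.Policy i) := ⟨G.uniformPolicy i⟩
  refine ciSup_le fun π => ?_
  -- In `uniformMixture` the uniform index is first pushed forward to `ℕ`; the two maps are
  -- composed.
  have hmix : G.uniformMixture T σ = (PMF.uniformOfFintype (Fin T)).map fun t : Fin T => σ t := by
    change PMF.map (fun t : ℕ => σ t)
      (PMF.bind (PMF.uniformOfFintype (Fin T)) fun t => PMF.pure (t : ℕ)) = _
    rw [PMF.map_bind]
    simp_rw [PMF.pure_map]
    exact PMF.bind_pure_comp _ _
  rw [hmix]
  have h1 : G.deviationValue i _ π = _ :=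
    tsum_map_uniformOfFintype (T := T) σ fun s => G.value i (Function.update s i π)
  have h2 : G.jointValue i _ = _ :=
    tsum_map_uniformOfFintype (T := T) σ fun s => G.value i s
  rw [h1, h2, ← sub_div, ← Finset.sum_sub_distrib, div_le_iff₀ hT]
  exact h i π

theorem regret_eq (σ : G.Profile) {i : Fin m} (π : G.Policy i) :
    G.value i (Function.update σ i π) - G.value i σ =
      (∑ x, ∑ a, G.seqForm i (σ i) x a * G.counterfactualLoss σ x a) -
        ∑ x, ∑ a, G.seqForm i π x a * G.counterfactualLoss σ x a := by
  rw [value_update, value_eq]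
  ring

theorem regret_le_horizon (T : ℕ) (σ : ℕ → G.Profile) {i : Fin m} (π : G.Policy i) :
    ∑ t ∈ Finset.range T, (G.value i (Function.update (σ t) i π) - G.value i (σ t)) ≤ H * T := by
  calc _ ≤ ∑ t ∈ Finset.range T, (H : ℝ) := Finset.sum_le_sum fun t _ => by
        linarith [(G.value_mem_Icc (i := i) (Function.update (σ t) i π)).2,
          (G.value_mem_Icc (i := i) (σ t)).1]
    _ = H * T := by simp [mul_comm]

variable {Ω : Type v} [MeasurableSpace Ω] {P : Measure Ω} [IsProbabilityMeasure P]

/-- Subadditivity on the cover of `Ω` by the good event and the players' bad events; none of these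
has to be measurable. -/
theorem measure_isNFCCE_ge (hm : 0 < m) {T : ℕ} [NeZero T] {ε δ ι : ℝ}
    (σ : ℕ → Ω → G.Profile)
    (h : ∀ i, P {ω | ∃ π : G.Policy i, ε * T < ∑ t ∈ Finset.range T,
      (G.value i (Function.update (σ t ω) i π) - G.value i (σ t ω))} ≤
      (3 * G.size i : ℕ) * ENNReal.ofReal (Real.exp (-ι)))
    (hι : 3 * G.sumSize * Real.exp (-ι) ≤ δ) :
    ENNReal.ofReal (1 - δ) ≤ P {ω | G.IsNFCCE ε (G.uniformMixture T fun t => σ t ω)} := by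
  set S := {ω | G.IsNFCCE ε (G.uniformMixture T fun t => σ t ω)} with hS
  let Bad : Fin m → Set Ω := fun i => {ω | ∃ π : G.Policy i, ε * T < ∑ t ∈ Finset.range T,
      (G.value i (Function.update (σ t ω) i π) - G.value i (σ t ω))}
  have hcov : Set.univ ⊆ S ∪ ⋃ i, Bad i := by
    intro ω _
    by_cases hω : ω ∈ ⋃ i, Bad i
    · exact .inr hω
    · refine .inl (G.isNFCCE_of_regret_le hm _ fun i π => ?_)
      by_contra! hlt
      exact hω (Set.mem_iUnion.2 ⟨i, π, hlt⟩)
  have hbad : P (⋃ i, Bad i) ≤ ENNReal.ofReal δ := by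
    calc P (⋃ i, Bad i) ≤ ∑ i, P (Bad i) := measure_iUnion_fintype_le _ _
      _ ≤ ∑ i, (3 * G.size i : ℕ) * ENNReal.ofReal (Real.exp (-ι)) :=
          Finset.sum_le_sum fun i _ => h i
      _ = ENNReal.ofReal (3 * G.sumSize * Real.exp (-ι)) := by
          rw [← Finset.sum_mul, ← Nat.cast_sum, ← Finset.mul_sum,
            ENNReal.ofReal_mul (by positivity)]
          congr 1
          rw [← ENNReal.ofReal_natCast, Nat.cast_mul, POMG.sumSize]
          norm_num
      _ ≤ _ := ENNReal.ofReal_le_ofReal hι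
  have hone : 1 ≤ P S + ENNReal.ofReal δ := by
    calc 1 = P Set.univ := measure_univ.symm
      _ ≤ P (S ∪ ⋃ i, Bad i) := measure_mono hcov
      _ ≤ P S + P (⋃ i, Bad i) := measure_union_le _ _
      _ ≤ _ := by gcongr
  have hδ0 : 0 ≤ δ := le_trans (by positivity) hι
  rw [ENNReal.ofReal_sub _ hδ0, ENNReal.ofReal_one]
  exact tsub_le_iff_right.2 hone

/-! ### Balanced OMD: the regret bound. -/

/-- Here `n`, `S`, `Lg` stand for `H`, `X_i A_i`, `log A_i`. With `D = √(n³ S ι T)` the terms add up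
to at most `6.5 D`, and the condition on `T` says `8 D ≤ ε T`; hence the constant `64`. The
assumption `ε ≤ n` gives `n ι S ≤ T`, so that `κ` and `γ n` are at most one. -/
theorem omd_rates_le {n S Lg ι T η γ ε : ℝ} (hn : 1 ≤ n) (hS : 1 ≤ S) (hL : 0 < Lg) (hLι : Lg ≤ ι)
    (hT : 0 < T) (hε : 0 < ε) (hεn : ε ≤ n) (hη : η = √(S * Lg / (n ^ 3 * T)))
    (hγ : γ = √(S * ι / (n * T))) (hC : 64 * (n ^ 3 * ι * S / ε ^ 2) ≤ T) :
    √(ι / T) ≤ 1 ∧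
    1 / η * (S * Lg) + η / 2 * (n * (2 * (n ^ 2 * T) + n ^ 2 * S / γ * ι)) +
      (γ * n * T + √(ι / T) * (n * T) + n * ι / √(ι / T)) + S * ι / γ ≤ ε * T := by
  have hι : 0 < ι := hL.trans_le hLι
  have hn0 : 0 < n := by linarith
  have hS0 : 0 < S := by linarith
  have hη2 : η ^ 2 * (n ^ 3 * T) = S * Lg := by
    rw [hη, Real.sq_sqrt (by positivity)]
    field_simp
  have hγ2 : γ ^ 2 * (n * T) = S * ι := by
    rw [hγ, Real.sq_sqrt (by positivity)]
    field_simp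
  have hη0 : 0 < η := by rw [hη]; positivity
  have hγ0 : 0 < γ := by rw [hγ]; positivity
  have hC1 : 64 * (n ^ 3 * ι * S) ≤ ε ^ 2 * T := by
    have : 64 * (n ^ 3 * ι * S / ε ^ 2) = 64 * (n ^ 3 * ι * S) / ε ^ 2 := by ring
    rw [this, div_le_iff₀ (by positivity)] at hC
    linarith
  have hC2 : n * ι * S ≤ T := by
    have h1 : ε ^ 2 * T ≤ n ^ 2 * T := by gcongr
    have h2 : n ^ 2 * (64 * (n * ι * S)) ≤ n ^ 2 * T := by nlinarith
    have h3 := le_of_mul_le_mul_left h2 (by positivity)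
    have : 0 < n * ι * S := by positivity
    linarith
  have hιT : ι ≤ T := by
    refine le_trans ?_ hC2
    have : 1 ≤ n * S := one_le_mul_of_one_le_of_one_le hn hS
    nlinarith
  set κ := √(ι / T) with hκ
  have hκ0 : 0 < κ := by positivity
  have hκ2 : κ ^ 2 * T = ι := by
    rw [hκ, Real.sq_sqrt (by positivity)]
    field_simp
  have hκ1 : κ ≤ 1 := by
    exact Real.sqrt_le_one.2 (div_le_one_of_le₀ hιT hT.le)
  set D := √(n ^ 3 * S * ι * T) with hD
  have hD2 : D ^ 2 = n ^ 3 * S * ι * T := by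
    rw [hD, Real.sq_sqrt (by positivity)]
  have hD0 : 0 ≤ D := Real.sqrt_nonneg _
  have hDε : 8 * D ≤ ε * T := by
    refine abs_le_of_sq_le_sq' ?_ (by positivity) |>.2
    have : (8 * D) ^ 2 = 64 * (n ^ 3 * ι * S) * T := by rw [mul_pow, hD2]; ring
    rw [this, mul_pow, pow_two T, ← mul_assoc]
    linarith [mul_le_mul_of_nonneg_right hC1 hT.le]
  have h1 : η * n ^ 3 * T ≤ D := by
    refine abs_le_of_sq_le_sq' ?_ hD0 |>.2
    have : (η * n ^ 3 * T) ^ 2 = (η ^ 2 * (n ^ 3 * T)) * (n ^ 3 * T) := by ring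
    rw [this, hη2, hD2]
    have : S * Lg * (n ^ 3 * T) ≤ S * ι * (n ^ 3 * T) := by gcongr
    linarith
  have hn3 : n ≤ n ^ 3 := le_self_pow₀ hn (by norm_num)
  have hn23 : n ^ 2 ≤ n ^ 3 := pow_le_pow_right₀ hn (by norm_num)
  have h2 : γ * n * T ≤ D := by
    refine abs_le_of_sq_le_sq' ?_ hD0 |>.2
    have : (γ * n * T) ^ 2 = (γ ^ 2 * (n * T)) * (n * T) := by ring
    rw [this, hγ2, hD2]
    have : n * (S * ι * T) ≤ n ^ 3 * (S * ι * T) := by gcongr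
    linarith
  have h3 : κ * (n * T) ≤ D := by
    refine abs_le_of_sq_le_sq' ?_ hD0 |>.2
    have : (κ * (n * T)) ^ 2 = (κ ^ 2 * T) * (n ^ 2 * T) := by ring
    rw [this, hκ2, hD2]
    have : n ^ 2 * (1 * (ι * T)) ≤ n ^ 3 * (S * (ι * T)) := by gcongr
    linarith
  have h4 : γ * n ≤ 1 := by
    refine abs_le_of_sq_le_sq' ?_ zero_le_one |>.2
    have : (γ * n) ^ 2 * T = n * (γ ^ 2 * (n * T)) := by ring
    rw [hγ2] at this
    refine le_of_mul_le_mul_right ?_ hT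
    rw [this]
    linarith
  have e1 : 1 / η * (S * Lg) = η * n ^ 3 * T := by
    rw [← hη2]
    field_simp
  have e2 : S * ι / γ = γ * n * T := by
    rw [← hγ2]
    field_simp
  have e3 : n * ι / κ = κ * (n * T) := by
    rw [← hκ2]
    field_simp
  have e4 : η / 2 * (n * (2 * (n ^ 2 * T) + n ^ 2 * S / γ * ι)) =
      η * n ^ 3 * T + (η * n ^ 3 * T) * (γ * n) / 2 := by
    have : n ^ 2 * S / γ * ι = n ^ 2 * (S * ι / γ) := by ring
    rw [this, e2]
    ring
  have h5 : (η * n ^ 3 * T) * (γ * n) ≤ D * 1 := by gcongr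
  refine ⟨hκ1, ?_⟩
  rw [e1, e2, e3, e4]
  linarith

variable {G}

/-- The regret splits into the underestimation of the played policies, the regret against the
estimates, and the overestimation of the comparator. The last is controlled pair by pair, so one
event serves all comparators; in total `2 + X_i A_i` events are excluded. -/
theorem IsBalancedOMD.measure_regret_le {T : ℕ} [NeZero T] {η γ : Fin m → ℝ} {play : G.Play P T}
    (hG : G.IsBalancedOMD T η γ play) {ε ι : ℝ} (hε : 0 < ε) (i : Fin m)
    (hι : Real.log (Fintype.card (G.A i)) ≤ ι) (hι0 : 0 < ι)
    (hη : η i = √(G.size i * Real.log (Fintype.card (G.A i)) / (H ^ 3 * T)))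
    (hγ : γ i = √(G.size i * ι / (H * T)))
    (hC : 64 * (H ^ 3 * ι * G.size i / ε ^ 2) ≤ T) :
    P {ω | ∃ π : G.Policy i, ε * T < ∑ t ∈ Finset.range T,
      (G.value i (Function.update (play.profile t ω) i π) - G.value i (play.profile t ω))} ≤
      (3 * G.size i : ℕ) * ENNReal.ofReal (Real.exp (-ι)) := by
  classical
  have hT0 : 0 < T := Nat.pos_of_ne_zero (NeZero.ne T)
  have hT : (0 : ℝ) < T := by exact_mod_cast hT0
  have hH := G.horizon_pos
  have hH1 : (1 : ℝ) ≤ H := by exact_mod_cast hH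
  have hS := G.size_pos i
  have hS1 : (1 : ℝ) ≤ G.size i := by exact_mod_cast hS
  have hA : 1 ≤ Fintype.card (G.A i) := Fintype.card_pos
  -- For `ε > H` the claim is trivial, as the regret per round is at most `H`.
  by_cases hεH : ε ≤ H
  swap
  · rw [Set.eq_empty_of_forall_notMem (s := {ω | _})]
    · simp
    · rintro ω ⟨π, hπ⟩
      have := G.regret_le_horizon T (fun t => play.profile t ω) π
      push Not at hεH
      nlinarith
  -- With a single action `log A_i`, and so `η i`, is zero and mirror descent degenerates; but then
  -- there is only one policy and no regret.
  rcases hA.eq_or_lt with hA1 | hA1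
  · rw [Set.eq_empty_of_forall_notMem (s := {ω | _})]
    · simp
    · rintro ω ⟨π, hπ⟩
      have hsub : Subsingleton (G.A i) := Fintype.card_le_one_iff_subsingleton.1 hA1.ge
      have hπ' : ∀ σ : G.Profile, Function.update σ i π = σ := fun σ => by
        rw [Function.update_eq_self_iff]
        refine funext fun x => Subtype.ext (funext fun a => ?_)
        have h1 : ∀ μ : G.Policy i, (μ x).1 a = 1 := fun μ => by
          rw [← G.policy_sum μ x]
          exact (Fintype.sum_subsingleton _ a).symm
        rw [h1, h1]
      simp only [hπ', sub_self, Finset.sum_const_zero] at hπ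
      have : 0 < ε * T := by positivity
      linarith
  have hL : 0 < Real.log (Fintype.card (G.A i)) := Real.log_pos (by exact_mod_cast hA1)
  obtain ⟨hκ1, hrate⟩ := omd_rates_le hH1 hS1 hL hι hT hε hεH hη hγ hC
  have hη0 : 0 < η i := by rw [hη]; positivity
  have hγ0 : 0 < γ i := by rw [hγ]; positivity
  have hB1 := hG.measure_played_le hη0 hγ0 hH (κ := √(ι / T)) (by positivity) hκ1 ι
  have hB2 := measure_secondOrder_le play hγ0 hH hS ι
  have hB3 := fun k : G.X i × G.A i => hG.measure_comparator_le hη0 hγ0 ι k.1 k.2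
  refine le_trans (measure_mono (t := _ ∪ (_ ∪ ⋃ k : G.X i × G.A i, _)) ?_)
    ((measure_union_le _ _).trans (add_le_add hB1 ((measure_union_le _ _).trans
      (add_le_add hB2 ((measure_iUnion_fintype_le P _).trans
        (Finset.sum_le_sum fun k _ => hB3 k)))))) |>.trans ?_
  · rintro ω ⟨π, hπ⟩
    by_contra hω
    simp only [Set.mem_union, Set.mem_iUnion, not_or, not_exists, Set.mem_ofPred_eq, not_lt] at hω
    obtain ⟨h1, h2, h3⟩ := hω
    simp only [regret_eq, Finset.sum_sub_distrib] at hπ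
    have h4 := hG.estimated_regret_le hT0 hη0 hγ0 ω π
    rw [Finset.sum_sub_distrib] at h4
    have h5 : (∑ t ∈ Finset.range T, ∑ x, ∑ a, G.seqForm i π x a *
        G.omdLoss i (γ i) (play.profile t ω i) (play.episode t ω) x a) -
        ∑ t ∈ Finset.range T, ∑ x, ∑ a, G.seqForm i π x a *
          G.counterfactualLoss (play.profile t ω) x a ≤ G.size i * ι / γ i := by
      rw [← Finset.sum_sub_distrib]
      calc _ = ∑ x, ∑ a, G.seqForm i π x a * ∑ t ∈ Finset.range T,
              (G.omdLoss i (γ i) (play.profile t ω i) (play.episode t ω) x a -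
                G.counterfactualLoss (play.profile t ω) x a) := by
            simp only [← Finset.sum_sub_distrib, ← mul_sub, Finset.mul_sum]
            rw [Finset.sum_comm]
            exact Finset.sum_congr rfl fun x _ => Finset.sum_comm
        _ ≤ ∑ x, ∑ a, G.seqForm i π x a * (ι / (γ i * G.balancedWeight x)) :=
            Finset.sum_le_sum fun x _ => Finset.sum_le_sum fun a _ =>
              mul_le_mul_of_nonneg_left (h3 (x, a)) (G.seqForm_nonneg π x a)
        _ = (∑ x, G.reach π x / G.balancedWeight x) * (ι / γ i) := by
            rw [Finset.sum_mul]
            refine Finset.sum_congr rfl fun x _ => ?_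
            rw [← Finset.sum_mul, sum_seqForm]
            have := (G.balancedWeight_pos x).ne'
            field_simp
        _ = _ := by rw [G.sum_reach_div, mul_div_assoc]
    have h6 := mul_le_mul_of_nonneg_left (mul_le_mul_of_nonneg_left h2 (Nat.cast_nonneg H))
      (half_pos hη0).le
    linarith
  · rw [Finset.sum_const, Finset.card_univ, Fintype.card_prod, nsmul_eq_mul, ← add_assoc,
      ← two_mul, ← add_mul]
    gcongr
    have : 2 + Fintype.card (G.X i) * Fintype.card (G.A i) ≤ 3 * G.size i := by
      change 2 + G.size i ≤ _
      omega
    exact_mod_cast this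

end IIEFG

namespace IIEFG

/-! ### Balanced CFR: local regrets and concentration of the counterfactual estimates. -/

section CFR

variable {m H : ℕ} {G : IIEFG.{u} m H} {i : Fin m}

/-- The total of the action values of `ν`, when the layers are reached with `π` and `μ x` is played
at `x`. -/
theorem sum_reach_actionValue_le (σ : G.Profile) (π ν μ : G.Policy i) :
    ∑ x, G.reach π x * ∑ a, (μ x).1 a * G.actionValue ν (G.counterfactualLoss σ) x a ≤
      (H : ℝ) ^ 2 := by
  classical
  rw [sum_layers]
  calc _ ≤ ∑ h : Fin H, (H : ℝ) := Finset.sum_le_sum fun h _ => by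
        -- Concatenating `π`, `μ` and `ν` before, at and after layer `h` turns the layer's sum into
        -- the loss of one policy from layer `h` on.
        let ρ : G.Policy i := fun x =>
          if G.infoStep i x < h then π x else if G.infoStep i x = h then μ x else ν x
        have hs := G.sum_layer_actionValue ν ρ h
          (fun x hx => by simp [ρ, hx.not_gt, hx.ne']) (G.counterfactualLoss σ)
        have hl := G.sum_seqForm_counterfactualLoss_le σ ρ
          (Finset.univ.filter fun x => h ≤ G.infoStep i x)
        rw [← hs] at hl
        refine le_trans (le_of_eq (Finset.sum_congr rfl fun x hx => ?_)) hl
        have hx := (Finset.mem_filter.1 hx).2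
        have hr : G.reach ρ x = G.reach π x := G.reach_congr fun y hy => if_pos (hx ▸ hy)
        have hρ : ρ x = μ x := by simp [ρ, hx]
        rw [Finset.mul_sum]
        refine Finset.sum_congr rfl fun a _ => ?_
        rw [seqForm_eq, hr, hρ, mul_assoc]
    _ = (H : ℝ) ^ 2 := by simp [sq]

/-- The loss of player `i` from `(x, a)` on, zero if this pair is not visited. -/
noncomputable def visitTail (e : G.Episode) (x : G.X i) (a : G.A i) : ℝ :=
  G.visit i e x a * ((H : ℝ) - (G.infoStep i x : ℕ) -
      ∑ h' ∈ Finset.Ici (G.infoStep i x), (e.2 h' i : ℝ))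

theorem measurable_visitTail (x : G.X i) (a : G.A i) :
    Measurable fun e : G.Episode => visitTail e x a :=
  (G.measurable_visit x a).mul ((Finset.measurable_sum _ fun h _ =>
    G.measurable_reward h).const_sub _)

theorem visitTail_nonneg (e : G.Episode) (x : G.X i) (a : G.A i) : 0 ≤ visitTail e x a := by
  refine mul_nonneg (G.visit_nonneg e x a) (sub_nonneg.2 ?_)
  calc ∑ h' ∈ Finset.Ici (G.infoStep i x), (e.2 h' i : ℝ)
      ≤ ∑ h' ∈ Finset.Ici (G.infoStep i x), (1 : ℝ) := Finset.sum_le_sum fun h _ => (e.2 h i).2.2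
    _ = (H : ℝ) - (G.infoStep i x : ℕ) := by simp [Nat.cast_sub (G.infoStep i x).2.le]

theorem visitTail_le (e : G.Episode) (x : G.X i) (a : G.A i) :
    visitTail e x a ≤ H * G.visit i e x a := by
  rw [visitTail, mul_comm]
  refine mul_le_mul_of_nonneg_right ?_ (G.visit_nonneg e x a)
  have h1 : 0 ≤ ∑ h' ∈ Finset.Ici (G.infoStep i x), (e.2 h' i : ℝ) :=
    Finset.sum_nonneg fun h _ => (e.2 h i).2.1
  have h2 : (0 : ℝ) ≤ (G.infoStep i x : ℕ) := Nat.cast_nonneg _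
  linarith

theorem visitTail_le_horizon (e : G.Episode) (x : G.X i) (a : G.A i) : visitTail e x a ≤ H :=
  (visitTail_le e x a).trans (mul_le_of_le_one_right (Nat.cast_nonneg _) (G.visit_le_one e x a))

theorem cfrLoss_eq (e : G.Episode) (x : G.X i) (a : G.A i) :
    G.cfrLoss i e x a = visitTail e x a / G.balancedWeight x := by
  rw [cfrLoss, balancedSeq_eq, visitTail]
  ring

theorem cfrLoss_nonneg (e : G.Episode) (x : G.X i) (a : G.A i) : 0 ≤ G.cfrLoss i e x a := by
  rw [cfrLoss_eq]
  exact div_nonneg (visitTail_nonneg e x a) (G.balancedWeight_pos x).le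

theorem sum_visit_infoset_le (e : G.Episode) (x : G.X i) : ∑ a, G.visit i e x a ≤ 1 :=
  (Finset.single_le_sum (f := fun x => ∑ a, G.visit i e x a)
    (fun y _ => Finset.sum_nonneg fun a _ => G.visit_nonneg e y a)
    (by simp : x ∈ Finset.univ.filter fun y => G.infoStep i y = G.infoStep i x)).trans
    (G.sum_layer_visit_le e (G.infoStep i x))

/-- At most one action is visited at `x`, so the range carries no factor `A_i`. -/
theorem sum_mul_cfrLoss_le (c : G.A i → ℝ) (hc : ∀ a, c a ≤ 1) (e : G.Episode) (x : G.X i) :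
    ∑ a, c a * G.cfrLoss i e x a ≤ H / G.balancedWeight x := by
  calc _ ≤ ∑ a, H * G.visit i e x a / G.balancedWeight x := Finset.sum_le_sum fun a _ => by
        refine (mul_le_of_le_one_left (cfrLoss_nonneg e x a) (hc a)).trans ?_
        rw [cfrLoss_eq]
        exact div_le_div_of_nonneg_right (visitTail_le e x a) (G.balancedWeight_pos x).le
    _ = H * (∑ a, G.visit i e x a) / G.balancedWeight x := by
        rw [← Finset.sum_div, Finset.mul_sum]
    _ ≤ H * 1 / G.balancedWeight x := by
        have := (G.balancedWeight_pos x).le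
        gcongr
        exact sum_visit_infoset_le e x
    _ = _ := by rw [mul_one]

theorem hedgeWeight_eq {η : ℝ} (hη : 0 < η) (μ : G.Policy i) (L : G.X i → G.A i → ℝ) (x : G.X i)
    (a : G.A i) : G.hedgeWeight i η μ L x a / ∑ b, G.hedgeWeight i η μ L x b =
      expWeights (1 / (η * G.balancedWeight x)) (μ x).1 (L x) a := by
  have h : ∀ a, G.hedgeWeight i η μ L x a =
      (μ x).1 a * Real.exp (-(L x a / (1 / (η * G.balancedWeight x)))) := fun a => by
    rw [hedgeWeight, balancedSeq_eq]
    congr 3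
    have := (mul_pos hη (G.balancedWeight_pos x)).ne'
    field_simp
  simp only [h, expWeights, partitionFn]

variable {Ω : Type v} [MeasurableSpace Ω] {P : Measure Ω} {T N : ℕ}
  {η : Fin m → ℝ} {pol : ℕ → Ω → G.Profile} {play : G.Play P N}

/-- The counterfactual loss vector of player `i` in round `t`. -/
noncomputable def cfrValue (pol : ℕ → Ω → G.Profile) (t : ℕ) (ω : Ω) (x : G.X i) (a : G.A i) : ℝ :=
  G.actionValue (pol t ω i) (G.counterfactualLoss (pol t ω)) x a

/-- The estimate of the counterfactual loss vector of player `i` in round `t`. -/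
noncomputable def cfrEstimate (play : G.Play P N) (t : ℕ) (ω : Ω) (x : G.X i) (a : G.A i) : ℝ :=
  G.cfrLoss i (play.episode (cfrIndex t i (G.infoStep i x)) ω) x a

theorem IsBalancedCFR.update_eq (hG : G.IsBalancedCFR T N η pol play) (hη : 0 < η i) {t : ℕ}
    (ht : t + 1 < T) (ω : Ω) (x : G.X i) : (pol (t + 1) ω i x).1 =
      expWeights (1 / (η i * G.balancedWeight x)) (pol t ω i x).1 (cfrEstimate play t ω x) := by
  funext a
  rw [hG.update t ht ω i x a, hedgeWeight_eq hη]
  rfl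

theorem IsBalancedCFR.pos (hG : G.IsBalancedCFR T N η pol play) (hη : 0 < η i) (ω : Ω) {t : ℕ}
    (ht : t < T) (x : G.X i) (a : G.A i) : 0 < (pol t ω i x).1 a := by
  induction t generalizing a with
  | zero => rw [hG.init]; exact G.uniformPolicy_pos x a
  | succ t ih =>
    rw [hG.update_eq hη ht]
    exact expWeights_pos (ih (by omega)) a

theorem cfrIndex_eq (t : ℕ) (i : Fin m) (h : Fin H) :
    cfrIndex t i h = t * (m * H) + (i * H + h) := by
  unfold cfrIndex
  ring

theorem index_lt (i : Fin m) (h : Fin H) : (i : ℕ) * H + h < m * H := by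
  calc (i : ℕ) * H + h < i * H + H := by have := h.2; omega
    _ = (i + 1) * H := by ring
    _ ≤ m * H := Nat.mul_le_mul_right H i.2

/-- Recovers the round from the episode number, so that coefficients indexed by rounds can be fed to
concentration bounds indexed by episodes. -/
theorem cfrIndex_div (t : ℕ) (i : Fin m) (h : Fin H) : cfrIndex t i h / (m * H) = t := by
  rw [cfrIndex_eq, Nat.div_eq_of_lt_le]
  · omega
  · have := index_lt i h
    rw [Nat.succ_mul]
    omega

theorem IsBalancedCFR.episodes_eq (hG : G.IsBalancedCFR T N η pol play) : N = m * H * T := by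
  refine eq_of_forall_lt_iff fun n => ?_
  rw [hG.episodes]
  constructor
  · rintro ⟨t, ht, i, h, rfl⟩
    have := index_lt i h
    rw [cfrIndex_eq]
    calc _ < t * (m * H) + m * H := by omega
      _ = m * H * (t + 1) := by ring
      _ ≤ m * H * T := Nat.mul_le_mul_left _ ht
  · intro hn
    have hmH : 0 < m * H := Nat.pos_of_ne_zero fun h => by simp [h] at hn
    have hm : 0 < m := Nat.pos_of_mul_pos_right hmH
    have hH : 0 < H := Nat.pos_of_mul_pos_left hmH
    refine ⟨n / (m * H), Nat.div_lt_of_lt_mul hn, ⟨n / H % m, Nat.mod_lt _ hm⟩,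
      ⟨n % H, Nat.mod_lt _ hH⟩, ?_⟩
    simp only [cfrIndex]
    have h1 : n / (m * H) = n / H / m := by rw [mul_comm, Nat.div_div_eq_div_mul]
    rw [h1, mul_comm _ m, Nat.div_add_mod, mul_comm, Nat.div_add_mod]

theorem IsBalancedCFR.index_lt (hG : G.IsBalancedCFR T N η pol play) {t : ℕ} (ht : t < T)
    (h : Fin H) : cfrIndex t i h < N :=
  (hG.episodes _).2 ⟨t, ht, i, h, rfl⟩

/-- The policies of round `t` depend only on the `t * (m * H)` episodes of earlier rounds, hence are
predictable for every episode of the round. -/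
theorem IsBalancedCFR.measurable_pol (hG : G.IsBalancedCFR T N η pol play) {t : ℕ} (ht : t < T) :
    G.MeasurableProfile (play.ℱ (t * (m * H))) (pol t) := by
  induction t with
  | zero =>
    intro i x a
    simp only [hG.init]
    exact measurable_const
  | succ t ih =>
    have hle : play.ℱ (t * (m * H)) ≤ play.ℱ ((t + 1) * (m * H)) :=
      play.ℱ.mono (Nat.mul_le_mul_right _ (Nat.le_succ t))
    have hw : ∀ i x a, Measurable[play.ℱ ((t + 1) * (m * H))] fun ω =>
        G.hedgeWeight i (η i) (pol t ω i)
          (fun y => G.cfrLoss i (play.episode (cfrIndex t i (G.infoStep i y)) ω) y) x a := by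
      intro i x a
      have he : Measurable[play.ℱ ((t + 1) * (m * H))]
          (play.episode (cfrIndex t i (G.infoStep i x))) := by
        refine (play.episode_measurable _ (hG.index_lt (by omega) _)).mono
          (play.ℱ.mono ?_) le_rfl
        have := IIEFG.index_lt i (G.infoStep i x)
        rw [cfrIndex_eq, Nat.succ_mul]
        omega
      have hL : Measurable fun e : G.Episode => G.cfrLoss i e x a := by
        simp only [cfrLoss_eq]
        exact (measurable_visitTail x a).div_const _
      exact ((ih (by omega) i x a).mono hle le_rfl).mul
        (((hL.comp he).const_mul _).neg.exp)
    intro i x a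
    simp only [hG.update t ht]
    exact (hw i x a).div (Finset.measurable_sum _ fun b _ => hw i x b)

/-- The local regret of the Hedge update at an infoset, with respect to the estimates. -/
theorem IsBalancedCFR.local_regret_le (hG : G.IsBalancedCFR T N η pol play) (hT : 0 < T)
    (hη : 0 < η i) (ω : Ω) (π : G.Policy i) (x : G.X i) :
    ∑ t ∈ Finset.range T, ((∑ a, (pol t ω i x).1 a * cfrEstimate play t ω x a) -
      ∑ a, (π x).1 a * cfrEstimate play t ω x a) ≤
      Real.log (Fintype.card (G.A i)) / (η i * G.balancedWeight x) + η i * H / 2 *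
        ∑ t ∈ Finset.range T, ∑ a, (pol t ω i x).1 a * cfrEstimate play t ω x a := by
  have hw := G.balancedWeight_pos x
  set c := 1 / (η i * G.balancedWeight x) with hc
  have hc0 : 0 < c := one_div_pos.2 (mul_pos hη hw)
  let p : ℕ → G.A i → ℝ := fun t => expWeights c (pol t ω i x).1 (cfrEstimate play t ω x)
  have hu : ∀ t a, 0 ≤ cfrEstimate play t ω x a := fun t a => cfrLoss_nonneg _ x a
  have hstep : ∀ t ∈ Finset.range T, (∑ a, (pol t ω i x).1 a * cfrEstimate play t ω x a) -
      ∑ a, (π x).1 a * cfrEstimate play t ω x a ≤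
      (c * finiteKL (π x).1 (pol t ω i x).1 - c * finiteKL (π x).1 (p t)) + η i * H / 2 *
        ∑ a, (pol t ω i x).1 a * cfrEstimate play t ω x a := by
    intro t ht
    have hpos := hG.pos hη ω (Finset.mem_range.1 ht) x
    have h1 := expWeights_identity (u := cfrEstimate play t ω x) hc0 hpos (π x).2
    have h2 := le_neg_log_partitionFn hc0 hpos (pol t ω i x).2 (hu t)
    -- The balanced weight in the local learning rate cancels the one in the estimate, so one factor
    -- of the square is at most `H` and the term becomes linear.
    have h3 : 1 / (2 * c) * ∑ a, (pol t ω i x).1 a * cfrEstimate play t ω x a ^ 2 ≤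
        η i * H / 2 * ∑ a, (pol t ω i x).1 a * cfrEstimate play t ω x a := by
      rw [Finset.mul_sum, Finset.mul_sum]
      refine Finset.sum_le_sum fun a _ => ?_
      have h4 : 1 / (2 * c) = η i / 2 * G.balancedWeight x := by
        rw [hc]
        field_simp
      have h5 : G.balancedWeight x * cfrEstimate play t ω x a ≤ H := by
        rw [cfrEstimate, cfrLoss_eq, mul_div_cancel₀ _ hw.ne']
        exact visitTail_le_horizon _ x a
      have h6 := mul_le_mul_of_nonneg_left h5
        (mul_nonneg (half_pos hη).le (mul_nonneg (hpos a).le (hu t a)))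
      rw [h4]
      nlinarith
    simp only [p]
    linarith
  refine (Finset.sum_le_sum hstep).trans ?_
  rw [Finset.sum_add_distrib, ← Finset.mul_sum]
  refine add_le_add ?_ le_rfl
  refine (sum_telescope_le hT (fun t => c * finiteKL (π x).1 (pol t ω i x).1)
    (fun t => c * finiteKL (π x).1 (p t))
    (fun t ht => by rw [hG.update_eq hη ht])
    (mul_nonneg hc0.le (finiteKL_nonneg (π x).2
      (expWeights_mem (hG.pos hη ω (by omega) x))
      (expWeights_pos (hG.pos hη ω (by omega) x))))).trans ?_
  rw [hG.init, div_eq_mul_one_div, mul_comm]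
  exact mul_le_mul_of_nonneg_right (finiteKL_uniform_le (π x).2) hc0.le

variable [IsProbabilityMeasure P]

/-- Concentration of the estimated counterfactual losses at an infoset. -/
theorem IsBalancedCFR.measure_estimate_le (hG : G.IsBalancedCFR T N η pol play) (x : G.X i)
    (c : ℕ → Ω → G.A i → ℝ)
    (hc : ∀ t < T, ∀ a, Measurable[play.ℱ (t * (m * H))] fun ω => c t ω a)
    (hc0 : ∀ t ω a, 0 ≤ c t ω a) (hc1 : ∀ t ω a, c t ω a ≤ 1) {κ s : ℝ} (hκ : 0 < κ)
    (hκ1 : κ ≤ 1) (hs : |s| = 1) (ι : ℝ) :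
    P {ω | κ * (∑ t ∈ Finset.range T, ∑ a, c t ω a * cfrValue pol t ω x a) +
        H / G.balancedWeight x * ι / κ <
      s * ((∑ t ∈ Finset.range T, ∑ a, c t ω a * cfrEstimate play t ω x a) -
        ∑ t ∈ Finset.range T, ∑ a, c t ω a * cfrValue pol t ω x a)} ≤
      ENNReal.ofReal (Real.exp (-ι)) := by
  classical
  have hw := G.balancedWeight_pos x
  have hH : (0 : ℝ) < H := by exact_mod_cast G.horizon_pos
  set idx : ℕ → ℕ := fun t => cfrIndex t i (G.infoStep i x) with hidx
  have hdiv : ∀ t, idx t / (m * H) = t := fun t => cfrIndex_div t i _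
  have hinj : Function.Injective idx := fun t t' h => by rw [← hdiv t, h, hdiv]
  have h := measure_deviation_le play ((Finset.range T).image idx)
    (fun n hn => by
      obtain ⟨t, ht, rfl⟩ := Finset.mem_image.1 hn
      exact hG.index_lt (Finset.mem_range.1 ht) _)
    (fun n ω a => c (n / (m * H)) ω a) (fun a e => G.cfrLoss i e x a)
    (fun n hn a => by
      obtain ⟨t, ht, rfl⟩ := Finset.mem_image.1 hn
      rw [hdiv]
      refine (hc t (Finset.mem_range.1 ht) a).mono (play.ℱ.mono ?_) le_rfl
      simp only [hidx, cfrIndex_eq]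
      omega)
    (fun a => by
      simp only [cfrLoss_eq]
      exact (measurable_visitTail x a).div_const _)
    (B := H / G.balancedWeight x)
    (fun a e => by
      rw [abs_of_nonneg (cfrLoss_nonneg e x a), cfrLoss_eq]
      exact div_le_div_of_nonneg_right (visitTail_le_horizon e x a) hw.le)
    (R := H / G.balancedWeight x) (div_pos hH hw) hκ hκ1 hs
    (fun n _ ω e => Finset.sum_nonneg fun a _ => mul_nonneg (hc0 _ _ _) (cfrLoss_nonneg e x a))
    (fun n _ ω e => sum_mul_cfrLoss_le _ (fun a => hc1 _ _ a) e x) ι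
  refine le_trans (measure_mono fun ω hω => ?_) h
  -- Unbiasedness: in its dedicated episode `(x, a)` has sequence-form weight equal to the balanced
  -- weight, which the estimator divides out, and afterwards the current policy is followed.
  have hE : ∀ t ∈ Finset.range T, ∑ a, c t ω a *
      ∫ e, G.cfrLoss i e x a ∂G.episodeLaw (play.profile (idx t) ω) =
      ∑ a, c t ω a * cfrValue pol t ω x a := by
    intro t ht
    refine Finset.sum_congr rfl fun a _ => ?_
    congr 1
    have hp := hG.played t (Finset.mem_range.1 ht) i (G.infoStep i x) ω
    simp only [hidx, hp, cfrLoss_eq, integral_div]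
    have hT := G.integral_visit_mul_tail (Function.update (pol t ω) i
      (G.explore (G.infoStep i x) (pol t ω i))) (pol t ω i) x a
      (fun y hy => by rw [Function.update_self, G.explore_of_lt _ hy])
    rw [counterfactualLoss_update, Function.update_self, G.seqForm_explore _ rfl] at hT
    change (∫ e, visitTail e x a ∂_) = _ at hT
    rw [hT, mul_div_cancel_left₀ _ hw.ne', cfrValue]
  simp only [Set.mem_ofPred_eq] at hω ⊢
  rw [Finset.sum_image hinj.injOn, Finset.sum_image hinj.injOn]
  simp only [hdiv]
  rw [Finset.sum_congr rfl hE]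
  exact hω

end CFR

/-- The choice `κ = √(S ι / (n T))` equalizes the multiplicative error `κ n² T` and the range error
`n ι S / κ`. Again the total is at most `6.5 D` with `8 D ≤ ε T`. -/
theorem cfr_rates_le {n S Lg ι T η ε : ℝ} (hn : 1 ≤ n) (hS : 1 ≤ S) (hLι : Lg ≤ ι)
    (hι : 0 < ι) (hT : 0 < T) (hε : 0 < ε) (hεn : ε ≤ n) (hη : η = √(S * ι / (n ^ 3 * T)))
    (hC : 64 * (n ^ 3 * ι * S / ε ^ 2) ≤ T) :
    √(S * ι / (n * T)) ≤ 1 ∧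
    √(S * ι / (n * T)) * (2 * (n ^ 2 * T)) + 2 * (n * ι / √(S * ι / (n * T)) * S) + Lg / η * S +
      η * n / 2 * (2 * (n ^ 2 * T) + n * ι * S) ≤ ε * T := by
  have hn0 : 0 < n := by linarith
  have hS0 : 0 < S := by linarith
  have hη2 : η ^ 2 * (n ^ 3 * T) = S * ι := by
    rw [hη, Real.sq_sqrt (by positivity)]
    field_simp
  have hη0 : 0 < η := by rw [hη]; positivity
  have hC1 : 64 * (n ^ 3 * ι * S) ≤ ε ^ 2 * T := by
    have : 64 * (n ^ 3 * ι * S / ε ^ 2) = 64 * (n ^ 3 * ι * S) / ε ^ 2 := by ring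
    rw [this, div_le_iff₀ (by positivity)] at hC
    linarith
  have hC2 : n * ι * S ≤ T := by
    have h1 : ε ^ 2 * T ≤ n ^ 2 * T := by gcongr
    have h2 : n ^ 2 * (64 * (n * ι * S)) ≤ n ^ 2 * T := by nlinarith
    have h3 := le_of_mul_le_mul_left h2 (by positivity)
    have : 0 < n * ι * S := by positivity
    linarith
  have hSι : 0 < S * ι := by positivity
  have hC3 : S * ι ≤ n * T := by nlinarith
  set κ := √(S * ι / (n * T)) with hκ
  have hκ0 : 0 < κ := by positivity
  have hκ2 : κ ^ 2 * (n * T) = S * ι := by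
    rw [hκ, Real.sq_sqrt (by positivity)]
    field_simp
  have hκ1 : κ ≤ 1 := Real.sqrt_le_one.2 (div_le_one_of_le₀ hC3 (by positivity))
  set D := √(n ^ 3 * S * ι * T) with hD
  have hD2 : D ^ 2 = n ^ 3 * S * ι * T := by
    rw [hD, Real.sq_sqrt (by positivity)]
  have hD0 : 0 ≤ D := Real.sqrt_nonneg _
  have hDε : 8 * D ≤ ε * T := by
    refine abs_le_of_sq_le_sq' ?_ (by positivity) |>.2
    have : (8 * D) ^ 2 = 64 * (n ^ 3 * ι * S) * T := by rw [mul_pow, hD2]; ring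
    rw [this, mul_pow, pow_two T, ← mul_assoc]
    linarith [mul_le_mul_of_nonneg_right hC1 hT.le]
  have h1 : η * n ^ 3 * T ≤ D := by
    refine abs_le_of_sq_le_sq' ?_ hD0 |>.2
    have : (η * n ^ 3 * T) ^ 2 = (η ^ 2 * (n ^ 3 * T)) * (n ^ 3 * T) := by ring
    rw [this, hη2, hD2]
    linarith
  have h3 : κ * (n ^ 2 * T) ≤ D := by
    refine abs_le_of_sq_le_sq' ?_ hD0 |>.2
    have : (κ * (n ^ 2 * T)) ^ 2 = (κ ^ 2 * (n * T)) * (n ^ 3 * T) := by ring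
    rw [this, hκ2, hD2]
    linarith
  have e1 : Lg / η * S ≤ η * n ^ 3 * T := by
    have : η * n ^ 3 * T = ι / η * S := by
      rw [div_mul_eq_mul_div, mul_comm ι, ← hη2]
      field_simp
    rw [this]
    gcongr
  have e3 : n * ι / κ * S = κ * (n ^ 2 * T) := by
    have : n * ι / κ * S = n * (S * ι) / κ := by ring
    rw [this, ← hκ2]
    field_simp
  have e4 : η * n / 2 * (2 * (n ^ 2 * T) + n * ι * S) ≤ η * n ^ 3 * T + η * n ^ 3 * T / 2 := by
    have h5 : η * n ^ 2 / 2 * (S * ι) ≤ η * n ^ 2 / 2 * (n * T) := by gcongr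
    nlinarith
  refine ⟨hκ1, ?_⟩
  rw [e3]
  linarith

variable {m H : ℕ} {G : IIEFG.{u} m H} {Ω : Type v} [MeasurableSpace Ω] {P : Measure Ω}
  [IsProbabilityMeasure P]

/-- The regret is the sum of the local regrets `A x - B x` weighted with the reach of the
comparator. Three families of events, `X_i`, `X_i` and `X_i A_i` in number, compare true and
estimated losses at each infoset. -/
theorem IsBalancedCFR.measure_regret_le {T N : ℕ} [NeZero T] {η : Fin m → ℝ}
    {pol : ℕ → Ω → G.Profile} {play : G.Play P N}
    (hG : G.IsBalancedCFR T N η pol play) {ε ι : ℝ} (hε : 0 < ε) (i : Fin m)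
    (hι : Real.log (Fintype.card (G.A i)) ≤ ι) (hι0 : 0 < ι)
    (hη : η i = √(G.size i * ι / (H ^ 3 * T)))
    (hC : 64 * (H ^ 3 * ι * G.size i / ε ^ 2) ≤ T) :
    P {ω | ∃ π : G.Policy i, ε * T < ∑ t ∈ Finset.range T,
      (G.value i (Function.update (pol t ω) i π) - G.value i (pol t ω))} ≤
      (3 * G.size i : ℕ) * ENNReal.ofReal (Real.exp (-ι)) := by
  classical
  have hT0 : 0 < T := Nat.pos_of_ne_zero (NeZero.ne T)
  have hT : (0 : ℝ) < T := by exact_mod_cast hT0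
  have hH := G.horizon_pos
  have hH1 : (1 : ℝ) ≤ H := by exact_mod_cast hH
  have hS := G.size_pos i
  have hS1 : (1 : ℝ) ≤ G.size i := by exact_mod_cast hS
  have hA : 1 ≤ Fintype.card (G.A i) := Fintype.card_pos
  by_cases hεH : ε ≤ H
  swap
  · rw [Set.eq_empty_of_forall_notMem (s := {ω | _})]
    · simp
    · rintro ω ⟨π, hπ⟩
      have := G.regret_le_horizon T (fun t => pol t ω) π
      push Not at hεH
      nlinarith
  obtain ⟨hκ1, hrate⟩ := cfr_rates_le hH1 hS1 hι hι0 hT hε hεH hη hC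
  have hη0 : 0 < η i := by rw [hη]; positivity
  set κ := √(G.size i * ι / (H * T)) with hκ
  have hκ0 : 0 < κ := by positivity
  have hB1 := fun x : G.X i => hG.measure_estimate_le x (fun t ω a => (pol t ω i x).1 a)
    (fun t ht a => hG.measurable_pol ht i x a) (fun t ω a => G.policy_nonneg _ x a)
    (fun t ω a => G.policy_le_one _ x a) hκ0 hκ1 (s := -1) (by simp) ι
  -- This bound enters only the second-order term, where a constant factor is affordable, so `κ = 1`
  -- suffices.
  have hB2 := fun x : G.X i => hG.measure_estimate_le x (fun t ω a => (pol t ω i x).1 a)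
    (fun t ht a => hG.measurable_pol ht i x a) (fun t ω a => G.policy_nonneg _ x a)
    (fun t ω a => G.policy_le_one _ x a) one_pos le_rfl (s := 1) (by simp) ι
  -- Point masses on single actions; averaging over them with `π x` covers all comparators at once.
  have hB3 := fun k : G.X i × G.A i => hG.measure_estimate_le k.1
    (fun _ _ a => if a = k.2 then 1 else 0)
    (fun t ht a => measurable_const) (fun t ω a => by split_ifs <;> simp)
    (fun t ω a => by split_ifs <;> simp) hκ0 hκ1 (s := 1) (by simp) ι
  refine le_trans (measure_mono (t := (⋃ x : G.X i, _) ∪ ((⋃ x : G.X i, _) ∪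
    ⋃ k : G.X i × G.A i, _)) ?_)
    ((measure_union_le _ _).trans (add_le_add ((measure_iUnion_fintype_le P _).trans
        (Finset.sum_le_sum fun k _ => hB1 k)) ((measure_union_le _ _).trans
      (add_le_add ((measure_iUnion_fintype_le P _).trans
        (Finset.sum_le_sum fun k _ => hB2 k)) ((measure_iUnion_fintype_le P _).trans
        (Finset.sum_le_sum fun k _ => hB3 k)))))) |>.trans ?_
  · rintro ω ⟨π, hπ⟩
    by_contra hω
    simp only [Set.mem_union, Set.mem_iUnion, not_or, not_exists, Set.mem_ofPred_eq, not_lt,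
      one_mul, div_one, neg_mul, ite_mul, zero_mul, Finset.sum_ite_eq', Finset.mem_univ,
      if_true] at hω
    obtain ⟨h1, h2, h3⟩ := hω
    let A : G.X i → ℝ := fun x => ∑ t ∈ Finset.range T, ∑ a, (pol t ω i x).1 a * cfrValue pol t ω x a
    let B : G.X i → ℝ := fun x => ∑ t ∈ Finset.range T, ∑ a, (π x).1 a * cfrValue pol t ω x a
    have hreg : ∑ t ∈ Finset.range T,
        (G.value i (Function.update (pol t ω) i π) - G.value i (pol t ω)) =
        ∑ x, G.reach π x * (A x - B x) := by
      simp only [regret_eq, regret_decomposition, sub_mul, Finset.sum_sub_distrib, A, B, mul_sub]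
      simp only [Finset.mul_sum (s := Finset.range T)]
      rw [Finset.sum_comm (s := Finset.range T), Finset.sum_comm (s := Finset.range T)]
      rfl
    have hsumA : ∑ x, G.reach π x * A x ≤ (H : ℝ) ^ 2 * T := by
      calc _ = ∑ t ∈ Finset.range T, ∑ x, G.reach π x *
            ∑ a, (pol t ω i x).1 a * cfrValue pol t ω x a := by
            simp only [A, Finset.mul_sum (s := Finset.range T)]
            exact Finset.sum_comm
        _ ≤ ∑ t ∈ Finset.range T, (H : ℝ) ^ 2 := Finset.sum_le_sum fun t _ =>
            sum_reach_actionValue_le (pol t ω) π (pol t ω i) (pol t ω i)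
        _ = _ := by simp [mul_comm]
    have hsumB : ∑ x, G.reach π x * B x ≤ (H : ℝ) ^ 2 * T := by
      calc _ = ∑ t ∈ Finset.range T, ∑ x, G.reach π x *
            ∑ a, (π x).1 a * cfrValue pol t ω x a := by
            simp only [B, Finset.mul_sum (s := Finset.range T)]
            exact Finset.sum_comm
        _ ≤ ∑ t ∈ Finset.range T, (H : ℝ) ^ 2 := Finset.sum_le_sum fun t _ =>
            sum_reach_actionValue_le (pol t ω) π (pol t ω i) π
        _ = _ := by simp [mul_comm]
    -- Every error is a multiple of `A x`, `B x` or the inverse balanced weight. Summed with the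
    -- reach of `π`, the first two give at most `H² T`, the last gives `X_i A_i`.
    have hlocal : ∀ x, A x - B x ≤ κ * A x + κ * B x + 2 * (H * ι / κ * (1 / G.balancedWeight x)) +
        Real.log (Fintype.card (G.A i)) / η i * (1 / G.balancedWeight x) +
        η i * H / 2 * (2 * A x + H * ι * (1 / G.balancedWeight x)) := by
      intro x
      have hl := hG.local_regret_le hT0 hη0 ω π x
      rw [Finset.sum_sub_distrib] at hl
      have h3' : (∑ t ∈ Finset.range T, ∑ a, (π x).1 a * cfrEstimate play t ω x a) - B x ≤
          κ * B x + H / G.balancedWeight x * ι / κ := by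
        have e : ∀ f : ℕ → G.A i → ℝ, ∑ t ∈ Finset.range T, ∑ a, (π x).1 a * f t a =
            ∑ a, (π x).1 a * ∑ t ∈ Finset.range T, f t a := fun f => by
          rw [Finset.sum_comm]
          simp only [Finset.mul_sum]
        simp only [B]
        rw [e, e]
        calc _ = ∑ a, (π x).1 a * ((∑ t ∈ Finset.range T, cfrEstimate play t ω x a) -
              ∑ t ∈ Finset.range T, cfrValue pol t ω x a) := by
              simp only [mul_sub, Finset.sum_sub_distrib]
          _ ≤ ∑ a, (π x).1 a * (κ * (∑ t ∈ Finset.range T, cfrValue pol t ω x a) +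
              H / G.balancedWeight x * ι / κ) := Finset.sum_le_sum fun a _ =>
              mul_le_mul_of_nonneg_left (h3 (x, a)) (G.policy_nonneg π x a)
          _ = _ := by
              simp only [mul_add, Finset.sum_add_distrib, ← Finset.sum_mul, G.policy_sum, one_mul,
                mul_left_comm _ κ, ← Finset.mul_sum]
      have h1' := h1 x
      have h2' := h2 x
      have h4 := mul_le_mul_of_nonneg_left (sub_le_iff_le_add.1 h2')
        (div_nonneg (mul_nonneg hη0.le (Nat.cast_nonneg H)) zero_le_two)
      have e1 : H / G.balancedWeight x * ι / κ = H * ι / κ * (1 / G.balancedWeight x) := by ring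
      have e2 : H / G.balancedWeight x * ι = H * ι * (1 / G.balancedWeight x) := by ring
      have e3 : Real.log (Fintype.card (G.A i)) / (η i * G.balancedWeight x) =
        Real.log (Fintype.card (G.A i)) / η i * (1 / G.balancedWeight x) := by
        rw [div_mul_div_comm, mul_one]
      rw [e1] at h1' h3'
      rw [e2] at h4
      rw [e3] at hl
      change -(_ - A x) ≤ κ * A x + _ at h1'
      change _ ≤ η i * H / 2 * (A x + _ + A x) at h4
      linarith
    have htot := Finset.sum_le_sum fun x (_ : x ∈ Finset.univ) =>
      mul_le_mul_of_nonneg_left (hlocal x) (G.reach_nonneg π x)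
    have hexp : ∑ x, G.reach π x * (κ * A x + κ * B x +
        2 * (H * ι / κ * (1 / G.balancedWeight x)) +
        Real.log (Fintype.card (G.A i)) / η i * (1 / G.balancedWeight x) +
        η i * H / 2 * (2 * A x + H * ι * (1 / G.balancedWeight x))) =
        κ * (∑ x, G.reach π x * A x) + κ * (∑ x, G.reach π x * B x) +
        2 * (H * ι / κ * G.size i) + Real.log (Fintype.card (G.A i)) / η i * G.size i +
        η i * H / 2 * (2 * (∑ x, G.reach π x * A x) + H * ι * G.size i) := by
      rw [← G.sum_reach_div π]
      simp only [Finset.mul_sum, ← Finset.sum_add_distrib]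
      exact Finset.sum_congr rfl fun x _ => by ring
    rw [hexp, ← hreg] at htot
    have h5 := mul_le_mul_of_nonneg_left hsumA hκ0.le
    have h6 := mul_le_mul_of_nonneg_left hsumB hκ0.le
    have h7 := mul_le_mul_of_nonneg_left hsumA
      (mul_nonneg hη0.le (Nat.cast_nonneg H : (0 : ℝ) ≤ H))
    linarith
  · simp only [Finset.sum_const, Finset.card_univ, Fintype.card_prod, nsmul_eq_mul]
    rw [← add_mul, ← add_mul]
    gcongr
    have h1 : Fintype.card (G.X i) ≤ G.size i := Nat.le_mul_of_pos_right _ Fintype.card_pos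
    have : Fintype.card (G.X i) + (Fintype.card (G.X i) +
        Fintype.card (G.X i) * Fintype.card (G.A i)) ≤ 3 * G.size i := by
      change Fintype.card (G.X i) + (Fintype.card (G.X i) + G.size i) ≤ _
      omega
    exact_mod_cast this

end IIEFG

/-! ### Conclusion: constants and the number of episodes. -/

/-- The size of the logarithmic factor. -/
theorem one_lt_log_factor {a s δ : ℝ} (ha : 3 ≤ a) (hs : 1 ≤ s) (hδ : 0 < δ) (hδ1 : δ < 1) :
    s ≤ a * s / δ ∧ 3 * s * Real.exp (-Real.log (a * s / δ)) ≤ δ ∧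
      1 < Real.log (a * s / δ) := by
  have h0 : 0 < a * s / δ := by positivity
  have h1 : 3 * s ≤ a * s / δ := by
    rw [le_div_iff₀ hδ]
    calc 3 * s * δ ≤ a * s * 1 := by gcongr
      _ = a * s := mul_one _
  refine ⟨by linarith, ?_, ?_⟩
  · rw [Real.exp_neg, Real.exp_log h0, ← div_eq_mul_inv, div_le_iff₀ h0, mul_div_cancel₀ _ hδ.ne']
    gcongr
  · rw [Real.lt_log_iff_exp_lt h0]
    linarith [Real.exp_one_lt_d9]

theorem theorem6 :
    (∃ C : ℝ, 0 < C ∧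
      ∀ (m H : ℕ) (_ : 0 < m) (G : IIEFG.{u} m H)
        (Ω : Type v) [MeasurableSpace Ω] (P : Measure Ω) [IsProbabilityMeasure P]
        (T : ℕ) [NeZero T] (ε δ ι : ℝ) (η γ : Fin m → ℝ) (play : G.Play P T),
        0 < ε → 0 < δ → δ < 1 →
        ι = Real.log (3 * H * G.sumSize / δ) →
        (∀ i, η i = √(G.size i * Real.log (Fintype.card (G.A i)) / (H ^ 3 * T))) →
        (∀ i, γ i = √(G.size i * ι / (H * T))) →
        G.IsBalancedOMD T η γ play →
        C * (H ^ 3 * ι * G.maxSize / ε ^ 2) ≤ T →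
        ENNReal.ofReal (1 - δ) ≤
          P {ω | G.IsNFCCE ε (G.uniformMixture T fun t => play.profile t ω)}) ∧
    (∃ C C' : ℝ, 0 < C ∧ 0 < C' ∧
      ∀ (m H : ℕ) (_ : 0 < m) (G : IIEFG.{u} m H)
        (Ω : Type v) [MeasurableSpace Ω] (P : Measure Ω) [IsProbabilityMeasure P]
        (T N : ℕ) [NeZero T] (ε δ ι : ℝ) (η : Fin m → ℝ) (pol : ℕ → Ω → G.Profile)
        (play : G.Play P N),
        0 < ε → 0 < δ → δ < 1 →
        ι = Real.log (10 * G.sumSize / δ) →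
        (∀ i, η i = √(G.size i * ι / (H ^ 3 * T))) →
        G.IsBalancedCFR T N η pol play →
        (C * (H ^ 3 * ι * G.maxSize / ε ^ 2) ≤ T →
          ENNReal.ofReal (1 - δ) ≤
            P {ω | G.IsNFCCE ε (G.uniformMixture T fun t => pol t ω)}) ∧
        N = m * H * T ∧
        (ε ≤ H → T = ⌈C * (H ^ 3 * ι * G.maxSize / ε ^ 2)⌉₊ →
          (N : ℝ) ≤ C' * (H ^ 4 * m * ι * G.maxSize / ε ^ 2))) := by
  have hmax : ∀ {m H : ℕ} (G : IIEFG.{u} m H) (i : Fin m) {ε ι T : ℝ}, 0 < ε → 0 < ι →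
      64 * (H ^ 3 * ι * G.maxSize / ε ^ 2) ≤ T → 64 * (H ^ 3 * ι * G.size i / ε ^ 2) ≤ T := by
    intro m H G i ε ι T hε hι hT
    refine le_trans ?_ hT
    have : (G.size i : ℝ) ≤ G.maxSize := by exact_mod_cast G.size_le_maxSize i
    gcongr
  have hsum : ∀ {m H : ℕ} (_ : 0 < m) (G : IIEFG.{u} m H), (1 : ℝ) ≤ G.sumSize := by
    intro m H hm G
    exact_mod_cast (G.size_pos ⟨0, hm⟩).trans_le (G.size_le_sumSize _)
  have hlog : ∀ {m H : ℕ} (G : IIEFG.{u} m H) (i : Fin m) {B : ℝ}, G.sumSize ≤ B →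
      Real.log (Fintype.card (G.A i)) ≤ Real.log B := by
    intro m H G i B hB
    refine Real.log_le_log G.card_action_pos (le_trans ?_ hB)
    exact_mod_cast (G.card_action_le_size i).trans (G.size_le_sumSize i)
  -- The constant `64` comes from the rate lemmas; `128` is its double, which absorbs the rounding
  -- up of `T`.
  refine ⟨⟨64, by norm_num, ?_⟩, 64, 128, by norm_num, by norm_num, ?_⟩
  · intro m H hm G Ω _ P _ T _ ε δ ι η γ play hε hδ hδ1 hι hη hγ hG hT
    have hH1 : (1 : ℝ) ≤ H := by exact_mod_cast G.horizon_pos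
    obtain ⟨h1, h2, h3⟩ := one_lt_log_factor (a := 3 * H) (by linarith) (hsum hm G) hδ hδ1
    rw [← hι] at h2 h3
    have hι0 : 0 < ι := by linarith
    refine G.measure_isNFCCE_ge hm _ (fun i => ?_) h2
    exact hG.measure_regret_le hε i (hι ▸ hlog G i h1) hι0 (hη i) (hγ i) (hmax G i hε hι0 hT)
  · intro m H hm G Ω _ P _ T N _ ε δ ι η pol play hε hδ hδ1 hι hη hG
    have hH1 : (1 : ℝ) ≤ H := by exact_mod_cast G.horizon_pos
    obtain ⟨h1, h2, h3⟩ := one_lt_log_factor (a := 10) (by norm_num) (hsum hm G) hδ hδ1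
    rw [← hι] at h2 h3
    have hι0 : 0 < ι := by linarith
    refine ⟨fun hT => G.measure_isNFCCE_ge hm _ (fun i => ?_) h2, hG.episodes_eq, fun hεH hT => ?_⟩
    · exact hG.measure_regret_le hε i (hι ▸ hlog G i h1) hι0 (hη i) (hmax G i hε hι0 hT)
    · have hM : (1 : ℝ) ≤ G.maxSize := by
        exact_mod_cast (G.size_pos ⟨0, hm⟩).trans_le (G.size_le_maxSize _)
      set y : ℝ := 64 * (H ^ 3 * ι * G.maxSize / ε ^ 2) with hy
      -- The assumption `ε ≤ H` and `ι > 1` enter here: the ceiling is below `y + 1`, hence at most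
      -- `2 * y`.
      have hy1 : 1 ≤ y := by
        have h4 : ε ^ 2 ≤ H ^ 3 * ι * G.maxSize := by
          calc ε ^ 2 ≤ (H : ℝ) ^ 2 := by gcongr
            _ ≤ (H : ℝ) ^ 3 := pow_le_pow_right₀ hH1 (by norm_num)
            _ = (H : ℝ) ^ 3 * 1 * 1 := by ring
            _ ≤ (H : ℝ) ^ 3 * ι * G.maxSize := by gcongr
        have h5 : 1 ≤ H ^ 3 * ι * G.maxSize / ε ^ 2 := by
          rwa [one_le_div (by positivity)]
        linarith
      have hTy : (T : ℝ) ≤ 2 * y := by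
        have := Nat.ceil_lt_add_one (by linarith : 0 ≤ y)
        rw [← hT] at this
        linarith
      rw [hG.episodes_eq]
      push_cast
      calc (m : ℝ) * H * T ≤ m * H * (2 * y) := by gcongr
        _ = 128 * (H ^ 4 * m * ι * G.maxSize / ε ^ 2) := by
          rw [hy]
          ring
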